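/- **Conventions.** Let $\Bbbk$ be a field and $\otimes=\otimes_\Bbbk$. A *weak bialgebra* is a $\Bbbk$-vector space $H$ that is both a (unital, associative) algebra and a (counital, coassociative) coalgebra such that, for all $a,b,c\in H$, $$\Delta(ab)=\Delta(a)\Delta(b),\qquad \varepsilon(abc)=\varepsilon(ab_1)\varepsilon(b_2c)=\varepsilon(ab_2)\varepsilon(b_1c),$$ $$\Delta^2(1)=(\Delta(1)\otimes 1)(1\otimes\Delta(1))=(1\otimes\Delta(1))(\Delta(1)\otimes 1).$$ A *weak bialgebra map* is a unital algebra map that is also a coalgebra map. Put $\varepsilon_s(h)=1_1\varepsilon(h1_2)$, $\varepsilon_t(h)=\varepsilon(1_1h)1_2$, $H_s=\varepsilon_s(H)$, $H_t=\varepsilon_t(H)$. A *biideal* of $H$ is a two-sided ideal $\mathcal I$ with $\Delta(\mathcal I)\subseteq \mathcal I\otimes H+H\otimes\mathcal I$ and $\varepsilon(\mathcal I)=0$; then $H/\mathcal I$ is a weak bialgebra with the induced structure. Let $A=\bigoplus_{n\ge0}A_n$ be a graded algebra with all $A_n$ finite-dimensional and $A_0$ commutative and separable. A *linear left $H$-comodule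 algebra structure* on $A$ is a coassociative, counital map $\lambda:A\to H\otimes A$ with $\lambda(ab)=\lambda(a)\lambda(b)$, $\lambda(1)\in H_s\otimes A$ and $\lambda(A_n)\subseteq H\otimes A_n$ for all $n$; a *linear right $H$-comodule algebra structure* is a coassociative, counital map $\rho:A\to A\otimes H$ with $\rho(ab)=\rho(a)\rho(b)$, $\rho(1)\in A\otimes H_t$ and $\rho(A_n)\subseteq A_n\otimes H$ for all $n$. Given both, $A$ is a *transposed $H$-comodule algebra* if each $A_n$ has a basis $(v_j)$ such that $\lambda(v_j)=\sum_l z_{j,l}\otimes v_l$ and $\rho(v_j)=\sum_l v_l\otimes z_{l,j}$ with the same elements $z_{j,l}\in H$. The algebra $H_t$ (resp. $H_s$) is a left (resp. right) $H$-comodule algebra via $\Delta$. A *left UQSGd* (universal quantum linear semigroupoid) $\mathcal O^{\rm left}(A)$ of $A$ is a weak bialgebra $\mathcal O$ with a linear left $\mathcal O$-comodule algebra structure $\lambda^{\mathcal O}$ on $A$ for which $A_0\cong\mathcal O_t$ as left $\mathcal O$-comodule algebras, such that for every weak bialgebra $H$ and every linear left $H$-comodule algebra structure $\lambda^H$ on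 $A$ with $A_0\cong H_t$ as left $H$-comodule algebras there is a unique weak bialgebra map $\pi:\mathcal O\to H$ with $(\pi\otimes\mathrm{id}_A)\lambda^{\mathcal O}=\lambda^H$. A *right UQSGd* $\mathcal O^{\rm right}(A)$ is defined in the same way with linear right comodule algebra structures $\rho$, the condition $A_0\cong H_s$ as right $H$-comodule algebras, and $(\mathrm{id}_A\otimes\pi)\rho^{\mathcal O}=\rho^H$. A *transposed UQSGd* $\mathcal O^{\rm trans}(A)$ is defined in the same way with pairs $(\lambda,\rho)$ making $A$ a transposed comodule algebra, both conditions $A_0\cong H_t$ (left) and $A_0\cong H_s$ (right), and both compatibilities for $\pi$. Let $Q$ be a finite quiver with path algebra $\Bbbk Q$, graded by path length, and let $Q_\ell$ be the set of paths of length $\ell$. *Hayashi's face algebra* $\mathfrak H(Q)$ is the weak bialgebra with basis $x_{a,b}$, $a,b\in Q_\ell$, $\ell\ge0$, with $$x_{a,b}x_{a',b'}=\delta_{t(a),s(a')}\delta_{t(b),s(b')}x_{aa',bb'},\quad 1=\sum_{i,j\in Q_0}x_{i,j},\quad \Delta(x_{a,b})=\sum_{c\in Q_\ell}x_{a,c}\otimes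 x_{c,b},\quad \varepsilon(x_{a,b})=\delta_{a,b};$$ as an algebra it is generated by the $x_{i,j}$ ($i,j\in Q_0$) and $x_{p,q}$ ($p,q\in Q_1$) subject to $\sum_{i,j}x_{i,j}=1$, $x_{i,j}x_{k,\ell}=\delta_{i,k}\delta_{j,\ell}x_{i,j}$ and $x_{s(p),s(q)}x_{p,q}=x_{p,q}=x_{p,q}x_{t(p),t(q)}$. **Proposition.** Let $Q$ be a finite quiver and let $I\subseteq\Bbbk Q$ be a graded (two-sided) ideal generated in degree $2$ or greater. Let $*\in\{\text{left},\text{right},\text{trans}\}$ and suppose that $\mathcal O^{*}(\Bbbk Q/I)$ exists. Then there are a surjective weak bialgebra map $\pi:\mathfrak H(Q)\to\mathcal O^*(\Bbbk Q/I)$ and a biideal $\mathcal I$ of $\mathfrak H(Q)$ such that $\pi$ induces an isomorphism of weak bialgebras $$\mathfrak H(Q)/\mathcal I\;\cong\;\mathcal O^*(\Bbbk Q/I).$$ -/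

import Mathlib

open scoped TensorProduct

universe u v w

/-- A set `X` of paths over a set `V` of vertices: every element has a source and a target, there is
a trivial path at every vertex, and `comp a b` is the concatenation (first `a`, then `b`) of paths
with `tgt a = src b`; concatenation is associative and trivial paths are neutral. -/
class Concatenation (X : Type*) (V : outParam Type*) where
  src : X → V
  tgt : X → V
  triv : V → X
  comp : ∀ a b : X, tgt a = src b → X
  src_triv : ∀ v, src (triv v) = v
  tgt_triv : ∀ v, tgt (triv v) = v
  src_comp : ∀ a b h, src (comp a b h) = src a
  tgt_comp : ∀ a b h, tgt (comp a b h) = tgt b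
  triv_comp : ∀ v a h, comp (triv v) a h = a
  comp_triv : ∀ a v h, comp a (triv v) h = a
  comp_assoc : ∀ a b c h₁ h₂ h₃ h₄, comp (comp a b h₁) c h₂ = comp a (comp b c h₃) h₄

/-- The `k`-vector space with basis `X`, a set of paths; it becomes a `k`-algebra below, with the
product given on basis elements by concatenation where defined and by zero otherwise. -/
def ConcatAlgebra (k : Type*) (X : Type*) [Field k] : Type _ := X →₀ k

namespace ConcatAlgebra

noncomputable section

variable {k X V : Type*} [Field k]

instance : AddCommGroup (ConcatAlgebra k X) := inferInstanceAs (AddCommGroup (X →₀ k))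

instance : Module k (ConcatAlgebra k X) := inferInstanceAs (Module k (X →₀ k))

variable (k) in
/-- The basis of the algebra, indexed by `X`. -/
def basis : Module.Basis X k (ConcatAlgebra k X) := ⟨LinearEquiv.refl k (X →₀ k)⟩

open Classical in
variable (k) in
/-- The product of two basis elements: `ab` if `tgt a = src b`, and zero otherwise. -/
def basisMul [Concatenation X V] (a b : X) : ConcatAlgebra k X :=
  if h : Concatenation.tgt a = Concatenation.src b then basis k (Concatenation.comp a b h) else 0

/-- The bilinear extension of the product of basis elements. -/
def mulHom [Concatenation X V] :
    ConcatAlgebra k X →ₗ[k] ConcatAlgebra k X →ₗ[k] ConcatAlgebra k X :=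
  (basis k).constr k fun a => (basis k).constr k fun b => basisMul k a b

instance [Concatenation X V] : Mul (ConcatAlgebra k X) := ⟨fun f g => mulHom f g⟩

/-- The unit is the sum of the trivial paths. -/
instance [Concatenation X V] [Fintype V] : One (ConcatAlgebra k X) :=
  ⟨∑ v : V, basis k (Concatenation.triv v)⟩

theorem mul_def [Concatenation X V] (f g : ConcatAlgebra k X) : f * g = mulHom f g := rfl

theorem one_def [Concatenation X V] [Fintype V] :
    (1 : ConcatAlgebra k X) = ∑ v : V, basis k (Concatenation.triv v) := rfl

theorem basis_mul_basis [Concatenation X V] (a b : X) :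
    basis k a * basis k b = basisMul k a b := by
  simp [mul_def, mulHom, Module.Basis.constr_basis]

theorem basisMul_of_eq [Concatenation X V] {a b : X}
    (h : Concatenation.tgt a = Concatenation.src b) :
    basisMul k a b = basis k (Concatenation.comp a b h) := dif_pos h

theorem basisMul_of_ne [Concatenation X V] {a b : X}
    (h : Concatenation.tgt a ≠ Concatenation.src b) :
    basisMul k a b = 0 := dif_neg h

theorem assoc_aux [Concatenation X V] (a b c : X) :
    mulHom (basisMul k a b) (basis k c) = mulHom (basis k a) (basisMul k b c) := by
  by_cases h₁ : Concatenation.tgt a = Concatenation.src b <;>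
  by_cases h₂ : Concatenation.tgt b = Concatenation.src c
  · have h₃ : Concatenation.tgt (Concatenation.comp a b h₁) = Concatenation.src c := by
      rw [Concatenation.tgt_comp, h₂]
    have h₄ : Concatenation.tgt a = Concatenation.src (Concatenation.comp b c h₂) := by
      rw [Concatenation.src_comp, h₁]
    rw [basisMul_of_eq h₁, basisMul_of_eq h₂, ← mul_def, ← mul_def, basis_mul_basis,
      basis_mul_basis, basisMul_of_eq h₃, basisMul_of_eq h₄, Concatenation.comp_assoc]
  · have h₃ : Concatenation.tgt (Concatenation.comp a b h₁) ≠ Concatenation.src c := by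
      rwa [Concatenation.tgt_comp]
    rw [basisMul_of_eq h₁, basisMul_of_ne h₂, ← mul_def, basis_mul_basis, basisMul_of_ne h₃,
      map_zero]
  · have h₄ : Concatenation.tgt a ≠ Concatenation.src (Concatenation.comp b c h₂) := by
      rwa [Concatenation.src_comp]
    rw [basisMul_of_ne h₁, basisMul_of_eq h₂, ← mul_def, ← mul_def, basis_mul_basis,
      basisMul_of_ne h₄, mul_def, map_zero, LinearMap.zero_apply]
  · rw [basisMul_of_ne h₁, basisMul_of_ne h₂, map_zero, map_zero, LinearMap.zero_apply]

theorem induction_basis {p : ConcatAlgebra k X → Prop} (hb : ∀ a, p (basis k a)) (h0 : p 0)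
    (ha : ∀ f g, p f → p g → p (f + g)) (hs : ∀ (c : k) f, p f → p (c • f)) (f) : p f :=
  Submodule.span_induction (p := fun f _ => p f) (by rintro _ ⟨a, rfl⟩; exact hb a) h0
    (fun f g _ _ => ha f g) (fun c f _ => hs c f) ((basis k).mem_span f)

theorem mulHom_assoc [Concatenation X V] (f g h : ConcatAlgebra k X) :
    mulHom (mulHom f g) h = mulHom f (mulHom g h) := by
  induction f using induction_basis with
  | h0 => simp
  | ha f f' hf hf' => simp [hf, hf']
  | hs c f hf => simp [hf]
  | hb a =>
    induction g using induction_basis with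
    | h0 => simp
    | ha f f' hf hf' => simp [hf, hf']
    | hs c f hf => simp [hf]
    | hb b =>
      induction h using induction_basis with
      | h0 => simp
      | ha f f' hf hf' => simp [hf, hf']
      | hs c f hf => simp [hf]
      | hb c =>
        rw [← mul_def (basis k a), ← mul_def (basis k b), basis_mul_basis, basis_mul_basis,
          assoc_aux]

theorem one_mulHom [Concatenation X V] [Fintype V] (f : ConcatAlgebra k X) :
    mulHom 1 f = f := by
  induction f using induction_basis with
  | h0 => simp
  | ha f f' hf hf' => simp [hf, hf']
  | hs c f hf => simp [hf]
  | hb a =>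
    rw [one_def, map_sum, LinearMap.sum_apply, Finset.sum_eq_single (Concatenation.src a)]
    · rw [← mul_def, basis_mul_basis, basisMul_of_eq (Concatenation.tgt_triv _),
        Concatenation.triv_comp]
    · intro v _ hv
      rw [← mul_def, basis_mul_basis, basisMul_of_ne]
      rwa [Concatenation.tgt_triv]
    · simp

theorem mulHom_one [Concatenation X V] [Fintype V] (f : ConcatAlgebra k X) :
    mulHom f 1 = f := by
  induction f using induction_basis with
  | h0 => simp
  | ha f f' hf hf' => simp [hf, hf']
  | hs c f hf => simp [hf]
  | hb a =>
    rw [one_def, map_sum, Finset.sum_eq_single (Concatenation.tgt a)]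
    · rw [← mul_def, basis_mul_basis, basisMul_of_eq (Concatenation.src_triv _).symm,
        Concatenation.comp_triv]
    · intro v _ hv
      rw [← mul_def, basis_mul_basis, basisMul_of_ne]
      rw [Concatenation.src_triv]
      exact hv.symm
    · simp

instance [Concatenation X V] [Fintype V] : Ring (ConcatAlgebra k X) where
  __ := (inferInstance : AddCommGroup (ConcatAlgebra k X))
  mul := (· * ·)
  one := 1
  mul_assoc := mulHom_assoc
  one_mul := one_mulHom
  mul_one := mulHom_one
  zero_mul f := by rw [mul_def, map_zero, LinearMap.zero_apply]
  mul_zero f := by rw [mul_def, map_zero]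
  left_distrib f g h := by rw [mul_def, map_add]; rfl
  right_distrib f g h := by rw [mul_def, map_add]; rfl

instance [Concatenation X V] [Fintype V] : Algebra k (ConcatAlgebra k X) :=
  Algebra.ofModule (fun c f g => by rw [mul_def, map_smul]; rfl)
    (fun c f g => by rw [mul_def, map_smul]; rfl)

end

end ConcatAlgebra

/-- A path in the quiver `Q`, with its source and target (trivial paths included). -/
structure QPath (Q : Type u) [Quiver.{v} Q] where
  {src : Q}
  {tgt : Q}
  path : Quiver.Path src tgt

namespace QPath

variable {Q : Type u} [Quiver.{v} Q]

/-- The number of arrows of a path. -/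
def length (a : QPath Q) : ℕ := a.path.length

/-- Concatenation of paths, read from left to right. -/
instance : Concatenation (QPath Q) Q where
  src := QPath.src
  tgt := QPath.tgt
  triv i := ⟨(Quiver.Path.nil : Quiver.Path i i)⟩
  comp a b h := ⟨a.path.comp (b.path.cast h.symm rfl)⟩
  src_triv _ := rfl
  tgt_triv _ := rfl
  src_comp _ _ _ := rfl
  tgt_comp _ _ _ := rfl
  triv_comp := by
    rintro v ⟨p⟩ h
    cases h
    simp
  comp_triv := by
    rintro ⟨p⟩ v h
    cases h
    simp
  comp_assoc := by
    rintro ⟨p⟩ ⟨q⟩ ⟨r⟩ h₁ h₂ h₃ h₄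
    cases h₁
    cases h₃
    simp

/-- An arrow as a path of length one. -/
def arrow {i j : Q} (p : i ⟶ j) : QPath Q := ⟨p.toPath⟩

theorem length_triv (i : Q) : length (Concatenation.triv i : QPath Q) = 0 := rfl

theorem length_comp (a b : QPath Q) (h) :
    length (Concatenation.comp a b h) = a.length + b.length := by
  rcases a with ⟨p⟩
  rcases b with ⟨q⟩
  change _ = _ at h
  cases h
  exact Quiver.Path.length_comp p q

theorem finite_length [Finite Q] [∀ i j : Q, Finite (i ⟶ j)] (n : ℕ) :
    {a : QPath Q | a.length = n}.Finite := by
  induction n with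
  | zero =>
    refine (Set.finite_range fun i : Q => (Concatenation.triv i : QPath Q)).subset ?_
    rintro ⟨p⟩ h
    cases p with
    | nil => exact ⟨_, rfl⟩
    | cons p e => cases h
  | succ n ih =>
    refine (ih.biUnion fun a _ => Set.finite_iUnion fun j : Q =>
      Set.finite_range fun e : a.tgt ⟶ j => (⟨a.path.cons e⟩ : QPath Q)).subset ?_
    rintro ⟨p⟩ h
    cases p with
    | nil => cases h
    | cons p e =>
      simp only [Set.mem_iUnion]
      exact ⟨⟨p⟩, Nat.succ.inj h, _, e, rfl⟩

/-- The finite set `Q_n` of paths of length `n` in a finite quiver. -/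
noncomputable def ofLength (Q : Type u) [Quiver.{v} Q] [Finite Q] [∀ i j : Q, Finite (i ⟶ j)]
    (n : ℕ) : Finset (QPath Q) := (finite_length n).toFinset

theorem mem_ofLength [Finite Q] [∀ i j : Q, Finite (i ⟶ j)] {n : ℕ} {a : QPath Q} :
    a ∈ ofLength Q n ↔ a.length = n := by simp [ofLength]

end QPath

/-- A pair `(a, b)` of paths of the same length; it indexes the basis element `x_{a,b}` of the face
algebra. -/
structure QPathPair (Q : Type u) [Quiver.{v} Q] where
  fst : QPath Q
  snd : QPath Q
  length_eq : fst.length = snd.length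

namespace QPathPair

variable {Q : Type u} [Quiver.{v} Q]

/-- Pairs of paths are concatenated componentwise. -/
instance : Concatenation (QPathPair Q) (Q × Q) where
  src w := (w.fst.src, w.snd.src)
  tgt w := (w.fst.tgt, w.snd.tgt)
  triv i := ⟨Concatenation.triv i.1, Concatenation.triv i.2, rfl⟩
  comp w z h := ⟨Concatenation.comp w.fst z.fst (congrArg Prod.fst h),
    Concatenation.comp w.snd z.snd (congrArg Prod.snd h), by
      rw [QPath.length_comp, QPath.length_comp, w.length_eq, z.length_eq]⟩
  src_triv _ := rfl
  tgt_triv _ := rfl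
  src_comp _ _ _ := rfl
  tgt_comp _ _ _ := rfl
  triv_comp v w h := by
    rcases w with ⟨a, b, hw⟩
    congr 1
    · exact Concatenation.triv_comp _ a _
    · exact Concatenation.triv_comp _ b _
  comp_triv w v h := by
    rcases w with ⟨a, b, hw⟩
    congr 1
    · exact Concatenation.comp_triv a _ _
    · exact Concatenation.comp_triv b _ _
  comp_assoc w z y h₁ h₂ h₃ h₄ := by
    congr 1
    · exact Concatenation.comp_assoc w.fst z.fst y.fst _ _ _ _
    · exact Concatenation.comp_assoc w.snd z.snd y.snd _ _ _ _

end QPathPair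

/-- The path algebra `kQ`: basis the paths of `Q`, product the concatenation of paths (read from left
to right) or zero, unit the sum of the trivial paths `e_i`. -/
abbrev PathAlgebra (k : Type*) (Q : Type u) [Field k] [Quiver.{v} Q] :=
  ConcatAlgebra k (QPath Q)

/-- The underlying algebra of the face algebra `H(Q)` attached to a quiver: basis the elements
`x_{a,b}` for paths `a`, `b` of the same length, product
`x_{a,b} x_{a',b'} = δ_{t(a),s(a')} δ_{t(b),s(b')} x_{aa',bb'}`, unit `∑ x_{i,j}` over all vertices
`i`, `j`. See `FaceAlgebra.existsUnique_algHom` for its presentation by generators and relations. -/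
abbrev FaceAlgebra (k : Type*) (Q : Type u) [Field k] [Quiver.{v} Q] :=
  ConcatAlgebra k (QPathPair Q)

/-- A weak bialgebra over `k`: an algebra and a coalgebra such that `Δ(ab) = Δ(a)Δ(b)`,
`ε(abc) = ε(a b₁) ε(b₂ c) = ε(a b₂) ε(b₁ c)` and
`Δ²(1) = (Δ(1) ⊗ 1)(1 ⊗ Δ(1)) = (1 ⊗ Δ(1))(Δ(1) ⊗ 1)`. A weak bialgebra map is a (unital) algebra map
that is also a coalgebra map, i.e. an element of `H →ₐc[k] K`. -/
class WeakBialgebra (k H : Type*) [Field k] [Ring H] [Algebra k H] [Coalgebra k H] : Prop where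
  comul_mul : ∀ a b : H,
    Coalgebra.comul (R := k) (a * b) = Coalgebra.comul (R := k) a * Coalgebra.comul (R := k) b
  counit_mul_mul₁ : ∀ a b c : H, Coalgebra.counit (R := k) (a * b * c) =
    LinearMap.mul' k k (TensorProduct.map
      (Coalgebra.counit ∘ₗ LinearMap.mulLeft k a) (Coalgebra.counit ∘ₗ LinearMap.mulRight k c)
      (Coalgebra.comul (R := k) b))
  counit_mul_mul₂ : ∀ a b c : H, Coalgebra.counit (R := k) (a * b * c) =
    LinearMap.mul' k k (TensorProduct.map
      (Coalgebra.counit ∘ₗ LinearMap.mulRight k c) (Coalgebra.counit ∘ₗ LinearMap.mulLeft k a)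
      (Coalgebra.comul (R := k) b))
  comul_comul_one₁ :
    TensorProduct.map LinearMap.id Coalgebra.comul (Coalgebra.comul (R := k) (1 : H)) =
      TensorProduct.assoc k H H H (Coalgebra.comul (R := k) (1 : H) ⊗ₜ[k] (1 : H)) *
        ((1 : H) ⊗ₜ[k] Coalgebra.comul (R := k) (1 : H))
  comul_comul_one₂ :
    TensorProduct.map LinearMap.id Coalgebra.comul (Coalgebra.comul (R := k) (1 : H)) =
      ((1 : H) ⊗ₜ[k] Coalgebra.comul (R := k) (1 : H)) *
        TensorProduct.assoc k H H H (Coalgebra.comul (R := k) (1 : H) ⊗ₜ[k] (1 : H))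

namespace FaceAlgebra

noncomputable section

open Classical in
/-- The element `x_{a,b}` of the face algebra for paths `a`, `b` of the same length (and zero for
paths of different lengths). -/
def x (k : Type*) {Q : Type u} [Field k] [Quiver.{v} Q] (a b : QPath Q) : FaceAlgebra k Q :=
  if h : a.length = b.length then ConcatAlgebra.basis k ⟨a, b, h⟩ else 0

variable {k : Type*} [Field k] {Q : Type u} [Quiver.{v} Q]

theorem x_of_eq {a b : QPath Q} (h : a.length = b.length) :
    x k a b = ConcatAlgebra.basis k ⟨a, b, h⟩ := dif_pos h

theorem x_of_ne {a b : QPath Q} (h : a.length ≠ b.length) : x k a b = 0 := dif_neg h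

theorem basis_eq_x (w : QPathPair Q) : ConcatAlgebra.basis k w = x k w.fst w.snd :=
  (x_of_eq w.length_eq).symm

theorem x_mul_x_of_eq [Fintype Q] {a b a' b' : QPath Q} (h : a.length = b.length)
    (h' : a'.length = b'.length) (ha : Concatenation.tgt a = Concatenation.src a')
    (hb : Concatenation.tgt b = Concatenation.src b') :
    x k a b * x k a' b' = x k (Concatenation.comp a a' ha) (Concatenation.comp b b' hb) := by
  rw [x_of_eq h, x_of_eq h', ConcatAlgebra.basis_mul_basis,
    ConcatAlgebra.basisMul_of_eq (Prod.ext ha hb), x_of_eq]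
  rfl

theorem x_mul_x_of_ne_left [Fintype Q] {a b a' b' : QPath Q}
    (ha : Concatenation.tgt a ≠ Concatenation.src a') :
    x k a b * x k a' b' = 0 := by
  by_cases h : a.length = b.length
  · by_cases h' : a'.length = b'.length
    · rw [x_of_eq h, x_of_eq h', ConcatAlgebra.basis_mul_basis, ConcatAlgebra.basisMul_of_ne]
      exact fun e => ha (congrArg Prod.fst e)
    · rw [x_of_ne h', mul_zero]
  · rw [x_of_ne h, zero_mul]

theorem x_mul_x_of_ne_right [Fintype Q] {a b a' b' : QPath Q}
    (hb : Concatenation.tgt b ≠ Concatenation.src b') :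
    x k a b * x k a' b' = 0 := by
  by_cases h : a.length = b.length
  · by_cases h' : a'.length = b'.length
    · rw [x_of_eq h, x_of_eq h', ConcatAlgebra.basis_mul_basis, ConcatAlgebra.basisMul_of_ne]
      exact fun e => hb (congrArg Prod.snd e)
    · rw [x_of_ne h', mul_zero]
  · rw [x_of_ne h, zero_mul]

theorem one_eq [Fintype Q] : (1 : FaceAlgebra k Q) =
    ∑ i : Q, ∑ j : Q, x k (Concatenation.triv i) (Concatenation.triv j) := by
  rw [ConcatAlgebra.one_def, Fintype.sum_prod_type]
  refine Finset.sum_congr rfl fun i _ => Finset.sum_congr rfl fun j _ => ?_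
  rw [basis_eq_x]
  rfl

theorem hom_ext {M : Type*} [AddCommGroup M] [Module k M] {f g : FaceAlgebra k Q →ₗ[k] M}
    (h : ∀ a b, f (x k a b) = g (x k a b)) : f = g :=
  (ConcatAlgebra.basis k).ext fun w => by rw [basis_eq_x, h]

theorem path_comp_unique {s₁ m₁ t₁ s₂ m₂ t₂ : Q} (p : Quiver.Path s₁ m₁) (q : Quiver.Path s₂ m₂)
    (p' : Quiver.Path m₁ t₁) (q' : Quiver.Path m₂ t₂) (h' : p'.length = q'.length)
    (e : (⟨p.comp p'⟩ : QPath Q) = ⟨q.comp q'⟩) :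
    (⟨p⟩ : QPath Q) = ⟨q⟩ ∧ (⟨p'⟩ : QPath Q) = ⟨q'⟩ := by
  induction p' generalizing t₂ with
  | nil =>
    cases q' with
    | nil => exact ⟨e, by cases e; rfl⟩
    | cons _ _ => cases h'
  | cons p' f ih =>
    cases q' with
    | nil => cases h'
    | cons q' g =>
      rw [Quiver.Path.comp_cons, Quiver.Path.comp_cons] at e
      rw [QPath.mk.injEq] at e
      obtain ⟨e₁, e₂, e₃⟩ := e
      cases e₁
      cases e₂
      have e₃ := eq_of_heq e₃
      have h₁ := Quiver.Path.obj_eq_of_cons_eq_cons e₃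
      cases h₁
      have h₂ := eq_of_heq (Quiver.Path.heq_of_cons_eq_cons e₃)
      have h₃ := eq_of_heq (Quiver.Path.hom_heq_of_cons_eq_cons e₃)
      cases h₃
      obtain ⟨i₁, i₂⟩ := ih q' (Nat.succ.inj h') (by rw [h₂])
      cases i₂
      exact ⟨i₁, rfl⟩

theorem comp_unique {a b a' b' : QPath Q} (h' : a'.length = b'.length)
    (ha : Concatenation.tgt a = Concatenation.src a')
    (hb : Concatenation.tgt b = Concatenation.src b')
    (e : Concatenation.comp a a' ha = Concatenation.comp b b' hb) : a = b ∧ a' = b' := by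
  rcases a with ⟨p⟩
  rcases b with ⟨q⟩
  rcases a' with ⟨p'⟩
  rcases b' with ⟨q'⟩
  change _ = _ at ha hb
  cases ha
  cases hb
  exact path_comp_unique p q p' q' h' e

theorem exists_comp {l m : ℕ} (d : QPath Q) (hd : d.length = l + m) :
    ∃ (c c' : QPath Q) (h : Concatenation.tgt c = Concatenation.src c'),
      c.length = l ∧ c'.length = m ∧ Concatenation.comp c c' h = d := by
  induction m generalizing d with
  | zero => exact ⟨d, Concatenation.triv (Concatenation.tgt d), rfl, hd, rfl,
      Concatenation.comp_triv _ _ _⟩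
  | succ m ih =>
    rcases d with ⟨p⟩
    cases p with
    | nil => simp [QPath.length] at hd
    | cons p f =>
      obtain ⟨c, ⟨p'⟩, h, hc, hc', e⟩ := ih ⟨p⟩ (Nat.succ.inj hd)
      rcases c with ⟨q⟩
      change _ = _ at h
      cases h
      change (⟨q.comp p'⟩ : QPath Q) = ⟨p⟩ at e
      rw [QPath.mk.injEq] at e
      obtain ⟨e₁, e₂, e₃⟩ := e
      cases e₁
      cases e₂
      cases e₃
      exact ⟨⟨q⟩, ⟨p'.cons f⟩, rfl, hc, congrArg Nat.succ hc', rfl⟩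

section

variable [Fintype Q]

open Classical in
theorem x_triv_mul_x_triv (i j m n : Q) :
    x k (Concatenation.triv i) (Concatenation.triv j) *
      x k (Concatenation.triv m) (Concatenation.triv n) =
    if i = m then if j = n then x k (Concatenation.triv i) (Concatenation.triv j) else 0
      else 0 := by
  by_cases h : i = m
  · by_cases h' : j = n
    · subst h h'
      rw [if_pos rfl, if_pos rfl, x_mul_x_of_eq (a := Concatenation.triv i)
        (b := Concatenation.triv j) (a' := Concatenation.triv i) (b' := Concatenation.triv j)
        rfl rfl rfl rfl, Concatenation.triv_comp, Concatenation.triv_comp]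
    · rw [if_pos h, if_neg h', x_mul_x_of_ne_right h']
  · rw [if_neg h, x_mul_x_of_ne_left h]

/-- The defining relations between vertex generators and arrow generators. -/
theorem x_triv_mul_x_arrow {i j i' j' : Q} (p : i ⟶ j) (q : i' ⟶ j') :
    x k (Concatenation.triv i) (Concatenation.triv i') * x k (.arrow p) (.arrow q) =
        x k (.arrow p) (.arrow q) ∧
      x k (.arrow p) (.arrow q) * x k (Concatenation.triv j) (Concatenation.triv j') =
        x k (.arrow p) (.arrow q) := by
  constructor
  · have hp : Concatenation.tgt (Concatenation.triv i : QPath Q) =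
      Concatenation.src (QPath.arrow p) := rfl
    have hq : Concatenation.tgt (Concatenation.triv i' : QPath Q) =
      Concatenation.src (QPath.arrow q) := rfl
    rw [x_mul_x_of_eq (a := Concatenation.triv i) (b := Concatenation.triv i')
      (a' := .arrow p) (b' := .arrow q) rfl rfl hp hq, Concatenation.triv_comp,
      Concatenation.triv_comp]
  · have hp : Concatenation.tgt (QPath.arrow p) =
      Concatenation.src (Concatenation.triv j : QPath Q) := rfl
    have hq : Concatenation.tgt (QPath.arrow q) =
      Concatenation.src (Concatenation.triv j' : QPath Q) := rfl
    rw [x_mul_x_of_eq (a := .arrow p) (b := .arrow q) (a' := Concatenation.triv j)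
      (b' := Concatenation.triv j') rfl rfl hp hq, Concatenation.comp_triv,
      Concatenation.comp_triv]

section Presentation

variable {B : Type*} [Ring B] [Algebra k B] (y₀ : Q → Q → B)
  (y₁ : ∀ {i j i' j' : Q}, (i ⟶ j) → (i' ⟶ j') → B)

/-- The product of the values of the generators along a pair of paths. -/
def evalPair {s s' : Q} : ∀ {t t' : Q}, Quiver.Path s t → Quiver.Path s' t' → B
  | _, _, .nil, .nil => y₀ s s'
  | _, _, .cons p e, .cons q f => evalPair p q * y₁ e f
  | _, _, .nil, .cons _ _ => 0
  | _, _, .cons _ _, .nil => 0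

open Classical in
/-- As an algebra, `H(Q)` is presented by the generators `x_{i,j}` (`i, j` vertices) and `x_{p,q}`
(`p, q` arrows) and the relations `∑ x_{i,j} = 1`, `x_{i,j} x_{m,n} = δ_{i,m} δ_{j,n} x_{i,j}` and
`x_{s(p),s(q)} x_{p,q} = x_{p,q} = x_{p,q} x_{t(p),t(q)}`. -/
theorem existsUnique_algHom (h_one : ∑ i : Q, ∑ j : Q, y₀ i j = 1)
    (h_mul : ∀ i j m n, y₀ i j * y₀ m n = if i = m then if j = n then y₀ i j else 0 else 0)
    (h_src : ∀ {i j i' j' : Q} (p : i ⟶ j) (q : i' ⟶ j'), y₀ i i' * y₁ p q = y₁ p q)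
    (h_tgt : ∀ {i j i' j' : Q} (p : i ⟶ j) (q : i' ⟶ j'), y₁ p q * y₀ j j' = y₁ p q) :
    ∃! f : FaceAlgebra k Q →ₐ[k] B,
      (∀ i j, f (x k (Concatenation.triv i) (Concatenation.triv j)) = y₀ i j) ∧
      ∀ {i j i' j' : Q} (p : i ⟶ j) (q : i' ⟶ j'), f (x k (.arrow p) (.arrow q)) = y₁ p q := by
  have hl {s s' t t' : Q} (p : Quiver.Path s t) (q : Quiver.Path s' t') :
      y₀ s s' * evalPair y₀ y₁ p q = evalPair y₀ y₁ p q := by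
    induction p generalizing t' with
    | nil => cases q <;> simp [evalPair, h_mul]
    | cons p e ih =>
      cases q with
      | nil => simp [evalPair]
      | cons q f => rw [evalPair, ← mul_assoc, ih]
  have hr {s s' t t' : Q} (p : Quiver.Path s t) (q : Quiver.Path s' t') :
      evalPair y₀ y₁ p q * y₀ t t' = evalPair y₀ y₁ p q := by
    cases p <;> cases q <;> simp [evalPair, h_mul, mul_assoc, h_tgt]
  have hc {s s' m m' t t' : Q} (p : Quiver.Path s m) (q : Quiver.Path s' m')
      (p' : Quiver.Path m t) (q' : Quiver.Path m' t') (h : p'.length = q'.length) :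
      evalPair y₀ y₁ (p.comp p') (q.comp q') = evalPair y₀ y₁ p q * evalPair y₀ y₁ p' q' := by
    induction p' generalizing t' with
    | nil =>
      cases q' with
      | nil => exact (hr p q).symm
      | cons q' f => cases h
    | cons p' e ih =>
      cases q' with
      | nil => cases h
      | cons q' f =>
        rw [Quiver.Path.comp_cons, Quiver.Path.comp_cons, evalPair, evalPair,
          ih q' (Nat.succ.inj h), mul_assoc]
  let F : FaceAlgebra k Q →ₗ[k] B :=
    (ConcatAlgebra.basis k).constr k fun w => evalPair y₀ y₁ w.fst.path w.snd.path
  have hF (w : QPathPair Q) : F (ConcatAlgebra.basis k w) = evalPair y₀ y₁ w.fst.path w.snd.path :=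
    (ConcatAlgebra.basis k).constr_basis _ _ _
  have hF1 : F 1 = 1 := by
    rw [ConcatAlgebra.one_def, map_sum, ← h_one, Fintype.sum_prod_type]
    exact Finset.sum_congr rfl fun i _ => Finset.sum_congr rfl fun j _ => hF _
  have hFm (f g : FaceAlgebra k Q) : F (f * g) = F f * F g := by
    induction f using ConcatAlgebra.induction_basis with
    | h0 => simp
    | ha f f' hf hf' => simp only [add_mul, map_add, hf, hf']
    | hs c f hf => simp only [smul_mul_assoc, map_smul, hf]
    | hb w =>
      induction g using ConcatAlgebra.induction_basis with
      | h0 => simp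
      | ha f f' hf hf' => simp only [mul_add, map_add, hf, hf']
      | hs c f hf => simp only [mul_smul_comm, map_smul, hf]
      | hb z =>
        rcases w with ⟨⟨p⟩, ⟨q⟩, hw⟩
        rcases z with ⟨⟨p'⟩, ⟨q'⟩, hz⟩
        rw [ConcatAlgebra.basis_mul_basis, hF, hF]
        by_cases h : (Concatenation.tgt (⟨⟨p⟩, ⟨q⟩, hw⟩ : QPathPair Q)) =
            Concatenation.src (⟨⟨p'⟩, ⟨q'⟩, hz⟩ : QPathPair Q)
        · rw [ConcatAlgebra.basisMul_of_eq h, hF]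
          have h₁ := congrArg Prod.fst h
          have h₂ := congrArg Prod.snd h
          change _ = _ at h₁ h₂
          dsimp only [Concatenation.tgt, Concatenation.src] at h₁ h₂
          subst h₁ h₂
          exact hc p q p' q' hz
        · rw [ConcatAlgebra.basisMul_of_ne h, map_zero]
          dsimp only
          rw [← hr p q, ← hl p' q', mul_assoc, ← mul_assoc (y₀ _ _), h_mul]
          split_ifs with h₁ h₂
          · exact absurd (Prod.ext h₁ h₂) h
          · simp
          · simp
  refine ⟨AlgHom.ofLinearMap F hF1 hFm, ⟨fun i j => ?_, fun p q => ?_⟩, fun G hG => ?_⟩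
  · rw [AlgHom.ofLinearMap_apply, x_of_eq (a := Concatenation.triv i)
      (b := Concatenation.triv j) rfl, hF]
    rfl
  · rw [AlgHom.ofLinearMap_apply, x_of_eq (a := .arrow p) (b := .arrow q) rfl, hF]
    change y₀ _ _ * y₁ p q = y₁ p q
    exact h_src p q
  · have hG' {s s' t t' : Q} (p : Quiver.Path s t) (q : Quiver.Path s' t')
        (h : p.length = q.length) : G (x k ⟨p⟩ ⟨q⟩) = evalPair y₀ y₁ p q := by
      induction p generalizing t' with
      | nil =>
        cases q with
        | nil => exact hG.1 _ _
        | cons q f => cases h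
      | cons p e ih =>
        cases q with
        | nil => cases h
        | cons q f =>
          have h' : p.length = q.length := Nat.succ.inj h
          rw [evalPair, ← ih q h', ← hG.2 e f, ← map_mul,
            x_mul_x_of_eq (a := ⟨p⟩) (b := ⟨q⟩) (a' := .arrow e) (b' := .arrow f) h' rfl rfl rfl]
          rfl
    refine AlgHom.toLinearMap_injective ((ConcatAlgebra.basis k).ext fun w => ?_)
    change G (ConcatAlgebra.basis k w) = F (ConcatAlgebra.basis k w)
    rw [hF, basis_eq_x]
    exact hG' _ _ w.length_eq

end Presentation

end

variable [Fintype Q] [∀ i j : Q, Finite (i ⟶ j)]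

open Classical in
/-- For `a`, `b` of length `l`: `Δ(x_{a,b}) = ∑_{c ∈ Q_l} x_{a,c} ⊗ x_{c,b}` and
`ε(x_{a,b}) = δ_{a,b}`. -/
instance : CoalgebraStruct k (FaceAlgebra k Q) where
  comul := (ConcatAlgebra.basis k).constr k fun w =>
    ∑ c ∈ QPath.ofLength Q w.fst.length, x k w.fst c ⊗ₜ[k] x k c w.snd
  counit := (ConcatAlgebra.basis k).constr k fun w => if w.fst = w.snd then 1 else 0

theorem comul_x (a b : QPath Q) : Coalgebra.comul (R := k) (x k a b) =
    ∑ c ∈ QPath.ofLength Q a.length, x k a c ⊗ₜ[k] x k c b := by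
  by_cases h : a.length = b.length
  · rw [x_of_eq h]
    exact (ConcatAlgebra.basis k).constr_basis _ _ _
  · rw [x_of_ne h, map_zero]
    refine (Finset.sum_eq_zero fun c hc => ?_).symm
    rw [QPath.mem_ofLength] at hc
    rw [x_of_ne (a := c) (by rwa [hc]), TensorProduct.tmul_zero]

open Classical in
theorem counit_x (a b : QPath Q) : Coalgebra.counit (R := k) (x k a b) =
    if a = b then (1 : k) else 0 := by
  by_cases h : a.length = b.length
  · rw [x_of_eq h]
    exact (ConcatAlgebra.basis k).constr_basis _ _ _
  · rw [x_of_ne h, map_zero, if_neg fun e => h (by rw [e])]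

instance : Coalgebra k (FaceAlgebra k Q) where
  coassoc := by
    refine hom_ext fun a b => ?_
    simp only [LinearMap.comp_apply, comul_x, map_sum, LinearMap.rTensor_tmul,
      LinearMap.lTensor_tmul, TensorProduct.sum_tmul, TensorProduct.tmul_sum,
      LinearEquiv.coe_coe, TensorProduct.assoc_tmul]
    rw [Finset.sum_comm]
    refine Finset.sum_congr rfl fun c hc => ?_
    rw [QPath.mem_ofLength.1 hc]
  rTensor_counit_comp_comul := by
    classical
    refine hom_ext fun a b => ?_
    simp only [LinearMap.comp_apply, comul_x, map_sum, LinearMap.rTensor_tmul, counit_x]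
    rw [Finset.sum_eq_single a]
    · simp
    · intro c _ hc
      rw [if_neg hc.symm, TensorProduct.zero_tmul]
    · intro h
      exact absurd (QPath.mem_ofLength.2 rfl) h
  lTensor_counit_comp_comul := by
    classical
    refine hom_ext fun a b => ?_
    simp only [LinearMap.comp_apply, comul_x, map_sum, LinearMap.lTensor_tmul, counit_x]
    by_cases h : a.length = b.length
    · rw [Finset.sum_eq_single b]
      · simp
      · intro c _ hc
        rw [if_neg hc, TensorProduct.tmul_zero]
      · intro h'
        exact absurd (QPath.mem_ofLength.2 h.symm) h'
    · rw [x_of_ne h, map_zero]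
      refine Finset.sum_eq_zero fun c hc => ?_
      rw [QPath.mem_ofLength] at hc
      rw [if_neg fun e : c = b => h (by rw [← hc, e]), TensorProduct.tmul_zero]

open Classical in
theorem sum_ofLength_add {M : Type*} [AddCommMonoid M] (l m : ℕ) (F : QPath Q → M) :
    ∑ d ∈ QPath.ofLength Q (l + m), F d =
      ∑ c ∈ QPath.ofLength Q l, ∑ c' ∈ QPath.ofLength Q m,
        if h : Concatenation.tgt c = Concatenation.src c' then F (Concatenation.comp c c' h)
        else 0 := by
  have h₁ : ∀ d ∈ QPath.ofLength Q (l + m), F d =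
      ∑ c ∈ QPath.ofLength Q l, ∑ c' ∈ QPath.ofLength Q m,
        if ∃ h : Concatenation.tgt c = Concatenation.src c', Concatenation.comp c c' h = d
        then F d else 0 := by
    intro d hd
    obtain ⟨c, c', h, hc, hc', e⟩ := exists_comp d (QPath.mem_ofLength.1 hd)
    rw [Finset.sum_eq_single c, Finset.sum_eq_single c', if_pos ⟨h, e⟩]
    · intro b hb hne
      rw [if_neg]
      rintro ⟨h', e'⟩
      exact hne (comp_unique ((QPath.mem_ofLength.1 hb).trans hc'.symm) _ _
        (e'.trans e.symm)).2
    · exact fun h => absurd (QPath.mem_ofLength.2 hc') h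
    · intro b hb hne
      refine Finset.sum_eq_zero fun b' hb' => ?_
      rw [if_neg]
      rintro ⟨h', e'⟩
      exact hne (comp_unique
        ((QPath.mem_ofLength.1 hb').trans hc'.symm) _ _ (e'.trans e.symm)).1
    · exact fun h => absurd (QPath.mem_ofLength.2 hc) h
  rw [Finset.sum_congr rfl h₁, Finset.sum_comm]
  refine Finset.sum_congr rfl fun c hc => ?_
  rw [Finset.sum_comm]
  refine Finset.sum_congr rfl fun c' hc' => ?_
  by_cases h : Concatenation.tgt c = Concatenation.src c'
  · rw [dif_pos h, Finset.sum_eq_single (Concatenation.comp c c' h), if_pos ⟨h, rfl⟩]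
    · intro d _ hne
      rw [if_neg]
      rintro ⟨_, e⟩
      exact hne e.symm
    · intro hn
      refine absurd (QPath.mem_ofLength.2 ?_) hn
      rw [QPath.length_comp, QPath.mem_ofLength.1 hc, QPath.mem_ofLength.1 hc']
  · rw [dif_neg h]
    refine Finset.sum_eq_zero fun d _ => if_neg ?_
    rintro ⟨h', _⟩
    exact h h'

theorem comul_x_mul_x (a b a' b' : QPath Q) :
    Coalgebra.comul (R := k) (x k a b * x k a' b') =
      Coalgebra.comul (R := k) (x k a b) * Coalgebra.comul (R := k) (x k a' b') := by
  by_cases h : a.length = b.length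
  swap
  · rw [x_of_ne h, zero_mul, map_zero, zero_mul]
  by_cases h' : a'.length = b'.length
  swap
  · rw [x_of_ne h', mul_zero, map_zero, mul_zero]
  rw [comul_x, comul_x, Finset.sum_mul_sum]
  simp only [Algebra.TensorProduct.tmul_mul_tmul]
  by_cases ha : Concatenation.tgt a = Concatenation.src a'
  swap
  · rw [x_mul_x_of_ne_left ha, map_zero]
    refine (Finset.sum_eq_zero fun c _ => Finset.sum_eq_zero fun c' _ => ?_).symm
    rw [x_mul_x_of_ne_left ha, TensorProduct.zero_tmul]
  by_cases hb : Concatenation.tgt b = Concatenation.src b'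
  swap
  · rw [x_mul_x_of_ne_right hb, map_zero]
    refine (Finset.sum_eq_zero fun c _ => Finset.sum_eq_zero fun c' _ => ?_).symm
    rw [x_mul_x_of_ne_right hb, TensorProduct.tmul_zero]
  rw [x_mul_x_of_eq h h' ha hb, comul_x, QPath.length_comp, sum_ofLength_add]
  refine Finset.sum_congr rfl fun c hc => Finset.sum_congr rfl fun c' hc' => ?_
  rw [QPath.mem_ofLength] at hc hc'
  by_cases hcc : Concatenation.tgt c = Concatenation.src c'
  · rw [dif_pos hcc, x_mul_x_of_eq hc.symm hc'.symm ha hcc,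
      x_mul_x_of_eq (hc.trans h) (hc'.trans h') hcc hb]
  · rw [dif_neg hcc, x_mul_x_of_ne_right hcc, TensorProduct.zero_tmul]

open Classical in
theorem counit_x_mul_x (a b a' b' : QPath Q) :
    Coalgebra.counit (R := k) (x k a b * x k a' b') =
      if a = b ∧ a' = b' ∧ Concatenation.tgt a = Concatenation.src a' then (1 : k) else 0 := by
  by_cases h : a.length = b.length
  swap
  · rw [x_of_ne h, zero_mul, map_zero, if_neg]
    rintro ⟨e, -⟩
    exact h (by rw [e])
  by_cases h' : a'.length = b'.length
  swap
  · rw [x_of_ne h', mul_zero, map_zero, if_neg]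
    rintro ⟨-, e, -⟩
    exact h' (by rw [e])
  by_cases ha : Concatenation.tgt a = Concatenation.src a'
  swap
  · rw [x_mul_x_of_ne_left ha, map_zero, if_neg]
    rintro ⟨-, -, e⟩
    exact ha e
  by_cases hb : Concatenation.tgt b = Concatenation.src b'
  swap
  · rw [x_mul_x_of_ne_right hb, map_zero, if_neg]
    rintro ⟨rfl, rfl, e⟩
    exact hb e
  rw [x_mul_x_of_eq h h' ha hb, counit_x]
  refine if_congr ⟨fun e => ?_, ?_⟩ rfl rfl
  · obtain ⟨e₁, e₂⟩ := comp_unique h' _ _ e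
    exact ⟨e₁, e₂, ha⟩
  · rintro ⟨rfl, rfl, -⟩
    rfl

open Classical in
theorem counit_x_mul_x_mul_x (a b a' b' a'' b'' : QPath Q) :
    Coalgebra.counit (R := k) (x k a b * x k a' b' * x k a'' b'') =
      if a = b ∧ a' = b' ∧ a'' = b'' ∧ Concatenation.tgt a = Concatenation.src a' ∧
        Concatenation.tgt a' = Concatenation.src a'' then (1 : k) else 0 := by
  by_cases h : a.length = b.length
  swap
  · rw [x_of_ne h, zero_mul, zero_mul, map_zero, if_neg]
    rintro ⟨e, -⟩
    exact h (by rw [e])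
  by_cases h' : a'.length = b'.length
  swap
  · rw [x_of_ne h', mul_zero, zero_mul, map_zero, if_neg]
    rintro ⟨-, e, -⟩
    exact h' (by rw [e])
  by_cases ha : Concatenation.tgt a = Concatenation.src a'
  swap
  · rw [x_mul_x_of_ne_left ha, zero_mul, map_zero, if_neg]
    rintro ⟨-, -, -, e, -⟩
    exact ha e
  by_cases hb : Concatenation.tgt b = Concatenation.src b'
  swap
  · rw [x_mul_x_of_ne_right hb, zero_mul, map_zero, if_neg]
    rintro ⟨rfl, rfl, -, e, -⟩
    exact hb e
  rw [x_mul_x_of_eq h h' ha hb, counit_x_mul_x]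
  refine if_congr ⟨?_, ?_⟩ rfl rfl
  · rintro ⟨e, e₃, e₄⟩
    obtain ⟨e₁, e₂⟩ := comp_unique h' _ _ e
    exact ⟨e₁, e₂, e₃, ha, e₄⟩
  · rintro ⟨rfl, rfl, e₃, -, e₄⟩
    exact ⟨rfl, e₃, e₄⟩

theorem sum_ofLength_zero {M : Type*} [AddCommMonoid M] (F : QPath Q → M) :
    ∑ c ∈ QPath.ofLength Q 0, F c = ∑ i : Q, F (Concatenation.triv i) := by
  symm
  refine Finset.sum_bij (fun i _ => Concatenation.triv i) ?_ ?_ ?_ ?_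
  · exact fun i _ => QPath.mem_ofLength.2 rfl
  · intro i _ j _ e
    exact congrArg QPath.src e
  · rintro ⟨p⟩ h
    rw [QPath.mem_ofLength] at h
    cases p with
    | nil => exact ⟨_, Finset.mem_univ _, rfl⟩
    | cons p f => cases h
  · exact fun _ _ => rfl

theorem comul_one_eq : Coalgebra.comul (R := k) (1 : FaceAlgebra k Q) =
    ∑ i : Q, ∑ j : Q, ∑ m : Q, x k (Concatenation.triv i) (Concatenation.triv m) ⊗ₜ[k]
      x k (Concatenation.triv m) (Concatenation.triv j) := by
  simp only [one_eq, map_sum, comul_x, QPath.length_triv, sum_ofLength_zero]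

/-- The face algebra of a finite quiver is a weak bialgebra. -/
instance : WeakBialgebra k (FaceAlgebra k Q) where
  comul_mul f g := by
    induction f using ConcatAlgebra.induction_basis with
    | h0 => simp
    | ha f f' hf hf' => simp only [add_mul, map_add, hf, hf']
    | hs c f hf => simp only [smul_mul_assoc, map_smul, hf]
    | hb w =>
      induction g using ConcatAlgebra.induction_basis with
      | h0 => simp
      | ha f f' hf hf' => simp only [mul_add, map_add, hf, hf']
      | hs c f hf => simp only [mul_smul_comm, map_smul, hf]
      | hb z => rw [basis_eq_x, basis_eq_x, comul_x_mul_x]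
  counit_mul_mul₁ f g h := by
    classical
    induction g using ConcatAlgebra.induction_basis with
    | h0 => simp
    | ha g g' hg hg' => simp only [mul_add, add_mul, map_add, hg, hg']
    | hs c g hg => simp only [mul_smul_comm, smul_mul_assoc, map_smul, hg]
    | hb z =>
      simp only [basis_eq_x, comul_x, map_sum, TensorProduct.map_tmul, LinearMap.mul'_apply,
        LinearMap.comp_apply, LinearMap.mulLeft_apply, LinearMap.mulRight_apply]
      induction f using ConcatAlgebra.induction_basis with
      | h0 => simp
      | ha f f' hf hf' => simp only [add_mul, map_add, hf, hf', Finset.sum_add_distrib]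
      | hs c f hf =>
        rw [smul_mul_assoc, smul_mul_assoc, map_smul, hf, Finset.smul_sum]
        simp only [smul_mul_assoc, map_smul]
      | hb w =>
        induction h using ConcatAlgebra.induction_basis with
        | h0 => simp
        | ha h h' hh hh' => simp only [mul_add, map_add, hh, hh', Finset.sum_add_distrib]
        | hs c h hh =>
          rw [mul_smul_comm, map_smul, hh, Finset.smul_sum]
          simp only [mul_smul_comm, map_smul]
        | hb y =>
          simp only [basis_eq_x, counit_x_mul_x, counit_x_mul_x_mul_x]
          rw [Finset.sum_eq_single z.fst]
          · rw [ite_zero_mul_ite_zero, mul_one]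
            refine if_congr ?_ rfl rfl
            constructor
            · rintro ⟨h₁, h₂, h₃, h₄, h₅⟩
              exact ⟨⟨h₁, rfl, h₄⟩, h₂, h₃, h₅⟩
            · rintro ⟨⟨h₁, -, h₄⟩, h₂, h₃, h₅⟩
              exact ⟨h₁, h₂, h₃, h₄, h₅⟩
          · intro c _ hc
            rw [if_neg (fun e => hc e.2.1.symm), zero_mul]
          · exact fun e => absurd (QPath.mem_ofLength.2 rfl) e
  counit_mul_mul₂ f g h := by
    classical
    induction g using ConcatAlgebra.induction_basis with
    | h0 => simp
    | ha g g' hg hg' => simp only [mul_add, add_mul, map_add, hg, hg']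
    | hs c g hg => simp only [mul_smul_comm, smul_mul_assoc, map_smul, hg]
    | hb z =>
      simp only [basis_eq_x, comul_x, map_sum, TensorProduct.map_tmul, LinearMap.mul'_apply,
        LinearMap.comp_apply, LinearMap.mulLeft_apply, LinearMap.mulRight_apply]
      induction f using ConcatAlgebra.induction_basis with
      | h0 => simp
      | ha f f' hf hf' => simp only [add_mul, mul_add, map_add, hf, hf', Finset.sum_add_distrib]
      | hs c f hf =>
        rw [smul_mul_assoc, smul_mul_assoc, map_smul, hf, Finset.smul_sum]
        simp only [smul_mul_assoc, mul_smul_comm, map_smul]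
      | hb w =>
        induction h using ConcatAlgebra.induction_basis with
        | h0 => simp
        | ha h h' hh hh' => simp only [mul_add, add_mul, map_add, hh, hh', Finset.sum_add_distrib]
        | hs c h hh =>
          rw [mul_smul_comm, map_smul, hh, Finset.smul_sum]
          simp only [mul_smul_comm, smul_mul_assoc, map_smul]
        | hb y =>
          simp only [basis_eq_x, counit_x_mul_x, counit_x_mul_x_mul_x]
          rw [Finset.sum_eq_single z.snd]
          · rw [ite_zero_mul_ite_zero, mul_one]
            refine if_congr ?_ rfl rfl
            constructor
            · rintro ⟨h₁, h₂, h₃, h₄, h₅⟩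
              exact ⟨⟨h₂, h₃, h₅⟩, h₁, rfl, h₂ ▸ h₄⟩
            · rintro ⟨⟨h₂, h₃, h₅⟩, h₁, -, h₄⟩
              exact ⟨h₁, h₂, h₃, h₂.symm ▸ h₄, h₅⟩
          · intro c _ hc
            rw [mul_comm, if_neg (fun e => hc e.2.1), zero_mul]
          · exact fun e => absurd (QPath.mem_ofLength.2 z.length_eq.symm) e
  comul_comul_one₁ := by
    classical
    simp only [comul_one_eq, map_sum, TensorProduct.map_tmul, LinearMap.id_apply, comul_x,
      QPath.length_triv, sum_ofLength_zero, TensorProduct.tmul_sum, TensorProduct.sum_tmul,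
      TensorProduct.assoc_tmul, Finset.mul_sum, Finset.sum_mul,
      Algebra.TensorProduct.tmul_mul_tmul,
      mul_one, one_mul, x_triv_mul_x_triv]
    simp only [TensorProduct.ite_tmul, TensorProduct.tmul_ite,
      Finset.sum_ite_eq', Finset.mem_univ, if_true]
    rw [Finset.sum_comm]
    conv_rhs => rw [Finset.sum_comm]
    refine Finset.sum_congr rfl fun t _ => ?_
    rw [Finset.sum_comm]
    refine Finset.sum_congr rfl fun m _ => ?_
    rw [Finset.sum_comm]
  comul_comul_one₂ := by
    classical
    simp only [comul_one_eq, map_sum, TensorProduct.map_tmul, LinearMap.id_apply, comul_x,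
      QPath.length_triv, sum_ofLength_zero, TensorProduct.tmul_sum, TensorProduct.sum_tmul,
      TensorProduct.assoc_tmul, Finset.mul_sum, Finset.sum_mul,
      Algebra.TensorProduct.tmul_mul_tmul,
      mul_one, one_mul, x_triv_mul_x_triv]
    simp only [TensorProduct.ite_tmul, TensorProduct.tmul_ite,
      Finset.sum_ite_irrel, Finset.sum_const_zero, Finset.sum_ite_eq',
      Finset.mem_univ, if_true]
    refine Finset.sum_congr rfl fun s _ => ?_
    rw [Finset.sum_comm]
    conv_rhs => rw [Finset.sum_comm]
    refine Finset.sum_congr rfl fun m _ => ?_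
    rw [Finset.sum_comm]

end

end FaceAlgebra

namespace WeakBialgebra

noncomputable section

variable {k H K : Type*} [Field k] [Ring H] [Algebra k H] [Coalgebra k H]
  [Ring K] [Algebra k K] [Coalgebra k K]

/-- The image of a weak bialgebra under an algebra and coalgebra map is a weak bialgebra. -/
theorem of_surjective [WeakBialgebra k H] (f : H →ₐc[k] K) (hf : Function.Surjective f) :
    WeakBialgebra k K := by
  have hm (x y : H ⊗[k] H) : TensorProduct.map (f : H →ₗ[k] K) (f : H →ₗ[k] K) (x * y) =
      TensorProduct.map (f : H →ₗ[k] K) (f : H →ₗ[k] K) x *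
        TensorProduct.map (f : H →ₗ[k] K) (f : H →ₗ[k] K) y :=
    map_mul (Algebra.TensorProduct.map (f : H →ₐ[k] K) (f : H →ₐ[k] K)) x y
  have hc (x : H) : Coalgebra.comul (R := k) (f x) =
      TensorProduct.map (f : H →ₗ[k] K) (f : H →ₗ[k] K) (Coalgebra.comul (R := k) x) :=
    (CoalgHomClass.map_comp_comul_apply f x).symm
  have he (x : H) : Coalgebra.counit (R := k) (f x) = Coalgebra.counit (R := k) x :=
    CoalgHomClass.counit_comp_apply f x
  have h1 : (1 : K) = f 1 := (map_one f).symm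
  have key : TensorProduct.map LinearMap.id Coalgebra.comul (Coalgebra.comul (R := k) (1 : K)) =
      TensorProduct.map (f : H →ₗ[k] K) (TensorProduct.map (f : H →ₗ[k] K) (f : H →ₗ[k] K))
        (TensorProduct.map LinearMap.id Coalgebra.comul (Coalgebra.comul (R := k) (1 : H))) := by
    rw [h1, hc]
    generalize Coalgebra.comul (R := k) (1 : H) = z
    induction z with
    | zero => simp
    | tmul x y => 
      simp only [TensorProduct.map_tmul, LinearMap.id_apply]
      exact congrArg _ (hc y)
    | add x y hx hy => simp only [map_add, hx, hy]
  have hF (x y : H ⊗[k] (H ⊗[k] H)) :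
      TensorProduct.map (f : H →ₗ[k] K) (TensorProduct.map (f : H →ₗ[k] K) (f : H →ₗ[k] K))
        (x * y) =
      TensorProduct.map (f : H →ₗ[k] K) (TensorProduct.map (f : H →ₗ[k] K) (f : H →ₗ[k] K)) x *
      TensorProduct.map (f : H →ₗ[k] K) (TensorProduct.map (f : H →ₗ[k] K) (f : H →ₗ[k] K)) y :=
    map_mul (Algebra.TensorProduct.map (f : H →ₐ[k] K)
      (Algebra.TensorProduct.map (f : H →ₐ[k] K) (f : H →ₐ[k] K))) x y
  have ha : TensorProduct.assoc k K K K (Coalgebra.comul (R := k) (1 : K) ⊗ₜ[k] (1 : K)) =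
      TensorProduct.map (f : H →ₗ[k] K) (TensorProduct.map (f : H →ₗ[k] K) (f : H →ₗ[k] K))
        (TensorProduct.assoc k H H H (Coalgebra.comul (R := k) (1 : H) ⊗ₜ[k] (1 : H))) := by
    rw [h1, hc]
    generalize Coalgebra.comul (R := k) (1 : H) = z
    induction z with
    | zero => simp
    | tmul x y => simp
    | add x y hx hy => simp only [map_add, TensorProduct.add_tmul, hx, hy]
  have hb : (1 : K) ⊗ₜ[k] Coalgebra.comul (R := k) (1 : K) =
      TensorProduct.map (f : H →ₗ[k] K) (TensorProduct.map (f : H →ₗ[k] K) (f : H →ₗ[k] K))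
        ((1 : H) ⊗ₜ[k] Coalgebra.comul (R := k) (1 : H)) := by
    rw [h1, hc, TensorProduct.map_tmul]
    rfl
  refine ⟨fun a b => ?_, fun a b c => ?_, fun a b c => ?_, ?_, ?_⟩
  · obtain ⟨a, rfl⟩ := hf a
    obtain ⟨b, rfl⟩ := hf b
    rw [← map_mul, hc, comul_mul, hm, hc, hc]
  · obtain ⟨a, rfl⟩ := hf a
    obtain ⟨b, rfl⟩ := hf b
    obtain ⟨c, rfl⟩ := hf c
    rw [← map_mul, ← map_mul, he, counit_mul_mul₁, hc,
      ← LinearMap.comp_apply (TensorProduct.map _ _) (TensorProduct.map _ _),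
      ← TensorProduct.map_comp]
    congr 3 <;> ext x <;> simp [← map_mul]
  · obtain ⟨a, rfl⟩ := hf a
    obtain ⟨b, rfl⟩ := hf b
    obtain ⟨c, rfl⟩ := hf c
    rw [← map_mul, ← map_mul, he, counit_mul_mul₂, hc,
      ← LinearMap.comp_apply (TensorProduct.map _ _) (TensorProduct.map _ _),
      ← TensorProduct.map_comp]
    congr 3 <;> ext x <;> simp [← map_mul]
  · rw [key, ha, hb, ← hF, comul_comul_one₁]
  · rw [key, ha, hb, ← hF, comul_comul_one₂]

variable (k H)

/-- The source counital map `ε_s : h ↦ 1₁ ε(h 1₂)`. -/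
def sourceCounital : H →ₗ[k] H :=
  TensorProduct.rid k H ∘ₗ LinearMap.lTensor H Coalgebra.counit ∘ₗ
    LinearMap.mulRight k (Coalgebra.comul (R := k) (1 : H)) ∘ₗ TensorProduct.mk k H H 1

/-- The target counital map `ε_t : h ↦ ε(1₁ h) 1₂`. -/
def targetCounital : H →ₗ[k] H :=
  TensorProduct.lid k H ∘ₗ LinearMap.rTensor H Coalgebra.counit ∘ₗ
    LinearMap.mulLeft k (Coalgebra.comul (R := k) (1 : H)) ∘ₗ (TensorProduct.mk k H H).flip 1

/-- The source counital subalgebra `H_s = ε_s(H)`, as a subspace of `H`. -/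
def sourceSub : Submodule k H := LinearMap.range (sourceCounital k H)

/-- The target counital subalgebra `H_t = ε_t(H)`, as a subspace of `H`. -/
def targetSub : Submodule k H := LinearMap.range (targetCounital k H)

end

end WeakBialgebra

/-- A biideal `J`: a two-sided ideal with `ε(J) = 0` and `Δ(J) ⊆ H ⊗ J + J ⊗ H`. -/
structure Biideal (k H : Type*) [Field k] [Ring H] [Algebra k H] [Coalgebra k H] where
  toIdeal : Ideal H
  isTwoSided : toIdeal.IsTwoSided
  counit_eq_zero : ∀ x ∈ toIdeal, Coalgebra.counit (R := k) x = 0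
  comul_mem : ∀ x ∈ toIdeal, Coalgebra.comul (R := k) x ∈
    LinearMap.range (LinearMap.lTensor H (toIdeal.restrictScalars k).subtype) ⊔
      LinearMap.range (LinearMap.rTensor H (toIdeal.restrictScalars k).subtype)

namespace Biideal

noncomputable section

variable {k H : Type*} [Field k] [Ring H] [Algebra k H] [Coalgebra k H]

instance (J : Biideal k H) : J.toIdeal.IsTwoSided := J.isTwoSided

instance (J : Biideal k H) : (J.toIdeal.restrictScalars k).IsCoideal :=
  (Submodule.isCoideal_iff_comul_mem _).2 ⟨J.counit_eq_zero, J.comul_mem⟩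

/-- The quotient `H/J` by a biideal, an algebra. -/
abbrev Quotient (J : Biideal k H) : Type _ := H ⧸ J.toIdeal

/-- The coalgebra structure induced on `H/J`. -/
instance (J : Biideal k H) : Coalgebra k J.Quotient :=
  inferInstanceAs (Coalgebra k (H ⧸ J.toIdeal.restrictScalars k))

/-- The canonical projection `H → H/J`, an algebra and coalgebra map. -/
def proj (J : Biideal k H) : H →ₐc[k] J.Quotient where
  __ := Ideal.Quotient.mkₐ k J.toIdeal
  map_smul' := map_smul (Ideal.Quotient.mkₐ k J.toIdeal)
  counit_comp := rfl
  map_comp_comul := rfl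

theorem proj_surjective (J : Biideal k H) : Function.Surjective J.proj :=
  Ideal.Quotient.mk_surjective

/-- The quotient of a weak bialgebra by a biideal is a weak bialgebra. -/
instance [WeakBialgebra k H] (J : Biideal k H) : WeakBialgebra k J.Quotient :=
  WeakBialgebra.of_surjective J.proj J.proj_surjective

end

end Biideal

section Coactions

variable {k : Type*} [Field k] {A : Type*} [Ring A] [Algebra k A] (𝒜 : ℕ → Submodule k A)

/-- `lam : A → H ⊗ A` makes `A` a linear left `H`-comodule algebra: it is coassociative and counital,
`lam (ab) = lam a * lam b`, `lam 1 ∈ H_s ⊗ A`, and every graded component is a subcomodule, i.e.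
`lam (A_n) ⊆ H ⊗ A_n`. -/
structure IsLeftComoduleAlgebra (H : Type*) [Ring H] [Algebra k H] [Coalgebra k H]
    (lam : A →ₗ[k] H ⊗[k] A) : Prop where
  coassoc : (TensorProduct.assoc k H H A).toLinearMap ∘ₗ
    LinearMap.rTensor A Coalgebra.comul ∘ₗ lam = LinearMap.lTensor H lam ∘ₗ lam
  counit_coact : TensorProduct.lid k A ∘ₗ LinearMap.rTensor A Coalgebra.counit ∘ₗ lam =
    LinearMap.id
  map_mul : ∀ a b : A, lam (a * b) = lam a * lam b
  map_one_mem : lam 1 ∈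
    LinearMap.range (LinearMap.rTensor A (WeakBialgebra.sourceSub k H).subtype)
  linear : ∀ n, ∀ a ∈ 𝒜 n, lam a ∈ LinearMap.range (LinearMap.lTensor H (𝒜 n).subtype)

/-- `rho : A → A ⊗ H` makes `A` a linear right `H`-comodule algebra: it is coassociative and counital,
`rho (ab) = rho a * rho b`, `rho 1 ∈ A ⊗ H_t`, and every graded component is a subcomodule, i.e.
`rho (A_n) ⊆ A_n ⊗ H`. -/
structure IsRightComoduleAlgebra (H : Type*) [Ring H] [Algebra k H] [Coalgebra k H]
    (rho : A →ₗ[k] A ⊗[k] H) : Prop where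
  coassoc : (TensorProduct.assoc k A H H).toLinearMap ∘ₗ
    LinearMap.rTensor H rho ∘ₗ rho = LinearMap.lTensor A Coalgebra.comul ∘ₗ rho
  counit_coact : TensorProduct.rid k A ∘ₗ LinearMap.lTensor A Coalgebra.counit ∘ₗ rho =
    LinearMap.id
  map_mul : ∀ a b : A, rho (a * b) = rho a * rho b
  map_one_mem : rho 1 ∈
    LinearMap.range (LinearMap.lTensor A (WeakBialgebra.targetSub k H).subtype)
  linear : ∀ n, ∀ a ∈ 𝒜 n, rho a ∈ LinearMap.range (LinearMap.rTensor H (𝒜 n).subtype)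

variable [SetLike.GradedMonoid 𝒜]

/-- `A_0 ≅ H_t` as left `H`-comodule algebras, where `A_0` carries the restriction `lam₀` of `lam` and
`H_t` the restriction of `Δ`. The isomorphism is given as an injective algebra map `ψ : A_0 → H` with
image `H_t` such that `Δ ∘ ψ = (id ⊗ ψ) ∘ lam₀`. -/
def TargetBaseIso (H : Type*) [Ring H] [Algebra k H] [Coalgebra k H]
    (lam : A →ₗ[k] H ⊗[k] A) : Prop :=
  ∃ (lam₀ : 𝒜 0 →ₗ[k] H ⊗[k] 𝒜 0) (ψ : 𝒜 0 →ₐ[k] H),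
    LinearMap.lTensor H (𝒜 0).subtype ∘ₗ lam₀ = lam ∘ₗ (𝒜 0).subtype ∧
    Function.Injective ψ ∧
    LinearMap.range ψ.toLinearMap = WeakBialgebra.targetSub k H ∧
    Coalgebra.comul ∘ₗ ψ.toLinearMap = LinearMap.lTensor H ψ.toLinearMap ∘ₗ lam₀

/-- `A_0 ≅ H_s` as right `H`-comodule algebras, where `A_0` carries the restriction `rho₀` of `rho` and
`H_s` the restriction of `Δ`. The isomorphism is given as an injective algebra map `φ : A_0 → H` with
image `H_s` such that `Δ ∘ φ = (φ ⊗ id) ∘ rho₀`. -/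
def SourceBaseIso (H : Type*) [Ring H] [Algebra k H] [Coalgebra k H]
    (rho : A →ₗ[k] A ⊗[k] H) : Prop :=
  ∃ (rho₀ : 𝒜 0 →ₗ[k] 𝒜 0 ⊗[k] H) (φ : 𝒜 0 →ₐ[k] H),
    LinearMap.rTensor H (𝒜 0).subtype ∘ₗ rho₀ = rho ∘ₗ (𝒜 0).subtype ∧
    Function.Injective φ ∧
    LinearMap.range φ.toLinearMap = WeakBialgebra.sourceSub k H ∧
    Coalgebra.comul ∘ₗ φ.toLinearMap = LinearMap.rTensor H φ.toLinearMap ∘ₗ rho₀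

/-- The left and right coactions are transposed: every `A_n` has a basis `(v_j)` such that
`lam v_j = ∑_l z_{j,l} ⊗ v_l` and `rho v_j = ∑_l v_l ⊗ z_{l,j}` with the same coefficients. -/
def IsTransposed (H : Type*) [Ring H] [Algebra k H]
    (lam : A →ₗ[k] H ⊗[k] A) (rho : A →ₗ[k] A ⊗[k] H) : Prop :=
  ∀ n, ∃ (d : ℕ) (v : Module.Basis (Fin d) k (𝒜 n)) (z : Fin d → Fin d → H),
    (∀ j, lam (v j) = ∑ l, z j l ⊗ₜ[k] (v l : A)) ∧
    (∀ j, rho (v j) = ∑ l, (v l : A) ⊗ₜ[k] z l j)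

end Coactions

section UQSGd

variable {k : Type*} [Field k] {A : Type*} [Ring A] [Algebra k A] (𝒜 : ℕ → Submodule k A)
  [SetLike.GradedMonoid 𝒜]

/-- `O` with the left coaction `lam` is a left universal quantum linear semigroupoid of the graded
algebra `A`: `A` is a linear left `O`-comodule algebra with `A_0 ≅ O_t`, and for every weak bialgebra
`H` with a linear left coaction `lamH` on `A` such that `A_0 ≅ H_t` there is a unique weak bialgebra
map `π : O → H` with `(π ⊗ id) lam = lamH`. -/
structure IsLeftUQSGd (O : Type w) [Ring O] [Algebra k O] [Coalgebra k O]
    [WeakBialgebra k O]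
    (lam : A →ₗ[k] O ⊗[k] A) : Prop where
  coaction : IsLeftComoduleAlgebra 𝒜 O lam
  base : TargetBaseIso 𝒜 O lam
  universal : ∀ (H : Type w) [Ring H] [Algebra k H] [Coalgebra k H] [WeakBialgebra k H]
    (lamH : A →ₗ[k] H ⊗[k] A), IsLeftComoduleAlgebra 𝒜 H lamH → TargetBaseIso 𝒜 H lamH →
    ∃! π : O →ₐc[k] H, LinearMap.rTensor A (π : O →ₗ[k] H) ∘ₗ lam = lamH

/-- `O` with the right coaction `rho` is a right universal quantum linear semigroupoid of the graded
algebra `A`: `A` is a linear right `O`-comodule algebra with `A_0 ≅ O_s`, and for every weak bialgebra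
`H` with a linear right coaction `rhoH` on `A` such that `A_0 ≅ H_s` there is a unique weak bialgebra
map `π : O → H` with `(id ⊗ π) rho = rhoH`. -/
structure IsRightUQSGd (O : Type w) [Ring O] [Algebra k O] [Coalgebra k O]
    [WeakBialgebra k O]
    (rho : A →ₗ[k] A ⊗[k] O) : Prop where
  coaction : IsRightComoduleAlgebra 𝒜 O rho
  base : SourceBaseIso 𝒜 O rho
  universal : ∀ (H : Type w) [Ring H] [Algebra k H] [Coalgebra k H] [WeakBialgebra k H]
    (rhoH : A →ₗ[k] A ⊗[k] H), IsRightComoduleAlgebra 𝒜 H rhoH → SourceBaseIso 𝒜 H rhoH →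
    ∃! π : O →ₐc[k] H, LinearMap.lTensor A (π : O →ₗ[k] H) ∘ₗ rho = rhoH

/-- `O` with the coactions `lam` and `rho` is a transposed universal quantum linear semigroupoid of the
graded algebra `A`: `A` is a transposed `O`-comodule algebra with `A_0 ≅ O_t` and `A_0 ≅ O_s`, and for
every weak bialgebra `H` over which `A` is a transposed comodule algebra with `A_0 ≅ H_t` and
`A_0 ≅ H_s` there is a unique weak bialgebra map `π : O → H` compatible with both coactions. -/
structure IsTransUQSGd (O : Type w) [Ring O] [Algebra k O] [Coalgebra k O]
    [WeakBialgebra k O]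
    (lam : A →ₗ[k] O ⊗[k] A) (rho : A →ₗ[k] A ⊗[k] O) : Prop where
  coaction_left : IsLeftComoduleAlgebra 𝒜 O lam
  coaction_right : IsRightComoduleAlgebra 𝒜 O rho
  transposed : IsTransposed 𝒜 O lam rho
  base_left : TargetBaseIso 𝒜 O lam
  base_right : SourceBaseIso 𝒜 O rho
  universal : ∀ (H : Type w) [Ring H] [Algebra k H] [Coalgebra k H] [WeakBialgebra k H]
    (lamH : A →ₗ[k] H ⊗[k] A) (rhoH : A →ₗ[k] A ⊗[k] H),
    IsLeftComoduleAlgebra 𝒜 H lamH → IsRightComoduleAlgebra 𝒜 H rhoH →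
    IsTransposed 𝒜 H lamH rhoH → TargetBaseIso 𝒜 H lamH → SourceBaseIso 𝒜 H rhoH →
    ∃! π : O →ₐc[k] H, LinearMap.rTensor A (π : O →ₗ[k] H) ∘ₗ lam = lamH ∧
      LinearMap.lTensor A (π : O →ₗ[k] H) ∘ₗ rho = rhoH

end UQSGd

namespace PathAlgebra

noncomputable section

variable (k : Type*) [Field k] (Q : Type u) [Quiver.{v} Q]

/-- The degree `n` component `(kQ)_n` of the path algebra, spanned by the paths of length `n`. -/
def grade (n : ℕ) : Submodule k (PathAlgebra k Q) :=
  Submodule.span k (ConcatAlgebra.basis k '' {a : QPath Q | a.length = n})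

variable {k Q} [Fintype Q]

/-- `I` is generated, as a two-sided ideal, by homogeneous elements of degree at least two; this says
that `I` is a graded ideal generated in degree at least two. -/
def IsGeneratedInDegreeGETwo (I : Ideal (PathAlgebra k Q)) : Prop :=
  ∃ S : Set (PathAlgebra k Q), (∀ s ∈ S, ∃ n, 2 ≤ n ∧ s ∈ grade k Q n) ∧
    I = (TwoSidedIdeal.span S).asIdeal

variable (I : Ideal (PathAlgebra k Q)) [I.IsTwoSided]

/-- The degree `n` component of the graded algebra `kQ/I`, the image of `(kQ)_n`. -/
def quotGrade (n : ℕ) : Submodule k (PathAlgebra k Q ⧸ I) :=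
  (grade k Q n).map (Ideal.Quotient.mkₐ k I).toLinearMap

instance : SetLike.GradedMonoid (grade k Q) where
  one_mem := by
    rw [ConcatAlgebra.one_def]
    exact Submodule.sum_mem _ fun i _ => Submodule.subset_span ⟨_, rfl, rfl⟩
  mul_mem := by
    intro m n f g hf hg
    have h : grade k Q m * grade k Q n ≤ grade k Q (m + n) := by
      rw [grade, grade, Submodule.span_mul_span, Submodule.span_le]
      rintro _ ⟨_, ⟨a, ha, rfl⟩, _, ⟨b, hb, rfl⟩, rfl⟩
      dsimp only
      rw [ConcatAlgebra.basis_mul_basis]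
      by_cases h : Concatenation.tgt a = Concatenation.src b
      · rw [ConcatAlgebra.basisMul_of_eq h]
        refine Submodule.subset_span ⟨_, ?_, rfl⟩
        rw [Set.mem_ofPred_eq, QPath.length_comp, ha, hb]
      · rw [ConcatAlgebra.basisMul_of_ne h]
        exact zero_mem _
    exact h (Submodule.mul_mem_mul hf hg)

instance : SetLike.GradedMonoid (quotGrade I) where
  one_mem := ⟨1, SetLike.GradedOne.one_mem, rfl⟩
  mul_mem := by
    rintro m n _ _ ⟨f, hf, rfl⟩ ⟨g, hg, rfl⟩
    exact ⟨f * g, SetLike.GradedMul.mul_mem hf hg, map_mul (Ideal.Quotient.mkₐ k I) f g⟩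

end

end PathAlgebra

/-!
Write `A = kQ/I`. As `I` starts in degree two, the vertices form a basis of `A_0` and the arrows one of
`A_1`. Given a linear left coaction on `A` over a weak bialgebra `O` with `A_0 ≅ O_t`, let `y a b` be
its matrix coefficients with respect to vertices and arrows. They satisfy the defining relations of
the face algebra. The relations between vertices and arrows express multiplicativity of the coaction.
The relations `y i j * y m n = δ_{i,m} δ_{j,n} y i j` and `∑ y i j = 1` between vertices use
`A_0 ≅ O_t`: the vertices become orthogonal idempotents `t i` of `O_t`, the equation
`Δ(1) = ∑ s j ⊗ t j` defines elements `s j ∈ O` with `y i j = t i * s j = s j * t i`, and the counit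
axioms show that the `s j` are orthogonal idempotents with sum one
(`WeakBialgebra.coeff_idempotents_of_target`). The universal property of the face algebra gives an
algebra map `π : H(Q) → O`, which is a coalgebra map because it is one on generators
(`FaceAlgebra.exists_bialgHom`). Right coactions are treated symmetrically.

If `O` is universal, `π` is surjective. Its image `K` is a weak bialgebra, it contains the coefficients
of the coaction since `A` is generated by vertices and arrows, and it contains `O_s` and `O_t`; so the
coaction restricts to `K` and satisfies the same conditions there (the lemmas called `restrict`).
Universality gives a map `O → K` whose composite with the inclusion of `K` is the identity of `O` by
uniqueness, so that `K = O`. In the transposed case both coactions have the same coefficients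
(`IsTransposed.mem_range`), so the map `π` built from the left coaction serves for both.

Finally the kernel of `π` is a biideal, and `π` induces an isomorphism from the quotient by it
(`BialgHom.exists_quotient_equiv`).
-/

/-! ### Counital maps of a weak bialgebra -/

namespace WeakBialgebra

section Slices

variable {k H : Type*} [Field k] [Ring H] [Algebra k H]

theorem lid_rTensor_assoc_mul (f : H →ₗ[k] k) (z w : H ⊗[k] H) :
    TensorProduct.lid k (H ⊗[k] H) (LinearMap.rTensor (H ⊗[k] H) f
      (TensorProduct.assoc k H H H (z ⊗ₜ[k] (1 : H)) * (1 : H) ⊗ₜ[k] w)) =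
    TensorProduct.lid k H (LinearMap.rTensor H f z) ⊗ₜ[k] 1 * w := by
  induction z with
  | zero => simp
  | add x y hx hy => simp only [map_add, add_mul, TensorProduct.add_tmul, hx, hy]
  | tmul a b =>
    induction w with
    | zero => simp
    | add x y hx hy => simp only [map_add, mul_add, TensorProduct.tmul_add, hx, hy]
    | tmul c d => simp [TensorProduct.smul_tmul']

theorem lid_rTensor_mul_assoc (f : H →ₗ[k] k) (z w : H ⊗[k] H) :
    TensorProduct.lid k (H ⊗[k] H) (LinearMap.rTensor (H ⊗[k] H) f
      ((1 : H) ⊗ₜ[k] w * TensorProduct.assoc k H H H (z ⊗ₜ[k] (1 : H)))) =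
    w * TensorProduct.lid k H (LinearMap.rTensor H f z) ⊗ₜ[k] 1 := by
  induction z with
  | zero => simp
  | add x y hx hy => simp only [map_add, mul_add, TensorProduct.add_tmul, hx, hy]
  | tmul a b =>
    induction w with
    | zero => simp
    | add x y hx hy => simp only [map_add, add_mul, TensorProduct.tmul_add, hx, hy]
    | tmul c d => simp [TensorProduct.smul_tmul']

theorem rid_lTensor_assoc_mul (f : H →ₗ[k] k) (z w : H ⊗[k] H) :
    TensorProduct.rid k (H ⊗[k] H) (LinearMap.lTensor (H ⊗[k] H) f
      ((TensorProduct.assoc k H H H).symm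
        (TensorProduct.assoc k H H H (z ⊗ₜ[k] (1 : H)) * (1 : H) ⊗ₜ[k] w))) =
    z * 1 ⊗ₜ[k] TensorProduct.rid k H (LinearMap.lTensor H f w) := by
  induction z with
  | zero => simp
  | add x y hx hy => simp only [map_add, add_mul, TensorProduct.add_tmul, hx, hy]
  | tmul a b =>
    induction w with
    | zero => simp
    | add x y hx hy => simp only [map_add, mul_add, TensorProduct.tmul_add, hx, hy]
    | tmul c d => simp

theorem rid_lTensor_mul_assoc (f : H →ₗ[k] k) (z w : H ⊗[k] H) :
    TensorProduct.rid k (H ⊗[k] H) (LinearMap.lTensor (H ⊗[k] H) f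
      ((TensorProduct.assoc k H H H).symm
        ((1 : H) ⊗ₜ[k] w * TensorProduct.assoc k H H H (z ⊗ₜ[k] (1 : H))))) =
    1 ⊗ₜ[k] TensorProduct.rid k H (LinearMap.lTensor H f w) * z := by
  induction z with
  | zero => simp
  | add x y hx hy => simp only [map_add, mul_add, TensorProduct.add_tmul, hx, hy]
  | tmul a b =>
    induction w with
    | zero => simp
    | add x y hx hy => simp only [map_add, add_mul, TensorProduct.tmul_add, hx, hy]
    | tmul c d => simp

end Slices

section Counital

variable {k H : Type*} [Field k] [Ring H] [Algebra k H] [Coalgebra k H]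

theorem targetCounital_apply (h : H) : targetCounital k H h =
    TensorProduct.lid k H (LinearMap.rTensor H Coalgebra.counit
      (Coalgebra.comul (R := k) (1 : H) * h ⊗ₜ[k] (1 : H))) := rfl

theorem sourceCounital_apply (h : H) : sourceCounital k H h =
    TensorProduct.rid k H (LinearMap.lTensor H Coalgebra.counit
      ((1 : H) ⊗ₜ[k] h * Coalgebra.comul (R := k) (1 : H))) := rfl

theorem targetCounital_mem (h : H) : targetCounital k H h ∈ targetSub k H := ⟨h, rfl⟩

theorem sourceCounital_mem (h : H) : sourceCounital k H h ∈ sourceSub k H := ⟨h, rfl⟩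

theorem targetCounital_eq (h : H) : targetCounital k H h =
    TensorProduct.lid k H (LinearMap.rTensor H (Coalgebra.counit ∘ₗ LinearMap.mulRight k h)
      (Coalgebra.comul (R := k) (1 : H))) := by
  rw [targetCounital_apply]
  generalize Coalgebra.comul (R := k) (1 : H) = z
  induction z with
  | zero => simp
  | tmul x y => simp
  | add x y hx hy => simp only [map_add, add_mul, hx, hy]

theorem sourceCounital_eq (h : H) : sourceCounital k H h =
    TensorProduct.rid k H (LinearMap.lTensor H (Coalgebra.counit ∘ₗ LinearMap.mulLeft k h)
      (Coalgebra.comul (R := k) (1 : H))) := by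
  rw [sourceCounital_apply]
  generalize Coalgebra.comul (R := k) (1 : H) = z
  induction z with
  | zero => simp
  | tmul x y => simp
  | add x y hx hy => simp only [map_add, mul_add, hx, hy]

theorem comul_lid_rTensor (f : H →ₗ[k] k) (z : H ⊗[k] H) :
    Coalgebra.comul (R := k) (TensorProduct.lid k H (LinearMap.rTensor H f z)) =
      TensorProduct.lid k (H ⊗[k] H) (LinearMap.rTensor (H ⊗[k] H) f
        (TensorProduct.map LinearMap.id Coalgebra.comul z)) := by
  induction z with
  | zero => simp
  | tmul x y => simp
  | add x y hx hy => simp only [map_add, hx, hy]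

theorem comul_rid_lTensor (f : H →ₗ[k] k) (z : H ⊗[k] H) :
    Coalgebra.comul (R := k) (TensorProduct.rid k H (LinearMap.lTensor H f z)) =
      TensorProduct.rid k (H ⊗[k] H) (LinearMap.lTensor (H ⊗[k] H) f
        (TensorProduct.map Coalgebra.comul LinearMap.id z)) := by
  induction z with
  | zero => simp
  | tmul x y => simp
  | add x y hx hy => simp only [map_add, hx, hy]

theorem map_comul_id_eq (x : H) : TensorProduct.map Coalgebra.comul LinearMap.id
      (Coalgebra.comul (R := k) x) =
    (TensorProduct.assoc k H H H).symm
      (TensorProduct.map LinearMap.id Coalgebra.comul (Coalgebra.comul (R := k) x)) :=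
  ((TensorProduct.assoc k H H H).symm_apply_eq.2 (Coalgebra.coassoc_apply x).symm).symm

variable [WeakBialgebra k H]

theorem comul_of_mem_targetSub {t : H} (ht : t ∈ targetSub k H) :
    Coalgebra.comul (R := k) t = t ⊗ₜ[k] 1 * Coalgebra.comul (R := k) (1 : H) := by
  obtain ⟨h, rfl⟩ := ht
  rw [targetCounital_eq, comul_lid_rTensor, comul_comul_one₁, lid_rTensor_assoc_mul]

theorem comul_of_mem_targetSub' {t : H} (ht : t ∈ targetSub k H) :
    Coalgebra.comul (R := k) t = Coalgebra.comul (R := k) (1 : H) * t ⊗ₜ[k] 1 := by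
  obtain ⟨h, rfl⟩ := ht
  rw [targetCounital_eq, comul_lid_rTensor, comul_comul_one₂, lid_rTensor_mul_assoc]

theorem comul_of_mem_sourceSub {s : H} (hs : s ∈ sourceSub k H) :
    Coalgebra.comul (R := k) s = 1 ⊗ₜ[k] s * Coalgebra.comul (R := k) (1 : H) := by
  obtain ⟨h, rfl⟩ := hs
  rw [sourceCounital_eq, comul_rid_lTensor, map_comul_id_eq, comul_comul_one₂,
    rid_lTensor_mul_assoc]

theorem comul_of_mem_sourceSub' {s : H} (hs : s ∈ sourceSub k H) :
    Coalgebra.comul (R := k) s = Coalgebra.comul (R := k) (1 : H) * 1 ⊗ₜ[k] s := by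
  obtain ⟨h, rfl⟩ := hs
  rw [sourceCounital_eq, comul_rid_lTensor, map_comul_id_eq, comul_comul_one₁,
    rid_lTensor_assoc_mul]

theorem targetCounital_of_mem {t : H} (ht : t ∈ targetSub k H) : targetCounital k H t = t := by
  rw [targetCounital_apply, ← comul_of_mem_targetSub' ht, Coalgebra.rTensor_counit_comul]
  simp

theorem sourceCounital_of_mem {s : H} (hs : s ∈ sourceSub k H) : sourceCounital k H s = s := by
  rw [sourceCounital_apply, ← comul_of_mem_sourceSub hs, Coalgebra.lTensor_counit_comul]
  simp

/-- `ε(xy) = ε(x 1₁) ε(1₂ y)`. -/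
theorem counit_mul_eq₁ {ι : Type*} [Fintype ι] {s t : ι → H}
    (h1 : Coalgebra.comul (R := k) (1 : H) = ∑ i, s i ⊗ₜ[k] t i) (x y : H) :
    Coalgebra.counit (R := k) (x * y) =
      ∑ i, Coalgebra.counit (R := k) (x * s i) * Coalgebra.counit (R := k) (t i * y) := by
  have := counit_mul_mul₁ (k := k) x 1 y
  rw [mul_one, h1] at this
  simpa [map_sum] using this

/-- `ε(xy) = ε(x 1₂) ε(1₁ y)`. -/
theorem counit_mul_eq₂ {ι : Type*} [Fintype ι] {s t : ι → H}
    (h1 : Coalgebra.comul (R := k) (1 : H) = ∑ i, s i ⊗ₜ[k] t i) (x y : H) :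
    Coalgebra.counit (R := k) (x * y) =
      ∑ i, Coalgebra.counit (R := k) (x * t i) * Coalgebra.counit (R := k) (s i * y) := by
  have := counit_mul_mul₂ (k := k) x 1 y
  rw [mul_one, h1] at this
  simpa [map_sum, mul_comm] using this

end Counital

section Maps

variable {k H K : Type*} [Field k] [Ring H] [Algebra k H] [Coalgebra k H]
  [Ring K] [Algebra k K] [Coalgebra k K]

theorem map_targetCounital (f : H →ₐc[k] K) (h : H) :
    f (targetCounital k H h) = targetCounital k K (f h) := by
  rw [targetCounital_eq, targetCounital_eq, ← map_one f, ← CoalgHomClass.map_comp_comul_apply]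
  generalize Coalgebra.comul (R := k) (1 : H) = z
  induction z with
  | zero => simp
  | add x y hx hy => simp only [map_add, hx, hy]
  | tmul x y =>
    simp only [LinearMap.rTensor_tmul, TensorProduct.map_tmul, TensorProduct.lid_tmul,
      LinearMap.comp_apply, LinearMap.mulRight_apply, map_smul]
    congr 1
    rw [← CoalgHomClass.counit_comp_apply f, map_mul]
    rfl

theorem map_sourceCounital (f : H →ₐc[k] K) (h : H) :
    f (sourceCounital k H h) = sourceCounital k K (f h) := by
  rw [sourceCounital_eq, sourceCounital_eq, ← map_one f, ← CoalgHomClass.map_comp_comul_apply]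
  generalize Coalgebra.comul (R := k) (1 : H) = z
  induction z with
  | zero => simp
  | add x y hx hy => simp only [map_add, hx, hy]
  | tmul x y =>
    simp only [LinearMap.lTensor_tmul, TensorProduct.map_tmul, TensorProduct.rid_tmul,
      LinearMap.comp_apply, LinearMap.mulLeft_apply, map_smul]
    congr 1
    rw [← CoalgHomClass.counit_comp_apply f, map_mul]
    rfl

end Maps

end WeakBialgebra

/-! ### Idempotents in the counital subalgebras -/

namespace WeakBialgebra

section Coefficients

variable {k H : Type*} [Field k] [AddCommGroup H] [Module k H]
  {ι : Type*} [Fintype ι] [DecidableEq ι]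

/-- The coefficients of a combination of a family that has dual functionals. -/
theorem rid_lTensor_sum_tmul {M : Type*} [AddCommGroup M] [Module k M] {t : ι → M}
    {g : ι → M →ₗ[k] k} (hg : ∀ i j, g j (t i) = if i = j then 1 else 0) (c : ι → H) (j : ι) :
    TensorProduct.rid k H (LinearMap.lTensor H (g j) (∑ i, c i ⊗ₜ[k] t i)) = c j := by
  simp [map_sum, hg]

theorem lid_rTensor_sum_tmul {M : Type*} [AddCommGroup M] [Module k M] {t : ι → M}
    {g : ι → M →ₗ[k] k} (hg : ∀ i j, g j (t i) = if i = j then 1 else 0) (c : ι → H) (j : ι) :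
    TensorProduct.lid k H (LinearMap.rTensor H (g j) (∑ i, t i ⊗ₜ[k] c i)) = c j := by
  simp [map_sum, hg]

end Coefficients

section Base

variable {k H : Type*} [Field k] [Ring H] [Algebra k H] [Coalgebra k H]
  {ι : Type*} [Fintype ι] [DecidableEq ι]

variable [WeakBialgebra k H]

/-- If `H_t` contains a linearly independent complete family of orthogonal idempotents `t i`, spanning
a left subcomodule with matrix coefficients `y i j`, then the `y i j` form a complete family of
orthogonal idempotents: `y i j = t i * s j` where `Δ(1) = ∑ j, s j ⊗ t j`, and the `s j` are
orthogonal idempotents commuting with the `t i`. -/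
theorem coeff_idempotents_of_target {t : ι → H} {y : ι → ι → H} {g : ι → H →ₗ[k] k}
    (ht : ∀ i, t i ∈ targetSub k H) (ht_mul : ∀ i j, t i * t j = if i = j then t i else 0)
    (ht_one : ∑ i, t i = 1) (hg : ∀ i j, g j (t i) = if i = j then 1 else 0)
    (hy : ∀ i, Coalgebra.comul (R := k) (t i) = ∑ j, y i j ⊗ₜ[k] t j) :
    (∀ i j m n, y i j * y m n = if i = m then if j = n then y i j else 0 else 0) ∧
      ∑ i, ∑ j, y i j = 1 := by
  obtain ⟨s, hs⟩ : ∃ s : ι → H, ∀ j, s j = ∑ i, y i j := ⟨_, fun _ => rfl⟩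
  have h1 : Coalgebra.comul (R := k) (1 : H) = ∑ j, s j ⊗ₜ[k] t j := by
    simp only [← ht_one, map_sum, hy, hs, TensorProduct.sum_tmul]
    exact Finset.sum_comm
  have coeff {c d : ι → H} (h : ∑ i, c i ⊗ₜ[k] t i = ∑ i, d i ⊗ₜ[k] t i) (i : ι) : c i = d i := by
    rw [← rid_lTensor_sum_tmul hg c i, h, rid_lTensor_sum_tmul hg]
  -- Compare coefficients in `Δ(t) = (t ⊗ 1) Δ(1) = Δ(1) (t ⊗ 1)`, valid in `H_t`.
  have hts (i j : ι) : y i j = t i * s j := by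
    refine coeff (c := y i) (d := fun j => t i * s j) ?_ j
    rw [← hy, comul_of_mem_targetSub (ht i), h1, Finset.mul_sum]
    simp
  have hst (i j : ι) : y i j = s j * t i := by
    refine coeff (c := y i) (d := fun j => s j * t i) ?_ j
    rw [← hy, comul_of_mem_targetSub' (ht i), h1, Finset.sum_mul]
    simp
  have hcomm (i j : ι) : s j * t i = t i * s j := (hst i j).symm.trans (hts i j)
  -- Compare coefficients in `Δ(1) Δ(1) = Δ(1)`.
  have hss (i : ι) : s i * s i = s i := by
    refine coeff (c := fun i => s i * s i) ?_ i
    rw [← h1, ← mul_one (1 : H), comul_mul, h1, Finset.sum_mul_sum]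
    simp [ht_mul, TensorProduct.tmul_ite]
  have hε (i j : ι) : Coalgebra.counit (R := k) (t i * s j) = if i = j then 1 else 0 := by
    have h := congrArg (TensorProduct.lid k H) (Coalgebra.rTensor_counit_comul (R := k) (t i))
    rw [hy] at h
    simp only [map_sum, LinearMap.rTensor_tmul, TensorProduct.lid_tmul, one_smul] at h
    rw [← hts, ← hg i j]
    conv_rhs => rw [← h]
    simp [map_sum, hg]
  -- Coassociativity at `1`.
  have hΔ (l : ι) : Coalgebra.comul (R := k) (s l) = ∑ j, s j ⊗ₜ[k] (t j * s l) := by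
    have h := Coalgebra.coassoc_symm_apply (R := k) (1 : H)
    rw [h1] at h
    simp only [map_sum, LinearMap.rTensor_tmul, LinearMap.lTensor_tmul, hy,
      TensorProduct.tmul_sum, TensorProduct.assoc_symm_tmul] at h
    rw [Finset.sum_comm] at h
    simp only [← TensorProduct.sum_tmul] at h
    have h' := rid_lTensor_sum_tmul (H := H ⊗[k] H) hg (fun i => Coalgebra.comul (R := k) (s i)) l
    rw [← h, rid_lTensor_sum_tmul hg] at h'
    simp only [← h', hts]
  -- For `i ≠ j` the counit law expresses `s i * s j` through the values `ε(s i * t m * s j)`.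
  have hs_mul (i j : ι) : s i * s j = if i = j then s i else 0 := by
    split_ifs with hij
    · rw [← hij, hss]
    · have h := congrArg (TensorProduct.rid k H)
        (Coalgebra.lTensor_counit_comul (R := k) (s i * s j))
      have hΔ' : Coalgebra.comul (R := k) (s i * s j) = ∑ m, s m ⊗ₜ[k] (s i * t m * s j) := by
        rw [comul_mul, hΔ, hΔ, Finset.sum_mul_sum]
        refine Finset.sum_congr rfl fun m _ => ?_
        simp only [Algebra.TensorProduct.tmul_mul_tmul, ← hcomm m i]
        rw [Finset.sum_eq_single m]
        · rw [hss, ← mul_assoc, mul_assoc (s i), ht_mul, if_pos rfl]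
        · intro n _ hn
          rw [← mul_assoc, mul_assoc (s i), ht_mul, if_neg hn.symm]
          simp
        · simp
      have h0 (m : ι) : Coalgebra.counit (R := k) (s i * t m * s j) = 0 := by
        -- Splitting at either end of `t m` shows that the value vanishes unless `m = i` and `m = j`.
        by_cases hmi : m = i
        · rw [mul_assoc, counit_mul_eq₁ h1]
          refine Finset.sum_eq_zero fun l _ => ?_
          rw [← mul_assoc, ht_mul]
          by_cases hl : l = m
          · rw [if_pos hl, hε, if_neg (by rw [hl, hmi]; exact hij), mul_zero]
          · simp [hl]
        · rw [counit_mul_eq₂ h1]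
          refine Finset.sum_eq_zero fun l _ => ?_
          rw [mul_assoc, ht_mul]
          by_cases hl : m = l
          · rw [if_pos hl, hcomm, hε, if_neg hmi, zero_mul]
          · simp [hl]
      rw [hΔ'] at h
      simpa [map_sum, h0] using h.symm
  -- The counit law gives `1 = ∑ ε(t i) s i`; multiplication by `s i` shows `ε(t i) s i = s i`.
  have hs_one : ∑ i, s i = 1 := by
    have h := congrArg (TensorProduct.rid k H) (Coalgebra.lTensor_counit_comul (R := k) (1 : H))
    rw [h1] at h
    simp only [map_sum, LinearMap.lTensor_tmul, TensorProduct.rid_tmul, one_smul] at h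
    have hi (i : ι) : Coalgebra.counit (R := k) (t i) • s i = s i := by
      have := congrArg (s i * ·) h
      simpa [Finset.mul_sum, hs_mul] using this
    rw [← h]
    exact Finset.sum_congr rfl fun i _ => (hi i).symm
  constructor
  · intro i j m n
    rw [hts, hts, mul_assoc, ← mul_assoc (s j), hcomm, mul_assoc, ← mul_assoc, ht_mul, hs_mul]
    split_ifs <;> simp
  · rw [Finset.sum_comm, ← hs_one]
    exact Finset.sum_congr rfl fun j _ => (hs j).symm

/-- The mirror image of `coeff_idempotents_of_target` for a complete family of orthogonal idempotents
in `H_s` spanning a right subcomodule. -/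
theorem coeff_idempotents_of_source {s : ι → H} {y : ι → ι → H} {g : ι → H →ₗ[k] k}
    (hs : ∀ i, s i ∈ sourceSub k H) (hs_mul : ∀ i j, s i * s j = if i = j then s i else 0)
    (hs_one : ∑ i, s i = 1) (hg : ∀ i j, g j (s i) = if i = j then 1 else 0)
    (hy : ∀ j, Coalgebra.comul (R := k) (s j) = ∑ i, s i ⊗ₜ[k] y i j) :
    (∀ i j m n, y i j * y m n = if i = m then if j = n then y i j else 0 else 0) ∧
      ∑ i, ∑ j, y i j = 1 := by
  obtain ⟨t, ht⟩ : ∃ t : ι → H, ∀ i, t i = ∑ j, y i j := ⟨_, fun _ => rfl⟩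
  have h1 : Coalgebra.comul (R := k) (1 : H) = ∑ j, s j ⊗ₜ[k] t j := by
    simp only [← hs_one, map_sum, hy, ht, TensorProduct.tmul_sum]
    exact Finset.sum_comm
  have coeff {c d : ι → H} (h : ∑ i, s i ⊗ₜ[k] c i = ∑ i, s i ⊗ₜ[k] d i) (i : ι) : c i = d i := by
    rw [← lid_rTensor_sum_tmul hg c i, h, lid_rTensor_sum_tmul hg]
  -- Compare coefficients in `Δ(s) = (1 ⊗ s) Δ(1) = Δ(1) (1 ⊗ s)`, valid in `H_s`.
  have hst (i j : ι) : y i j = s j * t i := by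
    refine coeff (c := fun i => y i j) (d := fun i => s j * t i) ?_ i
    rw [← hy, comul_of_mem_sourceSub (hs j), h1, Finset.mul_sum]
    simp
  have hts (i j : ι) : y i j = t i * s j := by
    refine coeff (c := fun i => y i j) (d := fun i => t i * s j) ?_ i
    rw [← hy, comul_of_mem_sourceSub' (hs j), h1, Finset.sum_mul]
    simp
  have hcomm (i j : ι) : s j * t i = t i * s j := (hst i j).symm.trans (hts i j)
  -- Compare coefficients in `Δ(1) Δ(1) = Δ(1)`.
  have htt (i : ι) : t i * t i = t i := by
    refine coeff (c := fun i => t i * t i) ?_ i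
    rw [← h1, ← mul_one (1 : H), comul_mul, h1, Finset.sum_mul_sum]
    simp [hs_mul, TensorProduct.ite_tmul]
  have hε (i j : ι) : Coalgebra.counit (R := k) (t i * s j) = if i = j then 1 else 0 := by
    have h := congrArg (TensorProduct.rid k H) (Coalgebra.lTensor_counit_comul (R := k) (s j))
    rw [hy] at h
    simp only [map_sum, LinearMap.lTensor_tmul, TensorProduct.rid_tmul, one_smul] at h
    rw [← hts]
    have h' := hg j i
    rw [← h] at h'
    simpa [map_sum, hg, eq_comm] using h'
  -- Coassociativity at `1`.
  have hΔ (l : ι) : Coalgebra.comul (R := k) (t l) = ∑ j, (t l * s j) ⊗ₜ[k] t j := by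
    have h := Coalgebra.coassoc_apply (R := k) (1 : H)
    rw [h1] at h
    simp only [map_sum, LinearMap.rTensor_tmul, LinearMap.lTensor_tmul, hy,
      TensorProduct.sum_tmul, TensorProduct.assoc_tmul] at h
    rw [Finset.sum_comm] at h
    simp only [← TensorProduct.tmul_sum] at h
    have h' := lid_rTensor_sum_tmul (H := H ⊗[k] H) hg (fun i => Coalgebra.comul (R := k) (t i)) l
    rw [← h, lid_rTensor_sum_tmul hg] at h'
    simp only [← h', hts]
  -- For `i ≠ j` the counit law expresses `t i * t j` through the values `ε(t i * s m * t j)`.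
  have ht_mul (i j : ι) : t i * t j = if i = j then t i else 0 := by
    split_ifs with hij
    · rw [← hij, htt]
    · have h := congrArg (TensorProduct.lid k H)
        (Coalgebra.rTensor_counit_comul (R := k) (t i * t j))
      have hΔ' : Coalgebra.comul (R := k) (t i * t j) = ∑ m, (t i * s m * t j) ⊗ₜ[k] t m := by
        rw [comul_mul, hΔ, hΔ, Finset.sum_mul_sum]
        refine Finset.sum_congr rfl fun m _ => ?_
        simp only [Algebra.TensorProduct.tmul_mul_tmul, ← hcomm j]
        rw [Finset.sum_eq_single m]
        · rw [htt, ← mul_assoc, mul_assoc (t i), hs_mul, if_pos rfl]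
        · intro n _ hn
          rw [← mul_assoc, mul_assoc (t i), hs_mul, if_neg hn.symm]
          simp
        · simp
      have h0 (m : ι) : Coalgebra.counit (R := k) (t i * s m * t j) = 0 := by
        by_cases hmi : m = i
        · rw [mul_assoc, counit_mul_eq₂ h1]
          refine Finset.sum_eq_zero fun l _ => ?_
          rw [← mul_assoc, hs_mul]
          by_cases hl : l = m
          · rw [if_pos hl, hl, hcomm, hε, if_neg (by rw [hmi]; exact fun e => hij e.symm), mul_zero]
          · simp [hl]
        · rw [counit_mul_eq₁ h1]
          refine Finset.sum_eq_zero fun l _ => ?_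
          rw [mul_assoc, hs_mul]
          by_cases hl : m = l
          · rw [if_pos hl, hε, if_neg (fun e => hmi e.symm), zero_mul]
          · simp [hl]
      rw [hΔ'] at h
      simpa [map_sum, h0] using h.symm
  -- The counit law gives `1 = ∑ ε(s i) t i`; multiplication by `t i` shows `ε(s i) t i = t i`.
  have ht_one : ∑ i, t i = 1 := by
    have h := congrArg (TensorProduct.lid k H) (Coalgebra.rTensor_counit_comul (R := k) (1 : H))
    rw [h1] at h
    simp only [map_sum, LinearMap.rTensor_tmul, TensorProduct.lid_tmul, one_smul] at h
    have hi (i : ι) : Coalgebra.counit (R := k) (s i) • t i = t i := by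
      have := congrArg (t i * ·) h
      simpa [Finset.mul_sum, ht_mul] using this
    rw [← h]
    exact Finset.sum_congr rfl fun i _ => (hi i).symm
  constructor
  · intro i j m n
    rw [hts, hts, mul_assoc, ← mul_assoc (s j), hcomm, mul_assoc, ← mul_assoc, ht_mul, hs_mul]
    split_ifs <;> simp
  · rw [← ht_one]
    exact Finset.sum_congr rfl fun j _ => (ht j).symm

end Base

end WeakBialgebra

/-! ### Restriction of coactions to a sub-weak-bialgebra -/

section TensorAux

variable {k : Type*} [Field k] {M N P : Type*} [AddCommGroup M] [Module k M]
  [AddCommGroup N] [Module k N] [AddCommGroup P] [Module k P]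

theorem TensorProduct.map_injective_of_injective {M' N' : Type*} [AddCommGroup M'] [Module k M']
    [AddCommGroup N'] [Module k N'] {f : M →ₗ[k] M'} {g : N →ₗ[k] N'}
    (hf : Function.Injective f) (hg : Function.Injective g) :
    Function.Injective (TensorProduct.map f g) :=
  TensorProduct.map_injective_of_flat_flat f g hf hg

theorem Submodule.mem_range_lTensor_subtype_iff (S : Submodule k N) (z : M ⊗[k] N) :
    z ∈ LinearMap.range (LinearMap.lTensor M S.subtype) ↔ LinearMap.lTensor M S.mkQ z = 0 :=
  (lTensor_exact M (LinearMap.exact_subtype_mkQ S) S.mkQ_surjective z).symm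

theorem Submodule.mem_range_rTensor_subtype_iff (S : Submodule k N) (z : N ⊗[k] M) :
    z ∈ LinearMap.range (LinearMap.rTensor M S.subtype) ↔ LinearMap.rTensor M S.mkQ z = 0 :=
  (rTensor_exact M (LinearMap.exact_subtype_mkQ S) S.mkQ_surjective z).symm

theorem TensorProduct.map_eq_rTensor_lTensor {M' N' : Type*} [AddCommGroup M'] [Module k M']
    [AddCommGroup N'] [Module k N'] (f : M →ₗ[k] M') (g : N →ₗ[k] N') (z : M ⊗[k] N) :
    TensorProduct.map f g z = LinearMap.rTensor N' f (LinearMap.lTensor M g z) :=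
  congrFun (congrArg DFunLike.coe (LinearMap.rTensor_comp_lTensor _ _ _).symm) z

theorem TensorProduct.map_eq_lTensor_rTensor {M' N' : Type*} [AddCommGroup M'] [Module k M']
    [AddCommGroup N'] [Module k N'] (f : M →ₗ[k] M') (g : N →ₗ[k] N') (z : M ⊗[k] N) :
    TensorProduct.map f g z = LinearMap.lTensor M' g (LinearMap.rTensor N f z) :=
  congrFun (congrArg DFunLike.coe (LinearMap.lTensor_comp_rTensor _ _ _).symm) z

end TensorAux

section Restriction

variable {k : Type*} [Field k] {A : Type*} [Ring A] [Algebra k A] {𝒜 : ℕ → Submodule k A}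
  {K O : Type*} [Ring K] [Algebra k K] [Coalgebra k K]
  [Ring O] [Algebra k O] [Coalgebra k O]
  {ι : K →ₐc[k] O}

namespace WeakBialgebra

/-- The image of a unital map contains `O_t`, because `Δ(1)` lies in its tensor square. -/
theorem targetSub_le_range (ι : K →ₐc[k] O) :
    targetSub k O ≤ LinearMap.range (ι : K →ₗ[k] O) := by
  rintro _ ⟨h, rfl⟩
  rw [targetCounital_eq, ← map_one ι, ← CoalgHomClass.map_comp_comul_apply]
  generalize Coalgebra.comul (R := k) (1 : K) = z
  induction z with
  | zero => simp
  | tmul x y =>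
    simp only [TensorProduct.map_tmul, LinearMap.rTensor_tmul, TensorProduct.lid_tmul]
    exact Submodule.smul_mem _ _ ⟨y, rfl⟩
  | add x y hx hy => simpa only [map_add] using add_mem hx hy

/-- The image of a unital map contains `O_s`, because `Δ(1)` lies in its tensor square. -/
theorem sourceSub_le_range (ι : K →ₐc[k] O) :
    sourceSub k O ≤ LinearMap.range (ι : K →ₗ[k] O) := by
  rintro _ ⟨h, rfl⟩
  rw [sourceCounital_eq, ← map_one ι, ← CoalgHomClass.map_comp_comul_apply]
  generalize Coalgebra.comul (R := k) (1 : K) = z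
  induction z with
  | zero => simp
  | tmul x y =>
    simp only [TensorProduct.map_tmul, LinearMap.lTensor_tmul, TensorProduct.rid_tmul]
    exact Submodule.smul_mem _ _ ⟨x, rfl⟩
  | add x y hx hy => simpa only [map_add] using add_mem hx hy

variable [WeakBialgebra k O]

/-- An injective weak bialgebra map restricts to a bijection of target counital subalgebras. -/
theorem map_targetSub (hι : Function.Injective ι) :
    (targetSub k K).map (ι : K →ₗ[k] O) = targetSub k O := by
  apply le_antisymm
  · rintro _ ⟨_, ⟨h, rfl⟩, rfl⟩
    exact ⟨ι h, (map_targetCounital ι h).symm⟩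
  · intro x hx
    obtain ⟨y, rfl⟩ := targetSub_le_range ι hx
    exact ⟨y, ⟨y, hι (by rw [map_targetCounital]; exact targetCounital_of_mem hx)⟩, rfl⟩

/-- An injective weak bialgebra map restricts to a bijection of source counital subalgebras. -/
theorem map_sourceSub (hι : Function.Injective ι) :
    (sourceSub k K).map (ι : K →ₗ[k] O) = sourceSub k O := by
  apply le_antisymm
  · rintro _ ⟨_, ⟨h, rfl⟩, rfl⟩
    exact ⟨ι h, (map_sourceCounital ι h).symm⟩
  · intro x hx
    obtain ⟨y, rfl⟩ := sourceSub_le_range ι hx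
    exact ⟨y, ⟨y, hι (by rw [map_sourceCounital]; exact sourceCounital_of_mem hx)⟩, rfl⟩

end WeakBialgebra

theorem BialgHom.exists_leftInverse (hι : Function.Injective ι) :
    ∃ σ : O →ₗ[k] K, ∀ x, σ (ι x) = x := by
  obtain ⟨σ, hσ⟩ := LinearMap.exists_leftInverse_of_injective (ι : K →ₗ[k] O)
    (LinearMap.ker_eq_bot.2 hι)
  exact ⟨σ, fun x => congrFun (congrArg DFunLike.coe hσ) x⟩

/-- An algebra map whose values lie in the image of an injective map `ι` factors through `ι`. -/
theorem BialgHom.exists_algHom_lift (hι : Function.Injective ι) {B : Type*} [Ring B] [Algebra k B]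
    (f : B →ₐ[k] O) (hf : ∀ b, f b ∈ LinearMap.range (ι : K →ₗ[k] O)) :
    ∃ g : B →ₐ[k] K, ∀ b, ι (g b) = f b := by
  let e := AlgEquiv.ofInjective (ι : K →ₐ[k] O) hι
  refine ⟨(e.symm : _ →ₐ[k] K).comp (f.codRestrict (ι : K →ₐ[k] O).range hf), fun b => ?_⟩
  exact congrArg Subtype.val (e.apply_symm_apply (f.codRestrict (ι : K →ₐ[k] O).range hf b))

theorem exists_rTensor_lift (hι : Function.Injective ι) {M : Type*} [AddCommGroup M] [Module k M]
    {lam : M →ₗ[k] O ⊗[k] M}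
    (h : ∀ a, lam a ∈ LinearMap.range (LinearMap.rTensor M (ι : K →ₗ[k] O))) :
    ∃ lamK : M →ₗ[k] K ⊗[k] M, ∀ a, LinearMap.rTensor M (ι : K →ₗ[k] O) (lamK a) = lam a := by
  obtain ⟨σ, hσ⟩ := BialgHom.exists_leftInverse hι
  have hσ' : σ ∘ₗ (ι : K →ₗ[k] O) = LinearMap.id := LinearMap.ext hσ
  refine ⟨LinearMap.rTensor M σ ∘ₗ lam, fun a => ?_⟩
  obtain ⟨z, hz⟩ := h a
  rw [LinearMap.comp_apply, ← hz, ← LinearMap.rTensor_comp_apply _ σ, hσ', LinearMap.rTensor_id]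
  rfl

theorem exists_lTensor_lift (hι : Function.Injective ι) {M : Type*} [AddCommGroup M] [Module k M]
    {rho : M →ₗ[k] M ⊗[k] O}
    (h : ∀ a, rho a ∈ LinearMap.range (LinearMap.lTensor M (ι : K →ₗ[k] O))) :
    ∃ rhoK : M →ₗ[k] M ⊗[k] K, ∀ a, LinearMap.lTensor M (ι : K →ₗ[k] O) (rhoK a) = rho a := by
  obtain ⟨σ, hσ⟩ := BialgHom.exists_leftInverse hι
  have hσ' : σ ∘ₗ (ι : K →ₗ[k] O) = LinearMap.id := LinearMap.ext hσ
  refine ⟨LinearMap.lTensor M σ ∘ₗ rho, fun a => ?_⟩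
  obtain ⟨z, hz⟩ := h a
  rw [LinearMap.comp_apply, ← hz, ← LinearMap.lTensor_comp_apply _ σ, hσ', LinearMap.lTensor_id]
  rfl

variable {lam : A →ₗ[k] O ⊗[k] A} {lamK : A →ₗ[k] K ⊗[k] A}
  {rho : A →ₗ[k] A ⊗[k] O} {rhoK : A →ₗ[k] A ⊗[k] K}

theorem BialgHom.comul_apply (f : K →ₐc[k] O) (x : K) : Coalgebra.comul (R := k) (f x) =
    TensorProduct.map (f : K →ₗ[k] O) (f : K →ₗ[k] O) (Coalgebra.comul (R := k) x) :=
  (CoalgHomClass.map_comp_comul_apply f x).symm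

theorem BialgHom.counit_apply (f : K →ₐc[k] O) (x : K) : Coalgebra.counit (R := k) (f x) =
    Coalgebra.counit (R := k) x :=
  CoalgHomClass.counit_comp_apply f x

/-- A left comodule algebra structure restricts to a sub-weak-bialgebra containing its
coefficients. -/
theorem IsLeftComoduleAlgebra.restrict [WeakBialgebra k O] (hι : Function.Injective ι)
    (h : ∀ a, LinearMap.rTensor A (ι : K →ₗ[k] O) (lamK a) = lam a)
    (hl : IsLeftComoduleAlgebra 𝒜 O lam) : IsLeftComoduleAlgebra 𝒜 K lamK where
  coassoc := by
    have hJ : Function.Injective (TensorProduct.map (ι : K →ₗ[k] O)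
        (LinearMap.rTensor A (ι : K →ₗ[k] O))) :=
      TensorProduct.map_injective_of_injective hι
        (Module.Flat.rTensor_preserves_injective_linearMap _ hι)
    have h₁ (z : K ⊗[k] A) : TensorProduct.map (ι : K →ₗ[k] O)
        (LinearMap.rTensor A (ι : K →ₗ[k] O))
          (TensorProduct.assoc k K K A (LinearMap.rTensor A Coalgebra.comul z)) =
        TensorProduct.assoc k O O A (LinearMap.rTensor A Coalgebra.comul
          (LinearMap.rTensor A (ι : K →ₗ[k] O) z)) := by
      induction z with
      | zero => simp
      | add x y hx hy => simp only [map_add, hx, hy]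
      | tmul x y =>
        simp only [LinearMap.rTensor_tmul, LinearMap.coe_coe, BialgHom.comul_apply]
        generalize Coalgebra.comul (R := k) x = w
        induction w with
        | zero => simp
        | add x y hx hy => simp only [map_add, TensorProduct.add_tmul, hx, hy]
        | tmul a b => simp
    have h₂ (z : K ⊗[k] A) : TensorProduct.map (ι : K →ₗ[k] O)
        (LinearMap.rTensor A (ι : K →ₗ[k] O)) (LinearMap.lTensor K lamK z) =
        LinearMap.lTensor O lam (LinearMap.rTensor A (ι : K →ₗ[k] O) z) := by
      induction z with
      | zero => simp
      | add x y hx hy => simp only [map_add, hx, hy]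
      | tmul x y => simp [h]
    refine LinearMap.ext fun a => hJ ?_
    have := congrFun (congrArg DFunLike.coe hl.coassoc) a
    simp only [LinearMap.comp_apply, LinearEquiv.coe_coe] at this ⊢
    rw [h₁, h₂, h, this]
  counit_coact := by
    have h₁ (z : K ⊗[k] A) : LinearMap.rTensor A (Coalgebra.counit (R := k))
        (LinearMap.rTensor A (ι : K →ₗ[k] O) z) =
        LinearMap.rTensor A (Coalgebra.counit (R := k)) z := by
      rw [← LinearMap.rTensor_comp_apply]
      congr 2
      exact LinearMap.ext fun x => BialgHom.counit_apply ι x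
    refine LinearMap.ext fun a => ?_
    have := congrFun (congrArg DFunLike.coe hl.counit_coact) a
    simp only [LinearMap.comp_apply, LinearEquiv.coe_coe] at this ⊢
    rw [← h₁, h, this]
  map_mul a b := by
    have hm (x y : K ⊗[k] A) : LinearMap.rTensor A (ι : K →ₗ[k] O) (x * y) =
        LinearMap.rTensor A (ι : K →ₗ[k] O) x * LinearMap.rTensor A (ι : K →ₗ[k] O) y :=
      _root_.map_mul (Algebra.TensorProduct.map (ι : K →ₐ[k] O) (AlgHom.id k A)) x y
    apply Module.Flat.rTensor_preserves_injective_linearMap (M := A) (ι : K →ₗ[k] O) hι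
    rw [hm, h, h, h, hl.map_mul]
  map_one_mem := by
    have h₁ (z : K ⊗[k] A) : LinearMap.rTensor A (ι : K →ₗ[k] O)
        (LinearMap.rTensor A (WeakBialgebra.sourceCounital k K) z) =
        LinearMap.rTensor A (WeakBialgebra.sourceCounital k O)
          (LinearMap.rTensor A (ι : K →ₗ[k] O) z) := by
      rw [← LinearMap.rTensor_comp_apply, ← LinearMap.rTensor_comp_apply]
      congr 2
      exact LinearMap.ext fun x => WeakBialgebra.map_sourceCounital ι x
    have h₂ : LinearMap.rTensor A (WeakBialgebra.sourceCounital k O) (lam 1) = lam 1 := by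
      obtain ⟨z, hz⟩ := hl.map_one_mem
      rw [← hz, ← LinearMap.rTensor_comp_apply]
      congr 2
      exact LinearMap.ext fun x => WeakBialgebra.sourceCounital_of_mem x.2
    have h₃ : LinearMap.rTensor A (WeakBialgebra.sourceCounital k K) (lamK 1) = lamK 1 := by
      apply Module.Flat.rTensor_preserves_injective_linearMap (M := A) (ι : K →ₗ[k] O) hι
      rw [h₁, h, h₂]
    refine ⟨LinearMap.rTensor A ((WeakBialgebra.sourceCounital k K).codRestrict
      (WeakBialgebra.sourceSub k K) WeakBialgebra.sourceCounital_mem) (lamK 1), ?_⟩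
    rw [← LinearMap.rTensor_comp_apply, LinearMap.subtype_comp_codRestrict, h₃]
  linear n a ha := by
    have := hl.linear n a ha
    rw [Submodule.mem_range_lTensor_subtype_iff] at this ⊢
    apply Module.Flat.rTensor_preserves_injective_linearMap (M := A ⧸ 𝒜 n) (ι : K →ₗ[k] O) hι
    rw [← TensorProduct.map_eq_rTensor_lTensor, TensorProduct.map_eq_lTensor_rTensor, h, this,
      map_zero]

/-- A right comodule algebra structure restricts to a sub-weak-bialgebra containing its
coefficients. -/
theorem IsRightComoduleAlgebra.restrict [WeakBialgebra k O] (hι : Function.Injective ι)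
    (h : ∀ a, LinearMap.lTensor A (ι : K →ₗ[k] O) (rhoK a) = rho a)
    (hr : IsRightComoduleAlgebra 𝒜 O rho) : IsRightComoduleAlgebra 𝒜 K rhoK where
  coassoc := by
    have hJ : Function.Injective (TensorProduct.map (LinearMap.id : A →ₗ[k] A)
        (TensorProduct.map (ι : K →ₗ[k] O) (ι : K →ₗ[k] O))) :=
      TensorProduct.map_injective_of_injective Function.injective_id
        (TensorProduct.map_injective_of_injective hι hι)
    have h₁ (z : A ⊗[k] K) : TensorProduct.map (LinearMap.id : A →ₗ[k] A)
        (TensorProduct.map (ι : K →ₗ[k] O) (ι : K →ₗ[k] O))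
          (LinearMap.lTensor A Coalgebra.comul z) =
        LinearMap.lTensor A Coalgebra.comul (LinearMap.lTensor A (ι : K →ₗ[k] O) z) := by
      induction z with
      | zero => simp
      | add x y hx hy => simp only [map_add, hx, hy]
      | tmul x y =>
        simp only [LinearMap.lTensor_tmul, LinearMap.coe_coe, BialgHom.comul_apply,
          TensorProduct.map_tmul, LinearMap.id_apply]
    have h₂ (z : A ⊗[k] K) : TensorProduct.map (LinearMap.id : A →ₗ[k] A)
        (TensorProduct.map (ι : K →ₗ[k] O) (ι : K →ₗ[k] O))
          (TensorProduct.assoc k A K K (LinearMap.rTensor K rhoK z)) =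
        TensorProduct.assoc k A O O
          (LinearMap.rTensor O rho (LinearMap.lTensor A (ι : K →ₗ[k] O) z)) := by
      induction z with
      | zero => simp
      | add x y hx hy => simp only [map_add, hx, hy]
      | tmul x y =>
        simp only [LinearMap.rTensor_tmul, LinearMap.lTensor_tmul, LinearMap.coe_coe, ← h]
        generalize rhoK x = w
        induction w with
        | zero => simp
        | add x y hx hy => simp only [map_add, TensorProduct.add_tmul, hx, hy]
        | tmul a b => simp
    refine LinearMap.ext fun a => hJ ?_
    have := congrFun (congrArg DFunLike.coe hr.coassoc) a
    simp only [LinearMap.comp_apply, LinearEquiv.coe_coe] at this ⊢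
    rw [h₁, h₂, h, this]
  counit_coact := by
    have h₁ (z : A ⊗[k] K) : LinearMap.lTensor A (Coalgebra.counit (R := k))
        (LinearMap.lTensor A (ι : K →ₗ[k] O) z) =
        LinearMap.lTensor A (Coalgebra.counit (R := k)) z := by
      rw [← LinearMap.lTensor_comp_apply]
      congr 2
      exact LinearMap.ext fun x => BialgHom.counit_apply ι x
    refine LinearMap.ext fun a => ?_
    have := congrFun (congrArg DFunLike.coe hr.counit_coact) a
    simp only [LinearMap.comp_apply, LinearEquiv.coe_coe] at this ⊢
    rw [← h₁, h, this]
  map_mul a b := by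
    have hm (x y : A ⊗[k] K) : LinearMap.lTensor A (ι : K →ₗ[k] O) (x * y) =
        LinearMap.lTensor A (ι : K →ₗ[k] O) x * LinearMap.lTensor A (ι : K →ₗ[k] O) y :=
      _root_.map_mul (Algebra.TensorProduct.map (AlgHom.id k A) (ι : K →ₐ[k] O)) x y
    apply Module.Flat.lTensor_preserves_injective_linearMap (M := A) (ι : K →ₗ[k] O) hι
    rw [hm, h, h, h, hr.map_mul]
  map_one_mem := by
    have h₁ (z : A ⊗[k] K) : LinearMap.lTensor A (ι : K →ₗ[k] O)
        (LinearMap.lTensor A (WeakBialgebra.targetCounital k K) z) =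
        LinearMap.lTensor A (WeakBialgebra.targetCounital k O)
          (LinearMap.lTensor A (ι : K →ₗ[k] O) z) := by
      rw [← LinearMap.lTensor_comp_apply, ← LinearMap.lTensor_comp_apply]
      congr 2
      exact LinearMap.ext fun x => WeakBialgebra.map_targetCounital ι x
    have h₂ : LinearMap.lTensor A (WeakBialgebra.targetCounital k O) (rho 1) = rho 1 := by
      obtain ⟨z, hz⟩ := hr.map_one_mem
      rw [← hz, ← LinearMap.lTensor_comp_apply]
      congr 2
      exact LinearMap.ext fun x => WeakBialgebra.targetCounital_of_mem x.2
    have h₃ : LinearMap.lTensor A (WeakBialgebra.targetCounital k K) (rhoK 1) = rhoK 1 := by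
      apply Module.Flat.lTensor_preserves_injective_linearMap (M := A) (ι : K →ₗ[k] O) hι
      rw [h₁, h, h₂]
    refine ⟨LinearMap.lTensor A ((WeakBialgebra.targetCounital k K).codRestrict
      (WeakBialgebra.targetSub k K) WeakBialgebra.targetCounital_mem) (rhoK 1), ?_⟩
    rw [← LinearMap.lTensor_comp_apply, LinearMap.subtype_comp_codRestrict, h₃]
  linear n a ha := by
    have := hr.linear n a ha
    rw [Submodule.mem_range_rTensor_subtype_iff] at this ⊢
    apply Module.Flat.lTensor_preserves_injective_linearMap (M := A ⧸ 𝒜 n) (ι : K →ₗ[k] O) hι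
    rw [← TensorProduct.map_eq_lTensor_rTensor, TensorProduct.map_eq_rTensor_lTensor, h, this,
      map_zero]

theorem IsTransposed.restrict (hι : Function.Injective ι)
    (h : ∀ a, LinearMap.rTensor A (ι : K →ₗ[k] O) (lamK a) = lam a)
    (h' : ∀ a, LinearMap.lTensor A (ι : K →ₗ[k] O) (rhoK a) = rho a)
    (ht : IsTransposed 𝒜 O lam rho) : IsTransposed 𝒜 K lamK rhoK := by
  obtain ⟨σ, hσ⟩ := BialgHom.exists_leftInverse hι
  have hσ' : σ ∘ₗ (ι : K →ₗ[k] O) = LinearMap.id := LinearMap.ext hσ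
  intro n
  obtain ⟨d, v, z, hl, hr⟩ := ht n
  refine ⟨d, v, fun j l => σ (z j l), fun j => ?_, fun j => ?_⟩
  · have := congrArg (LinearMap.rTensor A σ) ((h _).trans (hl j))
    rw [← LinearMap.rTensor_comp_apply, hσ', LinearMap.rTensor_id] at this
    simpa [map_sum] using this
  · have := congrArg (LinearMap.lTensor A σ) ((h' _).trans (hr j))
    rw [← LinearMap.lTensor_comp_apply, hσ', LinearMap.lTensor_id] at this
    simpa [map_sum] using this

variable [SetLike.GradedMonoid 𝒜] [WeakBialgebra k O]

/-- The isomorphism `A_0 ≅ O_t` restricts to an injectively embedded weak bialgebra `K`, since `K_t`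
is mapped onto `O_t`. -/
theorem TargetBaseIso.restrict (hι : Function.Injective ι)
    (h : ∀ a, LinearMap.rTensor A (ι : K →ₗ[k] O) (lamK a) = lam a)
    (hb : TargetBaseIso 𝒜 O lam) : TargetBaseIso 𝒜 K lamK := by
  obtain ⟨lam₀, ψ, h₀, hinj, hrange, hψ⟩ := hb
  obtain ⟨σ, hσ⟩ := BialgHom.exists_leftInverse hι
  have hσ' : σ ∘ₗ (ι : K →ₗ[k] O) = LinearMap.id := LinearMap.ext hσ
  have h₀' (a : 𝒜 0) : LinearMap.lTensor O (𝒜 0).subtype (lam₀ a) = lam a :=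
    congrFun (congrArg DFunLike.coe h₀) a
  obtain ⟨ψK, hψK⟩ := BialgHom.exists_algHom_lift hι ψ fun b =>
    WeakBialgebra.targetSub_le_range ι (hrange ▸ ⟨b, rfl⟩)
  refine ⟨LinearMap.rTensor (𝒜 0) σ ∘ₗ lam₀, ψK, ?_, ?_, ?_, ?_⟩
  · ext a : 1
    simp only [LinearMap.comp_apply, Submodule.subtype_apply]
    rw [← TensorProduct.map_eq_lTensor_rTensor, TensorProduct.map_eq_rTensor_lTensor, h₀', ← h,
      ← LinearMap.rTensor_comp_apply, hσ', LinearMap.rTensor_id]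
    rfl
  · exact fun a b hab => hinj (by rw [← hψK, hab, hψK])
  · apply Submodule.map_injective_of_injective (f := (ι : K →ₗ[k] O)) hι
    rw [WeakBialgebra.map_targetSub hι, ← hrange, ← LinearMap.range_comp]
    congr 1
    exact LinearMap.ext hψK
  · refine LinearMap.ext fun a => TensorProduct.map_injective_of_injective
      (f := (ι : K →ₗ[k] O)) (g := (ι : K →ₗ[k] O)) hι hι ?_
    have hψ' := congrFun (congrArg DFunLike.coe hψ) a
    simp only [LinearMap.comp_apply, AlgHom.toLinearMap_apply] at hψ' ⊢
    rw [← BialgHom.comul_apply, hψK, hψ', TensorProduct.map_eq_rTensor_lTensor,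
      ← LinearMap.lTensor_comp_apply]
    have e : (ι : K →ₗ[k] O) ∘ₗ ψK.toLinearMap = ψ.toLinearMap := LinearMap.ext hψK
    rw [e, ← TensorProduct.map_eq_rTensor_lTensor, TensorProduct.map_eq_lTensor_rTensor]
    congr 1
    apply Module.Flat.lTensor_preserves_injective_linearMap (M := O) _ (𝒜 0).subtype_injective
    rw [← TensorProduct.map_eq_lTensor_rTensor, TensorProduct.map_eq_rTensor_lTensor,
      ← TensorProduct.map_eq_lTensor_rTensor, TensorProduct.map_eq_rTensor_lTensor, h₀', ← h,
      ← LinearMap.rTensor_comp_apply _ σ, hσ', LinearMap.rTensor_id]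
    rfl

/-- The isomorphism `A_0 ≅ O_s` restricts to an injectively embedded weak bialgebra `K`, since `K_s`
is mapped onto `O_s`. -/
theorem SourceBaseIso.restrict (hι : Function.Injective ι)
    (h : ∀ a, LinearMap.lTensor A (ι : K →ₗ[k] O) (rhoK a) = rho a)
    (hb : SourceBaseIso 𝒜 O rho) : SourceBaseIso 𝒜 K rhoK := by
  obtain ⟨rho₀, φ, h₀, hinj, hrange, hφ⟩ := hb
  obtain ⟨σ, hσ⟩ := BialgHom.exists_leftInverse hι
  have hσ' : σ ∘ₗ (ι : K →ₗ[k] O) = LinearMap.id := LinearMap.ext hσ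
  have h₀' (a : 𝒜 0) : LinearMap.rTensor O (𝒜 0).subtype (rho₀ a) = rho a :=
    congrFun (congrArg DFunLike.coe h₀) a
  obtain ⟨φK, hφK⟩ := BialgHom.exists_algHom_lift hι φ fun b =>
    WeakBialgebra.sourceSub_le_range ι (hrange ▸ ⟨b, rfl⟩)
  refine ⟨LinearMap.lTensor (𝒜 0) σ ∘ₗ rho₀, φK, ?_, ?_, ?_, ?_⟩
  · ext a : 1
    simp only [LinearMap.comp_apply, Submodule.subtype_apply]
    rw [← TensorProduct.map_eq_rTensor_lTensor, TensorProduct.map_eq_lTensor_rTensor, h₀', ← h,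
      ← LinearMap.lTensor_comp_apply, hσ', LinearMap.lTensor_id]
    rfl
  · exact fun a b hab => hinj (by rw [← hφK, hab, hφK])
  · apply Submodule.map_injective_of_injective (f := (ι : K →ₗ[k] O)) hι
    rw [WeakBialgebra.map_sourceSub hι, ← hrange, ← LinearMap.range_comp]
    congr 1
    exact LinearMap.ext hφK
  · refine LinearMap.ext fun a => TensorProduct.map_injective_of_injective
      (f := (ι : K →ₗ[k] O)) (g := (ι : K →ₗ[k] O)) hι hι ?_
    have hφ' := congrFun (congrArg DFunLike.coe hφ) a
    simp only [LinearMap.comp_apply, AlgHom.toLinearMap_apply] at hφ' ⊢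
    rw [← BialgHom.comul_apply, hφK, hφ', TensorProduct.map_eq_lTensor_rTensor,
      ← LinearMap.rTensor_comp_apply]
    have e : (ι : K →ₗ[k] O) ∘ₗ φK.toLinearMap = φ.toLinearMap := LinearMap.ext hφK
    rw [e, ← TensorProduct.map_eq_lTensor_rTensor, TensorProduct.map_eq_rTensor_lTensor]
    congr 1
    apply Module.Flat.rTensor_preserves_injective_linearMap (M := O) _ (𝒜 0).subtype_injective
    rw [← TensorProduct.map_eq_rTensor_lTensor, TensorProduct.map_eq_lTensor_rTensor,
      ← TensorProduct.map_eq_rTensor_lTensor, TensorProduct.map_eq_lTensor_rTensor, h₀', ← h,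
      ← LinearMap.lTensor_comp_apply _ σ, hσ', LinearMap.lTensor_id]
    rfl

end Restriction

/-! ### Kernels and images of weak bialgebra maps -/

/-- The coalgebra structure induced along a surjection compatible with given structure maps. -/
abbrev coalgebraOfSurjective {k H K : Type*} [Field k] [AddCommGroup H] [Module k H]
    [Coalgebra k H] [AddCommGroup K] [Module k K] (p : H →ₗ[k] K) (hp : Function.Surjective p)
    (Δ : K →ₗ[k] K ⊗[k] K) (ε : K →ₗ[k] k)
    (hΔp : ∀ x, Δ (p x) = TensorProduct.map p p (Coalgebra.comul (R := k) x))
    (hεp : ∀ x, ε (p x) = Coalgebra.counit (R := k) x) : Coalgebra k K where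
  comul := Δ
  counit := ε
  coassoc := by
    refine LinearMap.ext fun x => ?_
    obtain ⟨x, rfl⟩ := hp x
    have h := congrArg (TensorProduct.map p (TensorProduct.map p p))
      (Coalgebra.coassoc_apply (R := k) x)
    simp only [LinearMap.comp_apply, LinearEquiv.coe_coe, hΔp]
    have h₁ (z : H ⊗[k] H) : TensorProduct.assoc k K K K
        (LinearMap.rTensor K Δ (TensorProduct.map p p z)) =
        TensorProduct.map p (TensorProduct.map p p)
          (TensorProduct.assoc k H H H (LinearMap.rTensor H Coalgebra.comul z)) := by
      induction z with
      | zero => simp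
      | add x y hx hy => simp only [map_add, hx, hy]
      | tmul x y =>
        simp only [TensorProduct.map_tmul, LinearMap.rTensor_tmul, hΔp]
        generalize Coalgebra.comul (R := k) x = w
        induction w with
        | zero => simp
        | add x y hx hy => simp only [map_add, TensorProduct.add_tmul, hx, hy]
        | tmul a b => simp
    have h₂ (z : H ⊗[k] H) : LinearMap.lTensor K Δ (TensorProduct.map p p z) =
        TensorProduct.map p (TensorProduct.map p p) (LinearMap.lTensor H Coalgebra.comul z) := by
      induction z with
      | zero => simp
      | add x y hx hy => simp only [map_add, hx, hy]
      | tmul x y => simp only [TensorProduct.map_tmul, LinearMap.lTensor_tmul, hΔp]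
    rw [h₁, h₂, h]
  rTensor_counit_comp_comul := by
    refine LinearMap.ext fun x => ?_
    obtain ⟨x, rfl⟩ := hp x
    have h := congrArg (LinearMap.lTensor k p) (Coalgebra.rTensor_counit_comul (R := k) x)
    simp only [LinearMap.comp_apply, hΔp]
    have h₁ (z : H ⊗[k] H) : LinearMap.rTensor K ε (TensorProduct.map p p z) =
        LinearMap.lTensor k p (LinearMap.rTensor H Coalgebra.counit z) := by
      induction z with
      | zero => simp
      | add x y hx hy => simp only [map_add, hx, hy]
      | tmul x y => simp only [TensorProduct.map_tmul, LinearMap.rTensor_tmul,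
          LinearMap.lTensor_tmul, hεp]
    rw [h₁, h]
    rfl
  lTensor_counit_comp_comul := by
    refine LinearMap.ext fun x => ?_
    obtain ⟨x, rfl⟩ := hp x
    have h := congrArg (LinearMap.rTensor k p) (Coalgebra.lTensor_counit_comul (R := k) x)
    simp only [LinearMap.comp_apply, hΔp]
    have h₁ (z : H ⊗[k] H) : LinearMap.lTensor K ε (TensorProduct.map p p z) =
        LinearMap.rTensor k p (LinearMap.lTensor H Coalgebra.counit z) := by
      induction z with
      | zero => simp
      | add x y hx hy => simp only [map_add, hx, hy]
      | tmul x y => simp only [TensorProduct.map_tmul, LinearMap.rTensor_tmul,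
          LinearMap.lTensor_tmul, hεp]
    rw [h₁, h]
    rfl

section Image

variable {k : Type*} [Field k] {H O : Type*} [Ring H] [Algebra k H] [Coalgebra k H]
  [Ring O] [Algebra k O] [Coalgebra k O]

/-- The kernel of a weak bialgebra map `f`, a biideal because `H ⊗ ker f + ker f ⊗ H` is the kernel of
`f ⊗ f` over a field. -/
def BialgHom.kerBiideal (f : H →ₐc[k] O) : Biideal k H where
  toIdeal := RingHom.ker (f : H →ₐ[k] O)
  isTwoSided := inferInstance
  counit_eq_zero x hx := by
    rw [← BialgHom.counit_apply f, show f x = 0 from hx, map_zero]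
  comul_mem x hx := by
    let S : Submodule k H := (RingHom.ker (f : H →ₐ[k] O)).restrictScalars k
    have hS : S = LinearMap.ker (f : H →ₗ[k] O) := rfl
    obtain ⟨g, hg, hgf⟩ : ∃ g : H ⧸ S →ₗ[k] O, Function.Injective g ∧
        g ∘ₗ S.mkQ = (f : H →ₗ[k] O) :=
      ⟨S.liftQ (f : H →ₗ[k] O) hS.le, LinearMap.ker_eq_bot.1 (Submodule.ker_liftQ_eq_bot' _ _ hS),
        S.liftQ_mkQ _ _⟩
    have hex := LinearMap.exact_subtype_mkQ S
    change _ ∈ LinearMap.range (LinearMap.lTensor H S.subtype) ⊔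
      LinearMap.range (LinearMap.rTensor H S.subtype)
    rw [← TensorProduct.map_ker hex S.mkQ_surjective hex S.mkQ_surjective, LinearMap.mem_ker]
    apply TensorProduct.map_injective_of_injective hg hg
    rw [TensorProduct.map_map, hgf, ← BialgHom.comul_apply, show f x = 0 from hx, map_zero, map_zero]

/-- A surjective weak bialgebra map induces an isomorphism from the quotient by its kernel. -/
theorem BialgHom.exists_quotient_equiv (f : H →ₐc[k] O) (hf : Function.Surjective f) :
    ∃ (J : Biideal k H) (e : J.Quotient ≃ₐc[k] O), ∀ h : H, e (J.proj h) = f h := by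
  let J := BialgHom.kerBiideal f
  let e₀ : J.Quotient ≃ₐ[k] O :=
    Ideal.quotientKerAlgEquivOfSurjective (f := (f : H →ₐ[k] O)) hf
  have he₀ (h : H) : e₀ (J.proj h) = f h := rfl
  refine ⟨J, { e₀ with
    map_smul' := map_smul e₀
    counit_comp := ?_
    map_comp_comul := ?_ }, he₀⟩
  · refine LinearMap.ext fun x => ?_
    obtain ⟨h, rfl⟩ := J.proj_surjective x
    exact (BialgHom.counit_apply f h).trans (BialgHom.counit_apply J.proj h).symm
  · refine LinearMap.ext fun x => ?_
    obtain ⟨h, rfl⟩ := J.proj_surjective x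
    have h₁ := BialgHom.comul_apply f h
    have h₂ := BialgHom.comul_apply J.proj h
    change TensorProduct.map e₀.toLinearMap e₀.toLinearMap (Coalgebra.comul (J.proj h)) =
      Coalgebra.comul (e₀ (J.proj h))
    rw [h₂, he₀, h₁, TensorProduct.map_map]
    rfl

/-- The image of a weak bialgebra map is a weak bialgebra. It lives in the universe of the target, as
is needed to apply the universal property of a UQSGd to it. -/
theorem BialgHom.exists_image {H : Type*} {O : Type w} [Ring H] [Algebra k H] [Coalgebra k H]
    [Ring O] [Algebra k O] [Coalgebra k O] [WeakBialgebra k H] (f : H →ₐc[k] O) :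
    ∃ (K : Type w) (_ : Ring K) (_ : Algebra k K) (_ : Coalgebra k K) (_ : WeakBialgebra k K)
      (ι : K →ₐc[k] O), Function.Injective ι ∧
        LinearMap.range (ι : K →ₗ[k] O) = LinearMap.range (f : H →ₗ[k] O) := by
  let K := (f : H →ₐ[k] O).range
  let p : H →ₗ[k] K := (f : H →ₐ[k] O).rangeRestrict.toLinearMap
  let i : K →ₗ[k] O := K.val.toLinearMap
  have hp : Function.Surjective p := (f : H →ₐ[k] O).rangeRestrict_surjective
  have hi : Function.Injective i := Subtype.val_injective
  have hip : i ∘ₗ p = (f : H →ₗ[k] O) := rfl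
  have hip' (x : H) : i (p x) = f x := rfl
  obtain ⟨σ, hσ⟩ := LinearMap.exists_rightInverse_of_surjective p (LinearMap.range_eq_top.2 hp)
  have hσ' (x : K) : p (σ x) = x := congrFun (congrArg DFunLike.coe hσ) x
  -- `Δ` does not depend on the section `σ`, by `hiΔ`.
  let Δ : K →ₗ[k] K ⊗[k] K := TensorProduct.map p p ∘ₗ Coalgebra.comul ∘ₗ σ
  let ε : K →ₗ[k] k := Coalgebra.counit ∘ₗ i
  have hii := TensorProduct.map_injective_of_injective hi hi
  have hiΔ (x : K) : TensorProduct.map i i (Δ x) = Coalgebra.comul (R := k) (i x) := by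
    change TensorProduct.map i i (TensorProduct.map p p (Coalgebra.comul (σ x))) = _
    rw [TensorProduct.map_map, hip, ← BialgHom.comul_apply, ← hip', hσ']
  have hΔp (x : H) : Δ (p x) = TensorProduct.map p p (Coalgebra.comul (R := k) x) := by
    apply hii
    rw [hiΔ, TensorProduct.map_map, hip, ← BialgHom.comul_apply, hip']
  have hεp (x : H) : ε (p x) = Coalgebra.counit (R := k) x := BialgHom.counit_apply f x
  let : Coalgebra k K := coalgebraOfSurjective p hp Δ ε hΔp hεp
  let q : H →ₐc[k] K :=
    { (f : H →ₐ[k] O).rangeRestrict with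
      map_smul' := map_smul p
      counit_comp := LinearMap.ext hεp
      map_comp_comul := LinearMap.ext fun x => (hΔp x).symm }
  let ι : K →ₐc[k] O :=
    { K.val with
      map_smul' := map_smul i
      counit_comp := rfl
      map_comp_comul := LinearMap.ext hiΔ }
  refine ⟨K, inferInstance, inferInstance, inferInstance, WeakBialgebra.of_surjective q hp, ι, hi,
    ?_⟩
  change LinearMap.range i = _
  rw [← hip, LinearMap.range_comp, LinearMap.range_eq_top.2 hp, Submodule.map_top]

end Image

/-! ### The quotient of the path algebra in degrees zero and one -/

section QuotientOfPathAlgebra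

variable {k : Type*} [Field k] {Q : Type u} [Quiver.{v} Q]

theorem QPath.exists_eq_triv {a : QPath Q} (h : a.length = 0) :
    ∃ i : Q, a = Concatenation.triv i := by
  rcases a with ⟨p⟩
  cases p with
  | nil => exact ⟨_, rfl⟩
  | cons p e => cases h

theorem QPath.exists_eq_arrow {a : QPath Q} (h : a.length = 1) :
    ∃ (i j : Q) (e : i ⟶ j), a = QPath.arrow e := by
  rcases a with ⟨p⟩
  cases p with
  | nil => cases h
  | cons p e =>
    cases p with
    | nil => exact ⟨_, _, e, rfl⟩
    | cons p f => cases h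

theorem QPath.length_arrow {i j : Q} (e : i ⟶ j) : (QPath.arrow e).length = 1 := rfl

theorem QPath.length_triv_lt_two (i : Q) : (Concatenation.triv i : QPath Q).length < 2 :=
  Nat.two_pos

theorem QPath.length_arrow_lt_two {i j : Q} (e : i ⟶ j) : (QPath.arrow e).length < 2 :=
  Nat.one_lt_two

namespace PathAlgebra

/-- The span of the paths of length at least two is an ideal: concatenation does not shorten paths. -/
theorem exists_twoSidedIdeal_repr_eq_zero [Fintype Q] : ∃ N : TwoSidedIdeal (PathAlgebra k Q),
    (∀ n, 2 ≤ n → ∀ f ∈ grade k Q n, f ∈ N) ∧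
      ∀ f ∈ N, ∀ b : QPath Q, b.length < 2 → (ConcatAlgebra.basis k).coord b f = 0 := by
  let S : Submodule k (PathAlgebra k Q) :=
    Submodule.span k (ConcatAlgebra.basis k '' {a : QPath Q | 2 ≤ a.length})
  have hmem (a : QPath Q) (ha : 2 ≤ a.length) : ConcatAlgebra.basis k a ∈ S :=
    Submodule.subset_span ⟨a, ha, rfl⟩
  have hl (f g : PathAlgebra k Q) (hg : g ∈ S) : f * g ∈ S := by
    induction f using ConcatAlgebra.induction_basis with
    | h0 => simp
    | ha f f' hf hf' => rw [add_mul]; exact add_mem hf hf'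
    | hs c f hf => rw [smul_mul_assoc]; exact S.smul_mem c hf
    | hb a =>
      induction hg using Submodule.span_induction with
      | zero => simp
      | add x y _ _ hx hy => rw [mul_add]; exact add_mem hx hy
      | smul c x _ hx => rw [mul_smul_comm]; exact S.smul_mem c hx
      | mem x hx =>
        obtain ⟨b, hb, rfl⟩ := hx
        rw [ConcatAlgebra.basis_mul_basis]
        by_cases h : Concatenation.tgt a = Concatenation.src b
        · rw [ConcatAlgebra.basisMul_of_eq h]
          exact hmem _ (by rw [QPath.length_comp]; exact le_add_left hb)
        · rw [ConcatAlgebra.basisMul_of_ne h]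
          exact zero_mem _
  have hr (f g : PathAlgebra k Q) (hf : f ∈ S) : f * g ∈ S := by
    induction g using ConcatAlgebra.induction_basis with
    | h0 => simp
    | ha g g' hg hg' => rw [mul_add]; exact add_mem hg hg'
    | hs c g hg => rw [mul_smul_comm]; exact S.smul_mem c hg
    | hb a =>
      induction hf using Submodule.span_induction with
      | zero => simp
      | add x y _ _ hx hy => rw [add_mul]; exact add_mem hx hy
      | smul c x _ hx => rw [smul_mul_assoc]; exact S.smul_mem c hx
      | mem x hx =>
        obtain ⟨b, hb, rfl⟩ := hx
        rw [ConcatAlgebra.basis_mul_basis]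
        by_cases h : Concatenation.tgt b = Concatenation.src a
        · rw [ConcatAlgebra.basisMul_of_eq h]
          exact hmem _ (by rw [QPath.length_comp]; exact le_add_right hb)
        · rw [ConcatAlgebra.basisMul_of_ne h]
          exact zero_mem _
  let N : TwoSidedIdeal (PathAlgebra k Q) := TwoSidedIdeal.mk' S S.zero_mem S.add_mem S.neg_mem
    (fun {f g} hg => hl f g hg) (fun {f g} hf => hr f g hf)
  have hN (f : PathAlgebra k Q) : f ∈ N ↔ f ∈ S := TwoSidedIdeal.mem_mk' _ _ _ _ _ _ _
  refine ⟨N, fun n hn f hf => (hN f).2 ?_, fun f hf b hb => ?_⟩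
  · refine Submodule.span_mono (Set.image_mono ?_) hf
    rintro a rfl
    exact hn
  · have : S ≤ LinearMap.ker ((ConcatAlgebra.basis k).coord b) := by
      refine Submodule.span_le.2 ?_
      rintro _ ⟨a, ha, rfl⟩
      have hab : a ≠ b := fun e => absurd hb (not_lt.2 (e ▸ ha))
      simp [hab]
    exact this ((hN f).1 hf)

variable [Fintype Q] (I : Ideal (PathAlgebra k Q)) [I.IsTwoSided]

/-- The class in `kQ/I` of a path. -/
noncomputable def pathClass (a : QPath Q) : PathAlgebra k Q ⧸ I :=
  Ideal.Quotient.mkₐ k I (ConcatAlgebra.basis k a)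

variable {I}

theorem pathClass_mem (a : QPath Q) : pathClass I a ∈ quotGrade I a.length :=
  ⟨_, Submodule.subset_span ⟨a, rfl, rfl⟩, rfl⟩

theorem pathClass_mem_of_eq {a : QPath Q} {n : ℕ} (h : a.length = n) :
    pathClass I a ∈ quotGrade I n := h ▸ pathClass_mem a

theorem pathClass_mul_of_eq {a b : QPath Q} (h : Concatenation.tgt a = Concatenation.src b) :
    pathClass I a * pathClass I b = pathClass I (Concatenation.comp a b h) := by
  rw [pathClass, pathClass, ← map_mul, ConcatAlgebra.basis_mul_basis,
    ConcatAlgebra.basisMul_of_eq h, pathClass]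

theorem pathClass_mul_of_ne {a b : QPath Q} (h : Concatenation.tgt a ≠ Concatenation.src b) :
    pathClass I a * pathClass I b = 0 := by
  rw [pathClass, pathClass, ← map_mul, ConcatAlgebra.basis_mul_basis,
    ConcatAlgebra.basisMul_of_ne h, map_zero]

theorem sum_pathClass_triv : ∑ i : Q, pathClass I (Concatenation.triv i) = 1 := by
  rw [← map_one (Ideal.Quotient.mkₐ k I), ConcatAlgebra.one_def, map_sum]
  rfl

open Classical in
theorem pathClass_triv_mul (i : Q) (a : QPath Q) :
    pathClass I (Concatenation.triv i) * pathClass I a =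
      if i = Concatenation.src a then pathClass I a else 0 := by
  split_ifs with h
  · rw [pathClass_mul_of_eq (a := Concatenation.triv i) h, Concatenation.triv_comp]
  · exact pathClass_mul_of_ne h

open Classical in
theorem pathClass_mul_triv (i : Q) (a : QPath Q) :
    pathClass I a * pathClass I (Concatenation.triv i) =
      if Concatenation.tgt a = i then pathClass I a else 0 := by
  split_ifs with h
  · rw [pathClass_mul_of_eq (b := Concatenation.triv i) h, Concatenation.comp_triv]
  · exact pathClass_mul_of_ne h

variable (I) in
/-- The class of a vertex, as an element of the degree zero component of `kQ/I`. -/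
noncomputable def vertexClass (i : Q) : quotGrade I 0 :=
  ⟨pathClass I (Concatenation.triv i), pathClass_mem_of_eq (QPath.length_triv i)⟩

open Classical in
theorem vertexClass_mul (i j : Q) :
    vertexClass I i * vertexClass I j = if i = j then vertexClass I i else 0 := by
  apply Subtype.ext
  rw [SetLike.GradeZero.coe_mul]
  change pathClass I (Concatenation.triv i) * pathClass I (Concatenation.triv j) = _
  rw [pathClass_triv_mul, Concatenation.src_triv]
  split_ifs with h
  · rw [h]
    rfl
  · rfl

theorem sum_vertexClass : ∑ i : Q, vertexClass I i = 1 := by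
  apply Subtype.ext
  rw [SetLike.GradeZero.coe_one, ← sum_pathClass_triv, AddSubmonoidClass.coe_finsetSum]
  rfl

theorem mem_span_pathClass (x : PathAlgebra k Q ⧸ I) :
    x ∈ Submodule.span k (Set.range (pathClass I)) := by
  obtain ⟨f, rfl⟩ := Ideal.Quotient.mkₐ_surjective k I x
  induction f using ConcatAlgebra.induction_basis with
  | h0 => simp
  | ha f f' hf hf' => rw [map_add]; exact add_mem hf hf'
  | hs c f hf => rw [map_smul]; exact Submodule.smul_mem _ c hf
  | hb a => exact Submodule.subset_span ⟨a, rfl⟩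

theorem quotGrade_eq_span (n : ℕ) : quotGrade I n =
    Submodule.span k (pathClass I '' {a : QPath Q | a.length = n}) := by
  rw [quotGrade, grade, Submodule.map_span, Set.image_image]
  rfl

/-- As `kQ/I` is generated by vertices and arrows, a multiplicative map takes values in a subspace
closed under products once it does so on vertices and arrows. -/
theorem mem_of_mem_of_length_lt_two {B : Type*} [Ring B] [Algebra k B]
    {F : PathAlgebra k Q ⧸ I →ₗ[k] B} (hF : ∀ a b, F (a * b) = F a * F b) {S : Submodule k B}
    (hS : ∀ x ∈ S, ∀ y ∈ S, x * y ∈ S) (h : ∀ a, a.length < 2 → F (pathClass I a) ∈ S)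
    (x : PathAlgebra k Q ⧸ I) : F x ∈ S := by
  have hp (a : QPath Q) : F (pathClass I a) ∈ S := by
    rcases a with ⟨p⟩
    induction p with
    | nil => exact h _ Nat.two_pos
    | cons p e ih =>
      have := pathClass_mul_of_eq (I := I) (a := ⟨p⟩) (b := QPath.arrow e) rfl
      change _ = pathClass I ⟨p.cons e⟩ at this
      rw [← this, hF]
      exact hS _ ih _ (h _ (by rw [QPath.length_arrow]; decide))
  have : Submodule.span k (Set.range (pathClass I)) ≤ S.comap F := by
    refine Submodule.span_le.2 ?_
    rintro _ ⟨a, rfl⟩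
    exact hp a
  exact this (mem_span_pathClass x)

open Classical in
/-- Relations in degrees at least two leave vertices and arrows linearly independent: the coordinates
of `kQ` at these paths descend to `kQ/I`. -/
theorem exists_coord (hI : IsGeneratedInDegreeGETwo I) :
    ∃ f : QPath Q → PathAlgebra k Q ⧸ I →ₗ[k] k, ∀ a b, b.length < 2 →
      f b (pathClass I a) = if a = b then 1 else 0 := by
  have hle (b : QPath Q) (hb : b.length < 2) :
      I.restrictScalars k ≤ LinearMap.ker ((ConcatAlgebra.basis k).coord b) := by
    obtain ⟨N, hN, hN'⟩ := exists_twoSidedIdeal_repr_eq_zero (k := k) (Q := Q)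
    obtain ⟨S, hS, rfl⟩ := hI
    intro f hf
    refine hN' f (TwoSidedIdeal.span_le.2 (fun s hs => ?_) (TwoSidedIdeal.mem_asIdeal.1 hf)) b hb
    obtain ⟨n, hn, hsn⟩ := hS s hs
    exact hN n hn s hsn
  refine ⟨fun b => if hb : b.length < 2 then
    (I.restrictScalars k).liftQ ((ConcatAlgebra.basis k).coord b) (hle b hb) ∘ₗ
      (Submodule.Quotient.restrictScalarsEquiv k I).symm.toLinearMap else 0, fun a b hb => ?_⟩
  dsimp only
  rw [dif_pos hb]
  change (ConcatAlgebra.basis k).coord b (ConcatAlgebra.basis k a) = _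
  simp [Finsupp.single_apply]

variable [∀ i j : Q, Finite (i ⟶ j)] {f : QPath Q → PathAlgebra k Q ⧸ I →ₗ[k] k}

open Classical in
theorem sum_coord_smul_pathClass
    (hf : ∀ a b, b.length < 2 → f b (pathClass I a) = if a = b then 1 else 0) {n : ℕ} (hn : n < 2)
    {x : PathAlgebra k Q ⧸ I} (hx : x ∈ quotGrade I n) :
    ∑ c ∈ QPath.ofLength Q n, f c x • pathClass I c = x := by
  rw [quotGrade_eq_span] at hx
  induction hx using Submodule.span_induction with
  | zero => simp
  | add x y _ _ hx hy => simp only [map_add, add_smul, Finset.sum_add_distrib, hx, hy]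
  | smul r x _ hx =>
    conv_rhs => rw [← hx]
    simp [Finset.smul_sum, mul_smul]
  | mem x hx =>
    obtain ⟨a, ha, rfl⟩ := hx
    rw [Finset.sum_eq_single a]
    · rw [hf a a (ha.trans_lt hn), if_pos rfl, one_smul]
    · intro c hc hne
      rw [hf a c ((QPath.mem_ofLength.1 hc).trans_lt hn), if_neg hne.symm, zero_smul]
    · exact fun h => absurd (QPath.mem_ofLength.2 ha) h

variable {M : Type*} [AddCommGroup M] [Module k M]

open Classical in
/-- An element of `M ⊗ (kQ/I)_n` for `n = 0, 1` in terms of its coordinates at paths. -/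
theorem sum_coord_tmul_pathClass
    (hf : ∀ a b, b.length < 2 → f b (pathClass I a) = if a = b then 1 else 0) {n : ℕ} (hn : n < 2)
    {z : M ⊗[k] (PathAlgebra k Q ⧸ I)}
    (hz : z ∈ LinearMap.range (LinearMap.lTensor M (quotGrade I n).subtype)) :
    z = ∑ c ∈ QPath.ofLength Q n,
      TensorProduct.rid k M (LinearMap.lTensor M (f c) z) ⊗ₜ[k] pathClass I c := by
  obtain ⟨z, rfl⟩ := hz
  induction z with
  | zero => simp
  | add x y hx hy =>
    simp only [map_add, TensorProduct.add_tmul, Finset.sum_add_distrib]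
    rw [← hx, ← hy]
  | tmul m x =>
    simp only [LinearMap.lTensor_tmul, TensorProduct.rid_tmul, TensorProduct.smul_tmul,
      ← TensorProduct.tmul_sum, Submodule.subtype_apply]
    rw [sum_coord_smul_pathClass hf hn x.2]

open Classical in
/-- An element of `(kQ/I)_n ⊗ M` for `n = 0, 1` in terms of its coordinates at paths. -/
theorem sum_pathClass_tmul_coord
    (hf : ∀ a b, b.length < 2 → f b (pathClass I a) = if a = b then 1 else 0) {n : ℕ} (hn : n < 2)
    {z : (PathAlgebra k Q ⧸ I) ⊗[k] M}
    (hz : z ∈ LinearMap.range (LinearMap.rTensor M (quotGrade I n).subtype)) :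
    z = ∑ c ∈ QPath.ofLength Q n,
      pathClass I c ⊗ₜ[k] TensorProduct.lid k M (LinearMap.rTensor M (f c) z) := by
  obtain ⟨z, rfl⟩ := hz
  induction z with
  | zero => simp
  | add x y hx hy =>
    simp only [map_add, TensorProduct.tmul_add, Finset.sum_add_distrib]
    rw [← hx, ← hy]
  | tmul x m =>
    simp only [LinearMap.rTensor_tmul, TensorProduct.lid_tmul, ← TensorProduct.smul_tmul,
      ← TensorProduct.sum_tmul, Submodule.subtype_apply]
    rw [sum_coord_smul_pathClass hf hn x.2]

end PathAlgebra

end QuotientOfPathAlgebra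

/-! ### Weak bialgebra maps out of the face algebra -/

namespace FaceAlgebra

variable {k : Type*} [Field k] {Q : Type u} [Quiver.{v} Q] [Fintype Q]

/-- Induction along a pair of paths, appending an arrow to both paths at each step. -/
theorem x_induction {P : FaceAlgebra k Q → Prop}
    (h0 : ∀ i j, P (x k (Concatenation.triv i) (Concatenation.triv j)))
    (h1 : ∀ (a b : QPath Q) {i j i' j' : Q} (p : i ⟶ j) (q : i' ⟶ j'), P (x k a b) →
      P (x k a b * x k (.arrow p) (.arrow q)))
    (a b : QPath Q) (h : a.length = b.length) : P (x k a b) := by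
  have key {s s' t t' : Q} (p : Quiver.Path s t) (q : Quiver.Path s' t')
      (h : p.length = q.length) : P (x k ⟨p⟩ ⟨q⟩) := by
    induction p generalizing t' with
    | nil =>
      cases q with
      | nil => exact h0 _ _
      | cons q f => cases h
    | cons p e ih =>
      cases q with
      | nil => cases h
      | cons q f =>
        have h' : p.length = q.length := Nat.succ.inj h
        have := h1 ⟨p⟩ ⟨q⟩ e f (ih q h')
        rwa [x_mul_x_of_eq (a := ⟨p⟩) (b := ⟨q⟩) (a' := .arrow e) (b' := .arrow f) h' rfl rfl rfl]
          at this
  exact key a.path b.path h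

theorem x_mul_x_triv (a b : QPath Q) (m j : Q) :
    x k a b * x k (Concatenation.triv m) (Concatenation.triv j) = x k a b ∨
      x k a b * x k (Concatenation.triv m) (Concatenation.triv j) = 0 := by
  by_cases h : a.length = b.length
  swap
  · exact Or.inr (by rw [x_of_ne h, zero_mul])
  by_cases ha : Concatenation.tgt a = m
  swap
  · exact Or.inr (x_mul_x_of_ne_left ha)
  by_cases hb : Concatenation.tgt b = j
  swap
  · exact Or.inr (x_mul_x_of_ne_right hb)
  left
  rw [x_mul_x_of_eq (a' := Concatenation.triv m) (b' := Concatenation.triv j) h rfl ha hb,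
    Concatenation.comp_triv, Concatenation.comp_triv]

theorem x_triv_mul_x (a b : QPath Q) (m j : Q) :
    x k (Concatenation.triv m) (Concatenation.triv j) * x k a b = x k a b ∨
      x k (Concatenation.triv m) (Concatenation.triv j) * x k a b = 0 := by
  by_cases h : a.length = b.length
  swap
  · exact Or.inr (by rw [x_of_ne h, mul_zero])
  by_cases ha : m = Concatenation.src a
  swap
  · exact Or.inr (x_mul_x_of_ne_left ha)
  by_cases hb : j = Concatenation.src b
  swap
  · exact Or.inr (x_mul_x_of_ne_right hb)
  left
  rw [x_mul_x_of_eq (a := Concatenation.triv m) (b := Concatenation.triv j) rfl h ha hb,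
    Concatenation.triv_comp, Concatenation.triv_comp]

variable [∀ i j : Q, Finite (i ⟶ j)] {O : Type*} [Ring O] [Algebra k O] [Coalgebra k O]
  [WeakBialgebra k O]

/-- An algebra map out of the face algebra is compatible with the comultiplications if it is so on
vertex and arrow generators. -/
theorem comul_algHom (F : FaceAlgebra k Q →ₐ[k] O)
    (h : ∀ a b : QPath Q, a.length < 2 → a.length = b.length →
      Coalgebra.comul (R := k) (F (x k a b)) =
        TensorProduct.map F.toLinearMap F.toLinearMap (Coalgebra.comul (x k a b)))
    (z : FaceAlgebra k Q) : Coalgebra.comul (R := k) (F z) =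
      TensorProduct.map F.toLinearMap F.toLinearMap (Coalgebra.comul z) := by
  have hm (x y : FaceAlgebra k Q ⊗[k] FaceAlgebra k Q) :
      TensorProduct.map F.toLinearMap F.toLinearMap (x * y) =
      TensorProduct.map F.toLinearMap F.toLinearMap x *
        TensorProduct.map F.toLinearMap F.toLinearMap y :=
    map_mul (Algebra.TensorProduct.map F F) x y
  induction z using ConcatAlgebra.induction_basis with
  | h0 => simp
  | ha f g hf hg => simp only [map_add, hf, hg]
  | hs c f hf => simp only [map_smul, hf]
  | hb w =>
    rw [basis_eq_x]
    refine x_induction (P := fun z => Coalgebra.comul (R := k) (F z) =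
      TensorProduct.map F.toLinearMap F.toLinearMap (Coalgebra.comul z))
      (fun i j => h _ _ Nat.two_pos rfl) (fun a b i j i' j' p q ih => ?_) _ _ w.length_eq
    rw [map_mul, WeakBialgebra.comul_mul, ih, h (.arrow p) (.arrow q) Nat.one_lt_two rfl, ← hm,
      ← WeakBialgebra.comul_mul]

/-- An algebra map out of the face algebra that is compatible with the comultiplications is compatible
with the counits if it is so on vertex and arrow generators. On products this follows from
`ε(xy) = ε(x 1₂) ε(1₁ y)`, as multiplication by a vertex generator fixes or kills a basis element. -/
theorem counit_algHom (F : FaceAlgebra k Q →ₐ[k] O)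
    (hΔ : ∀ z, Coalgebra.comul (R := k) (F z) =
      TensorProduct.map F.toLinearMap F.toLinearMap (Coalgebra.comul z))
    (h : ∀ a b : QPath Q, a.length < 2 → a.length = b.length →
      Coalgebra.counit (R := k) (F (x k a b)) = Coalgebra.counit (R := k) (x k a b))
    (z : FaceAlgebra k Q) : Coalgebra.counit (R := k) (F z) = Coalgebra.counit (R := k) z := by
  have hmul (a b a' b' : QPath Q)
      (hl : Coalgebra.counit (R := k) (F (x k a b)) = Coalgebra.counit (R := k) (x k a b))
      (hr : Coalgebra.counit (R := k) (F (x k a' b')) = Coalgebra.counit (R := k) (x k a' b')) :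
      Coalgebra.counit (R := k) (F (x k a b * x k a' b')) =
        Coalgebra.counit (R := k) (x k a b * x k a' b') := by
    have hl' (m j : Q) : Coalgebra.counit (R := k)
        (F (x k a b * x k (Concatenation.triv m) (Concatenation.triv j))) =
        Coalgebra.counit (R := k) (x k a b * x k (Concatenation.triv m) (Concatenation.triv j)) := by
      rcases x_mul_x_triv (k := k) a b m j with e | e <;> simp [e, hl]
    have hr' (m j : Q) : Coalgebra.counit (R := k)
        (F (x k (Concatenation.triv m) (Concatenation.triv j) * x k a' b')) =
        Coalgebra.counit (R := k)
          (x k (Concatenation.triv m) (Concatenation.triv j) * x k a' b') := by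
      rcases x_triv_mul_x (k := k) a' b' m j with e | e <;> simp [e, hr]
    have e₁ := WeakBialgebra.counit_mul_mul₂ (k := k) (F (x k a b)) 1 (F (x k a' b'))
    have e₂ := WeakBialgebra.counit_mul_mul₂ (k := k) (x k a b) 1 (x k a' b')
    rw [mul_one, ← map_one F, hΔ, comul_one_eq] at e₁
    rw [mul_one, comul_one_eq] at e₂
    rw [map_mul, e₁, e₂]
    simp only [map_sum, TensorProduct.map_tmul, LinearMap.mul'_apply, LinearMap.comp_apply,
      LinearMap.mulLeft_apply, LinearMap.mulRight_apply, AlgHom.toLinearMap_apply, ← map_mul F,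
      hl', hr']
  induction z using ConcatAlgebra.induction_basis with
  | h0 => simp
  | ha f g hf hg => simp only [map_add, hf, hg]
  | hs c f hf => simp only [map_smul, hf]
  | hb w =>
    rw [basis_eq_x]
    exact x_induction (P := fun z => Coalgebra.counit (R := k) (F z) = Coalgebra.counit (R := k) z)
      (fun i j => h _ _ Nat.two_pos rfl)
      (fun a b i j i' j' p q ih => hmul _ _ _ _ ih (h (.arrow p) (.arrow q) Nat.one_lt_two rfl))
      _ _ w.length_eq

open Classical in
/-- Families of matrix coefficients, indexed by vertices and by arrows, that satisfy the defining
relations of the face algebra give a weak bialgebra map. -/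
theorem exists_bialgHom (y : QPath Q → QPath Q → O)
    (hΔ : ∀ a b : QPath Q, a.length < 2 → a.length = b.length → Coalgebra.comul (R := k) (y a b) =
      ∑ c ∈ QPath.ofLength Q a.length, y a c ⊗ₜ[k] y c b)
    (hε : ∀ a b : QPath Q, a.length < 2 → a.length = b.length →
      Coalgebra.counit (R := k) (y a b) = if a = b then 1 else 0)
    (h_one : ∑ i : Q, ∑ j : Q, y (Concatenation.triv i) (Concatenation.triv j) = 1)
    (h_mul : ∀ i j m n, y (Concatenation.triv i) (Concatenation.triv j) *
      y (Concatenation.triv m) (Concatenation.triv n) =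
        if i = m then if j = n then y (Concatenation.triv i) (Concatenation.triv j) else 0 else 0)
    (h_src : ∀ {i j i' j' : Q} (p : i ⟶ j) (q : i' ⟶ j'),
      y (Concatenation.triv i) (Concatenation.triv i') * y (.arrow p) (.arrow q) =
        y (.arrow p) (.arrow q))
    (h_tgt : ∀ {i j i' j' : Q} (p : i ⟶ j) (q : i' ⟶ j'),
      y (.arrow p) (.arrow q) * y (Concatenation.triv j) (Concatenation.triv j') =
        y (.arrow p) (.arrow q)) :
    ∃ π : FaceAlgebra k Q →ₐc[k] O, ∀ a b : QPath Q, a.length < 2 → a.length = b.length →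
      π (x k a b) = y a b := by
  obtain ⟨F, ⟨hF₀, hF₁⟩, -⟩ := existsUnique_algHom (k := k) (B := O)
    (fun i j => y (Concatenation.triv i) (Concatenation.triv j))
    (fun p q => y (.arrow p) (.arrow q)) h_one h_mul h_src h_tgt
  have hF (a b : QPath Q) (ha : a.length < 2) (hab : a.length = b.length) :
      F (x k a b) = y a b := by
    rcases Nat.lt_succ_iff_lt_or_eq.1 ha with h | h
    · have h := Nat.lt_one_iff.1 h
      obtain ⟨i, rfl⟩ := QPath.exists_eq_triv h
      obtain ⟨j, rfl⟩ := QPath.exists_eq_triv (hab.symm.trans h)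
      exact hF₀ i j
    · obtain ⟨i, j, p, rfl⟩ := QPath.exists_eq_arrow h
      obtain ⟨i', j', q, rfl⟩ := QPath.exists_eq_arrow (hab.symm.trans h)
      exact hF₁ p q
  have hFΔ := comul_algHom F fun a b ha hab => by
    rw [hF a b ha hab, hΔ a b ha hab, comul_x, map_sum]
    refine Finset.sum_congr rfl fun c hc => ?_
    rw [QPath.mem_ofLength] at hc
    rw [TensorProduct.map_tmul, AlgHom.toLinearMap_apply, AlgHom.toLinearMap_apply,
      hF a c ha hc.symm, hF c b (hc ▸ ha) (hc.trans hab)]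
  have hFε := counit_algHom F hFΔ fun a b ha hab => by
    rw [hF a b ha hab, hε a b ha hab, counit_x]
  exact ⟨{ F with
    map_smul' := map_smul F
    counit_comp := LinearMap.ext hFε
    map_comp_comul := LinearMap.ext fun z => (hFΔ z).symm }, hF⟩

end FaceAlgebra

/-! ### Coactions and the face algebra -/

section Coefficients

variable {k : Type*} [Field k] {A O : Type*} [AddCommGroup A] [Module k A]
  [AddCommGroup O] [Module k O]

theorem rid_lTensor_rTensor {K : Type*} [AddCommGroup K] [Module k K] (g : K →ₗ[k] O)
    (f : A →ₗ[k] k) (z : K ⊗[k] A) :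
    TensorProduct.rid k O (LinearMap.lTensor O f (LinearMap.rTensor A g z)) =
      g (TensorProduct.rid k K (LinearMap.lTensor K f z)) := by
  induction z with
  | zero => simp
  | add x y hx hy => simp only [map_add, hx, hy]
  | tmul x y => simp

variable [Coalgebra k O]

theorem comul_rid_lTensor_assoc (f : A →ₗ[k] k) (z : O ⊗[k] A) :
    Coalgebra.comul (R := k) (TensorProduct.rid k O (LinearMap.lTensor O f z)) =
      LinearMap.lTensor O (TensorProduct.rid k O ∘ₗ LinearMap.lTensor O f)
        (TensorProduct.assoc k O O A (LinearMap.rTensor A Coalgebra.comul z)) := by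
  induction z with
  | zero => simp
  | add x y hx hy => simp only [map_add, hx, hy]
  | tmul x y =>
    simp only [LinearMap.lTensor_tmul, LinearMap.rTensor_tmul, TensorProduct.rid_tmul, map_smul]
    generalize Coalgebra.comul (R := k) x = w
    induction w with
    | zero => simp
    | add x y hx hy => simp only [smul_add, map_add, TensorProduct.add_tmul, hx, hy]
    | tmul a b => simp

theorem comul_lid_rTensor_assoc (f : A →ₗ[k] k) (z : A ⊗[k] O) :
    Coalgebra.comul (R := k) (TensorProduct.lid k O (LinearMap.rTensor O f z)) =
      LinearMap.rTensor O (TensorProduct.lid k O ∘ₗ LinearMap.rTensor O f)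
        ((TensorProduct.assoc k A O O).symm (LinearMap.lTensor A Coalgebra.comul z)) := by
  induction z with
  | zero => simp
  | add x y hx hy => simp only [map_add, hx, hy]
  | tmul x y =>
    simp only [LinearMap.lTensor_tmul, LinearMap.rTensor_tmul, TensorProduct.lid_tmul, map_smul]
    generalize Coalgebra.comul (R := k) y = w
    induction w with
    | zero => simp
    | add x y hx hy => simp only [smul_add, map_add, TensorProduct.tmul_add, hx, hy]
    | tmul a b => simp [TensorProduct.smul_tmul']

theorem counit_rid_lTensor (f : A →ₗ[k] k) (z : O ⊗[k] A) :
    Coalgebra.counit (R := k) (TensorProduct.rid k O (LinearMap.lTensor O f z)) =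
      f (TensorProduct.lid k A (LinearMap.rTensor A Coalgebra.counit z)) := by
  induction z with
  | zero => simp
  | add x y hx hy => simp only [map_add, hx, hy]
  | tmul x y => simp [mul_comm]

theorem counit_lid_rTensor (f : A →ₗ[k] k) (z : A ⊗[k] O) :
    Coalgebra.counit (R := k) (TensorProduct.lid k O (LinearMap.rTensor O f z)) =
      f (TensorProduct.rid k A (LinearMap.lTensor A Coalgebra.counit z)) := by
  induction z with
  | zero => simp
  | add x y hx hy => simp only [map_add, hx, hy]
  | tmul x y => simp [mul_comm]

end Coefficients

namespace PathAlgebra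

variable {k : Type*} [Field k] {Q : Type u} [Quiver.{v} Q] [Fintype Q]
  [∀ i j : Q, Finite (i ⟶ j)] {I : Ideal (PathAlgebra k Q)} [I.IsTwoSided]
  {O : Type*} [Ring O] [Algebra k O] [Coalgebra k O] [WeakBialgebra k O]

/-- A linear left coaction on `kQ/I` with `A_0 ≅ O_t` comes from a weak bialgebra map out of the face
algebra: its matrix coefficients on vertices and arrows satisfy the relations of the generators. -/
theorem exists_bialgHom_of_left (hI : IsGeneratedInDegreeGETwo I)
    {lam : PathAlgebra k Q ⧸ I →ₗ[k] O ⊗[k] (PathAlgebra k Q ⧸ I)}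
    (hl : IsLeftComoduleAlgebra (quotGrade I) O lam) (hb : TargetBaseIso (quotGrade I) O lam) :
    ∃ π : FaceAlgebra k Q →ₐc[k] O, ∀ a : QPath Q, a.length < 2 →
      lam (pathClass I a) =
        ∑ c ∈ QPath.ofLength Q a.length, π (FaceAlgebra.x k a c) ⊗ₜ[k] pathClass I c := by
  classical
  obtain ⟨f, hf⟩ := exists_coord hI
  let y (a b : QPath Q) : O :=
    TensorProduct.rid k O (LinearMap.lTensor O (f b) (lam (pathClass I a)))
  have hlam (a : QPath Q) (ha : a.length < 2) : lam (pathClass I a) =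
      ∑ c ∈ QPath.ofLength Q a.length, y a c ⊗ₜ[k] pathClass I c :=
    sum_coord_tmul_pathClass hf ha (hl.linear _ _ (pathClass_mem a))
  have hlam₀ (i : Q) : lam (pathClass I (Concatenation.triv i)) = ∑ j : Q,
      y (Concatenation.triv i) (Concatenation.triv j) ⊗ₜ[k] pathClass I (Concatenation.triv j) := by
    rw [hlam _ (QPath.length_triv_lt_two i), QPath.length_triv, FaceAlgebra.sum_ofLength_zero]
  -- A coefficient of an expansion in paths of length `n` can be read off by a coordinate functional.
  have hcoeff (n : ℕ) (hn : n < 2) (d : QPath Q → O) (b : QPath Q) (hbn : b.length = n) :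
      TensorProduct.rid k O (LinearMap.lTensor O (f b)
        (∑ c ∈ QPath.ofLength Q n, d c ⊗ₜ[k] pathClass I c)) = d b := by
    simp only [map_sum, LinearMap.lTensor_tmul, hf _ b (hbn ▸ hn), TensorProduct.rid_tmul, ite_smul,
      one_smul, zero_smul, Finset.sum_ite_eq', QPath.mem_ofLength, hbn, if_true]
  obtain ⟨lam₀, ψ, h₀, hinj, hrange, hψ⟩ := hb
  have hyt (i : Q) : Coalgebra.comul (R := k) (ψ (vertexClass I i)) = ∑ j : Q,
      y (Concatenation.triv i) (Concatenation.triv j) ⊗ₜ[k] ψ (vertexClass I j) := by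
    have h₁ : lam₀ (vertexClass I i) = ∑ j : Q,
        y (Concatenation.triv i) (Concatenation.triv j) ⊗ₜ[k] vertexClass I j := by
      apply Module.Flat.lTensor_preserves_injective_linearMap (M := O) _
        (quotGrade I 0).subtype_injective
      have := congrFun (congrArg DFunLike.coe h₀) (vertexClass I i)
      simp only [LinearMap.comp_apply] at this
      rw [this, map_sum]
      exact hlam₀ i
    have := congrFun (congrArg DFunLike.coe hψ) (vertexClass I i)
    simp only [LinearMap.comp_apply, h₁, map_sum, LinearMap.lTensor_tmul] at this
    exact this
  obtain ⟨r, hrψ⟩ := LinearMap.exists_leftInverse_of_injective ψ.toLinearMap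
    (LinearMap.ker_eq_bot.2 hinj)
  have hr' (a) : r (ψ a) = a := congrFun (congrArg DFunLike.coe hrψ) a
  have hbase := WeakBialgebra.coeff_idempotents_of_target (k := k) (t := fun i => ψ (vertexClass I i))
    (y := fun i j => y (Concatenation.triv i) (Concatenation.triv j))
    (g := fun j => f (Concatenation.triv j) ∘ₗ (quotGrade I 0).subtype ∘ₗ r)
    (fun i => hrange ▸ ⟨vertexClass I i, rfl⟩)
    (fun i j => by
      rw [← map_mul, vertexClass_mul, apply_ite ψ, map_zero])
    (by
      rw [← map_sum, sum_vertexClass, map_one])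
    (fun i j => by
      simp only [LinearMap.comp_apply, hr', Submodule.subtype_apply, vertexClass]
      rw [hf _ _ (QPath.length_triv_lt_two j)]
      refine if_congr ⟨fun h => congrArg QPath.src h, fun h => h ▸ rfl⟩ rfl rfl)
    hyt
  obtain ⟨π, hπ⟩ := FaceAlgebra.exists_bialgHom (k := k) y
    (fun a b ha hab => by
      have h₁ := congrFun (congrArg DFunLike.coe hl.coassoc) (pathClass I a)
      simp only [LinearMap.comp_apply, LinearEquiv.coe_coe] at h₁
      change Coalgebra.comul (R := k) (TensorProduct.rid k O _) = _
      rw [comul_rid_lTensor_assoc, h₁, hlam a ha, map_sum, map_sum]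
      rfl)
    (fun a b ha hab => by
      have h₁ := congrFun (congrArg DFunLike.coe hl.counit_coact) (pathClass I a)
      simp only [LinearMap.comp_apply, LinearEquiv.coe_coe, LinearMap.id_apply] at h₁
      change Coalgebra.counit (R := k) (TensorProduct.rid k O _) = _
      rw [counit_rid_lTensor, h₁, hf a b (hab ▸ ha)])
    hbase.2 hbase.1
    (fun {i j i' j'} p q => by
      have h₁ := hl.map_mul (pathClass I (Concatenation.triv i)) (pathClass I (.arrow p))
      rw [pathClass_triv_mul, if_pos (show i = Concatenation.src (QPath.arrow p) from rfl),
        hlam₀, hlam _ (QPath.length_arrow_lt_two p), QPath.length_arrow,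
        Finset.sum_mul_sum, Finset.sum_comm] at h₁
      have h₂ := hcoeff 1 Nat.one_lt_two (y (.arrow p)) (.arrow q) rfl
      rw [h₁] at h₂
      refine Eq.trans ?_ h₂
      symm
      refine (congrArg (fun z => TensorProduct.rid k O (LinearMap.lTensor O (f (.arrow q)) z))
        ?_).trans (hcoeff 1 Nat.one_lt_two (fun c => y (Concatenation.triv i)
        (Concatenation.triv (Concatenation.src c)) * y (.arrow p) c) (.arrow q) rfl)
      refine Finset.sum_congr rfl fun c _ => ?_
      simp only [Algebra.TensorProduct.tmul_mul_tmul, pathClass_triv_mul, TensorProduct.tmul_ite,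
        Finset.sum_ite_eq', Finset.mem_univ, if_true])
    (fun {i j i' j'} p q => by
      have h₁ := hl.map_mul (pathClass I (.arrow p)) (pathClass I (Concatenation.triv j))
      rw [pathClass_mul_triv, if_pos (show Concatenation.tgt (QPath.arrow p) = j from rfl),
        hlam₀, hlam _ (QPath.length_arrow_lt_two p), QPath.length_arrow,
        Finset.sum_mul_sum] at h₁
      have h₂ := hcoeff 1 Nat.one_lt_two (y (.arrow p)) (.arrow q) rfl
      rw [h₁] at h₂
      refine Eq.trans ?_ h₂
      symm
      refine (congrArg (fun z => TensorProduct.rid k O (LinearMap.lTensor O (f (.arrow q)) z))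
        ?_).trans (hcoeff 1 Nat.one_lt_two (fun c => y (.arrow p) c * y (Concatenation.triv j)
        (Concatenation.triv (Concatenation.tgt c))) (.arrow q) rfl)
      refine Finset.sum_congr rfl fun c _ => ?_
      simp only [Algebra.TensorProduct.tmul_mul_tmul, pathClass_mul_triv, TensorProduct.tmul_ite,
        Finset.sum_ite_eq, Finset.mem_univ, if_true])
  refine ⟨π, fun a ha => ?_⟩
  rw [hlam a ha]
  refine Finset.sum_congr rfl fun c hc => ?_
  rw [hπ a c ha (QPath.mem_ofLength.1 hc).symm]

/-- A linear right coaction on `kQ/I` with `A_0 ≅ O_s` comes from a weak bialgebra map out of the face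
algebra: its matrix coefficients on vertices and arrows satisfy the relations of the generators. -/
theorem exists_bialgHom_of_right (hI : IsGeneratedInDegreeGETwo I)
    {rho : PathAlgebra k Q ⧸ I →ₗ[k] (PathAlgebra k Q ⧸ I) ⊗[k] O}
    (hr : IsRightComoduleAlgebra (quotGrade I) O rho) (hb : SourceBaseIso (quotGrade I) O rho) :
    ∃ π : FaceAlgebra k Q →ₐc[k] O, ∀ a : QPath Q, a.length < 2 →
      rho (pathClass I a) =
        ∑ c ∈ QPath.ofLength Q a.length, pathClass I c ⊗ₜ[k] π (FaceAlgebra.x k c a) := by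
  classical
  obtain ⟨f, hf⟩ := exists_coord hI
  let y (b a : QPath Q) : O :=
    TensorProduct.lid k O (LinearMap.rTensor O (f b) (rho (pathClass I a)))
  have hrho (a : QPath Q) (ha : a.length < 2) : rho (pathClass I a) =
      ∑ c ∈ QPath.ofLength Q a.length, pathClass I c ⊗ₜ[k] y c a :=
    sum_pathClass_tmul_coord hf ha (hr.linear _ _ (pathClass_mem a))
  have hrho₀ (i : Q) : rho (pathClass I (Concatenation.triv i)) = ∑ j : Q,
      pathClass I (Concatenation.triv j) ⊗ₜ[k] y (Concatenation.triv j) (Concatenation.triv i) := by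
    rw [hrho _ (QPath.length_triv_lt_two i), QPath.length_triv, FaceAlgebra.sum_ofLength_zero]
  -- A coefficient of an expansion in paths of length `n` can be read off by a coordinate functional.
  have hcoeff (n : ℕ) (hn : n < 2) (d : QPath Q → O) (b : QPath Q) (hbn : b.length = n) :
      TensorProduct.lid k O (LinearMap.rTensor O (f b)
        (∑ c ∈ QPath.ofLength Q n, pathClass I c ⊗ₜ[k] d c)) = d b := by
    simp only [map_sum, LinearMap.rTensor_tmul, hf _ b (hbn ▸ hn), TensorProduct.lid_tmul, ite_smul,
      one_smul, zero_smul, Finset.sum_ite_eq', QPath.mem_ofLength, hbn, if_true]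
  obtain ⟨rho₀, φ, h₀, hinj, hrange, hφ⟩ := hb
  have hys (j : Q) : Coalgebra.comul (R := k) (φ (vertexClass I j)) = ∑ i : Q,
      φ (vertexClass I i) ⊗ₜ[k] y (Concatenation.triv i) (Concatenation.triv j) := by
    have h₁ : rho₀ (vertexClass I j) = ∑ i : Q,
        vertexClass I i ⊗ₜ[k] y (Concatenation.triv i) (Concatenation.triv j) := by
      apply Module.Flat.rTensor_preserves_injective_linearMap (M := O) _
        (quotGrade I 0).subtype_injective
      have := congrFun (congrArg DFunLike.coe h₀) (vertexClass I j)
      simp only [LinearMap.comp_apply] at this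
      rw [this, map_sum]
      exact hrho₀ j
    have := congrFun (congrArg DFunLike.coe hφ) (vertexClass I j)
    simp only [LinearMap.comp_apply, h₁, map_sum, LinearMap.rTensor_tmul] at this
    exact this
  obtain ⟨r, hrφ⟩ := LinearMap.exists_leftInverse_of_injective φ.toLinearMap
    (LinearMap.ker_eq_bot.2 hinj)
  have hr' (a) : r (φ a) = a := congrFun (congrArg DFunLike.coe hrφ) a
  have hbase := WeakBialgebra.coeff_idempotents_of_source (k := k)
    (s := fun i => φ (vertexClass I i))
    (y := fun i j => y (Concatenation.triv i) (Concatenation.triv j))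
    (g := fun j => f (Concatenation.triv j) ∘ₗ (quotGrade I 0).subtype ∘ₗ r)
    (fun i => hrange ▸ ⟨vertexClass I i, rfl⟩)
    (fun i j => by
      rw [← map_mul, vertexClass_mul, apply_ite φ, map_zero])
    (by
      rw [← map_sum, sum_vertexClass, map_one])
    (fun i j => by
      simp only [LinearMap.comp_apply, hr', Submodule.subtype_apply, vertexClass]
      rw [hf _ _ (QPath.length_triv_lt_two j)]
      refine if_congr ⟨fun h => congrArg QPath.src h, fun h => h ▸ rfl⟩ rfl rfl)
    hys
  obtain ⟨π, hπ⟩ := FaceAlgebra.exists_bialgHom (k := k) y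
    (fun b a hb hba => by
      have ha : a.length < 2 := hba ▸ hb
      have h₁ := congrFun (congrArg DFunLike.coe hr.coassoc) (pathClass I a)
      simp only [LinearMap.comp_apply, LinearEquiv.coe_coe] at h₁
      change Coalgebra.comul (R := k) (TensorProduct.lid k O _) = _
      rw [comul_lid_rTensor_assoc, ← h₁, LinearEquiv.symm_apply_apply, hrho a ha, map_sum, map_sum,
        hba]
      rfl)
    (fun b a hb hba => by
      have h₁ := congrFun (congrArg DFunLike.coe hr.counit_coact) (pathClass I a)
      simp only [LinearMap.comp_apply, LinearEquiv.coe_coe, LinearMap.id_apply] at h₁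
      change Coalgebra.counit (R := k) (TensorProduct.lid k O _) = _
      rw [counit_lid_rTensor, h₁, hf a b hb]
      exact if_congr eq_comm rfl rfl)
    hbase.2 hbase.1
    (fun {i j i' j'} p q => by
      have h₁ := hr.map_mul (pathClass I (Concatenation.triv i')) (pathClass I (.arrow q))
      rw [pathClass_triv_mul, if_pos (show i' = Concatenation.src (QPath.arrow q) from rfl),
        hrho₀, hrho _ (QPath.length_arrow_lt_two q), QPath.length_arrow,
        Finset.sum_mul_sum, Finset.sum_comm] at h₁
      have h₂ := hcoeff 1 Nat.one_lt_two (fun c => y c (.arrow q)) (.arrow p) rfl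
      rw [h₁] at h₂
      refine Eq.trans ?_ h₂
      symm
      refine (congrArg (fun z => TensorProduct.lid k O (LinearMap.rTensor O (f (.arrow p)) z))
        ?_).trans (hcoeff 1 Nat.one_lt_two (fun c => y (Concatenation.triv (Concatenation.src c))
          (Concatenation.triv i') * y c (.arrow q)) (.arrow p) rfl)
      refine Finset.sum_congr rfl fun c _ => ?_
      simp only [Algebra.TensorProduct.tmul_mul_tmul, pathClass_triv_mul, TensorProduct.ite_tmul,
        Finset.sum_ite_eq', Finset.mem_univ, if_true])
    (fun {i j i' j'} p q => by
      have h₁ := hr.map_mul (pathClass I (.arrow q)) (pathClass I (Concatenation.triv j'))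
      rw [pathClass_mul_triv, if_pos (show Concatenation.tgt (QPath.arrow q) = j' from rfl),
        hrho₀, hrho _ (QPath.length_arrow_lt_two q), QPath.length_arrow,
        Finset.sum_mul_sum] at h₁
      have h₂ := hcoeff 1 Nat.one_lt_two (fun c => y c (.arrow q)) (.arrow p) rfl
      rw [h₁] at h₂
      refine Eq.trans ?_ h₂
      symm
      refine (congrArg (fun z => TensorProduct.lid k O (LinearMap.rTensor O (f (.arrow p)) z))
        ?_).trans (hcoeff 1 Nat.one_lt_two (fun c => y c (.arrow q) *
          y (Concatenation.triv (Concatenation.tgt c)) (Concatenation.triv j')) (.arrow p) rfl)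
      refine Finset.sum_congr rfl fun c _ => ?_
      simp only [Algebra.TensorProduct.tmul_mul_tmul, pathClass_mul_triv, TensorProduct.ite_tmul,
        Finset.sum_ite_eq, Finset.mem_univ, if_true])
  refine ⟨π, fun a ha => ?_⟩
  rw [hrho a ha]
  refine Finset.sum_congr rfl fun c hc => ?_
  have hca := QPath.mem_ofLength.1 hc
  rw [hπ c a (hca ▸ ha) hca]

end PathAlgebra

/-! ### Surjectivity from universality -/

section Generation

variable {k : Type*} [Field k] {Q : Type u} [Quiver.{v} Q] [Fintype Q]
  {I : Ideal (PathAlgebra k Q)} [I.IsTwoSided]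
  {K O : Type*} [Ring K] [Algebra k K] [Coalgebra k K] [Ring O] [Algebra k O] [Coalgebra k O]

open PathAlgebra

/-- A multiplicative left coaction on `kQ/I` has its coefficients in the image of `ι` once it does so
on vertices and arrows. -/
theorem mem_range_rTensor_of_length_lt_two (ι : K →ₐc[k] O)
    {lam : PathAlgebra k Q ⧸ I →ₗ[k] O ⊗[k] (PathAlgebra k Q ⧸ I)}
    (hmul : ∀ a b, lam (a * b) = lam a * lam b)
    (h : ∀ a : QPath Q, a.length < 2 → lam (pathClass I a) ∈
      LinearMap.range (LinearMap.rTensor (PathAlgebra k Q ⧸ I) (ι : K →ₗ[k] O)))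
    (x : PathAlgebra k Q ⧸ I) :
    lam x ∈ LinearMap.range (LinearMap.rTensor (PathAlgebra k Q ⧸ I) (ι : K →ₗ[k] O)) := by
  refine mem_of_mem_of_length_lt_two hmul ?_ h x
  rintro _ ⟨z, rfl⟩ _ ⟨w, rfl⟩
  exact ⟨z * w, map_mul (Algebra.TensorProduct.map (ι : K →ₐ[k] O) (AlgHom.id k _)) z w⟩

/-- A multiplicative right coaction on `kQ/I` has its coefficients in the image of `ι` once it does so
on vertices and arrows. -/
theorem mem_range_lTensor_of_length_lt_two (ι : K →ₐc[k] O)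
    {rho : PathAlgebra k Q ⧸ I →ₗ[k] (PathAlgebra k Q ⧸ I) ⊗[k] O}
    (hmul : ∀ a b, rho (a * b) = rho a * rho b)
    (h : ∀ a : QPath Q, a.length < 2 → rho (pathClass I a) ∈
      LinearMap.range (LinearMap.lTensor (PathAlgebra k Q ⧸ I) (ι : K →ₗ[k] O)))
    (x : PathAlgebra k Q ⧸ I) :
    rho x ∈ LinearMap.range (LinearMap.lTensor (PathAlgebra k Q ⧸ I) (ι : K →ₗ[k] O)) := by
  refine mem_of_mem_of_length_lt_two hmul ?_ h x
  rintro _ ⟨z, rfl⟩ _ ⟨w, rfl⟩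
  exact ⟨z * w, map_mul (Algebra.TensorProduct.map (AlgHom.id k _) (ι : K →ₐ[k] O)) z w⟩

/-- Transposed coactions have the same coefficients. -/
theorem IsTransposed.mem_range {A : Type*} [Ring A] [Algebra k A] {𝒜 : ℕ → Submodule k A}
    (ι : K →ₐc[k] O) {lam : A →ₗ[k] O ⊗[k] A} {rho : A →ₗ[k] A ⊗[k] O}
    (ht : IsTransposed 𝒜 O lam rho)
    (h : ∀ a, lam a ∈ LinearMap.range (LinearMap.rTensor A (ι : K →ₗ[k] O)))
    {n : ℕ} {a : A} (ha : a ∈ 𝒜 n) :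
    rho a ∈ LinearMap.range (LinearMap.lTensor A (ι : K →ₗ[k] O)) := by
  classical
  obtain ⟨d, b, z, hl, hr⟩ := ht n
  obtain ⟨r, hr'⟩ := LinearMap.exists_leftInverse_of_injective (𝒜 n).subtype
    (LinearMap.ker_eq_bot.2 (𝒜 n).subtype_injective)
  have hr'' (x : 𝒜 n) : r x = x := congrFun (congrArg DFunLike.coe hr') x
  have hz (j l : Fin d) : z j l ∈ LinearMap.range (ι : K →ₗ[k] O) := by
    obtain ⟨w, hw⟩ := h (b j)
    have := rid_lTensor_rTensor (ι : K →ₗ[k] O) (b.coord l ∘ₗ r) w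
    rw [hw, hl] at this
    simp only [map_sum, LinearMap.lTensor_tmul, LinearMap.comp_apply, hr'', Module.Basis.coord_apply,
      Module.Basis.repr_self, Finsupp.single_apply, TensorProduct.rid_tmul, ite_smul, one_smul,
      zero_smul, Finset.sum_ite_eq', Finset.mem_univ, if_true] at this
    exact ⟨_, this.symm⟩
  have key : (⊤ : Submodule k (𝒜 n)) ≤ (LinearMap.range
      (LinearMap.lTensor A (ι : K →ₗ[k] O))).comap (rho ∘ₗ (𝒜 n).subtype) := by
    rw [← b.span_eq, Submodule.span_le]
    rintro _ ⟨j, rfl⟩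
    change rho (b j) ∈ LinearMap.range (LinearMap.lTensor A (ι : K →ₗ[k] O))
    rw [hr]
    refine Submodule.sum_mem _ fun l _ => ?_
    obtain ⟨w, hw⟩ := hz l j
    exact ⟨(b l : A) ⊗ₜ[k] w, by rw [LinearMap.lTensor_tmul, hw]⟩
  exact key (Submodule.mem_top (x := ⟨a, ha⟩))

theorem BialgHom.surjective_of_comp_eq_id {ι : K →ₐc[k] O} (π : O →ₐc[k] K)
    (h : ι.comp π = BialgHom.id k O) : Function.Surjective ι :=
  fun x => ⟨π x, congrFun (congrArg DFunLike.coe h) x⟩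

end Generation

section Surjectivity

variable {k : Type*} [Field k] {Q : Type u} [Quiver.{v} Q] [Fintype Q]
  [∀ i j : Q, Finite (i ⟶ j)] {I : Ideal (PathAlgebra k Q)} [I.IsTwoSided]
  {O : Type w} [Ring O] [Algebra k O] [Coalgebra k O] [WeakBialgebra k O]

open PathAlgebra

/-- By universality, a left UQSGd has no proper sub-weak-bialgebra containing the coefficients of its
coaction. -/
theorem exists_surjective_of_isLeftUQSGd (hI : IsGeneratedInDegreeGETwo I)
    {lam : PathAlgebra k Q ⧸ I →ₗ[k] O ⊗[k] (PathAlgebra k Q ⧸ I)}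
    (hO : IsLeftUQSGd (quotGrade I) O lam) :
    ∃ π : FaceAlgebra k Q →ₐc[k] O, Function.Surjective π := by
  obtain ⟨π, hπ⟩ := exists_bialgHom_of_left hI hO.coaction hO.base
  obtain ⟨K, _, _, _, _, ι, hι, hrange⟩ := BialgHom.exists_image π
  have hlam := mem_range_rTensor_of_length_lt_two ι hO.coaction.map_mul fun a ha => by
    rw [hπ a ha]
    refine Submodule.sum_mem _ fun c _ => ?_
    obtain ⟨w, hw⟩ := hrange.ge ⟨FaceAlgebra.x k a c, rfl⟩
    exact ⟨w ⊗ₜ[k] pathClass I c, by rw [LinearMap.rTensor_tmul, hw]; rfl⟩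
  obtain ⟨lamK, hlamK⟩ := exists_rTensor_lift hι hlam
  obtain ⟨θ, hθ, -⟩ := hO.universal K lamK (hO.coaction.restrict hι hlamK) (hO.base.restrict hι hlamK)
  have hid := (hO.universal O lam hO.coaction hO.base).unique
    (y₁ := ι.comp θ) (y₂ := BialgHom.id k O)
    (by
      refine LinearMap.ext fun a => ?_
      rw [← hlamK a, ← hθ]
      exact LinearMap.rTensor_comp_apply _ (ι : K →ₗ[k] O) (θ : O →ₗ[k] K) (lam a))
    (LinearMap.ext fun a => LinearMap.rTensor_id_apply _ _ (lam a))
  refine ⟨π, fun x => ?_⟩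
  obtain ⟨y, rfl⟩ := BialgHom.surjective_of_comp_eq_id θ hid x
  exact hrange.le ⟨y, rfl⟩

/-- By universality, a right UQSGd has no proper sub-weak-bialgebra containing the coefficients of its
coaction. -/
theorem exists_surjective_of_isRightUQSGd (hI : IsGeneratedInDegreeGETwo I)
    {rho : PathAlgebra k Q ⧸ I →ₗ[k] (PathAlgebra k Q ⧸ I) ⊗[k] O}
    (hO : IsRightUQSGd (quotGrade I) O rho) :
    ∃ π : FaceAlgebra k Q →ₐc[k] O, Function.Surjective π := by
  obtain ⟨π, hπ⟩ := exists_bialgHom_of_right hI hO.coaction hO.base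
  obtain ⟨K, _, _, _, _, ι, hι, hrange⟩ := BialgHom.exists_image π
  have hrho := mem_range_lTensor_of_length_lt_two ι hO.coaction.map_mul fun a ha => by
    rw [hπ a ha]
    refine Submodule.sum_mem _ fun c _ => ?_
    obtain ⟨w, hw⟩ := hrange.ge ⟨FaceAlgebra.x k c a, rfl⟩
    exact ⟨pathClass I c ⊗ₜ[k] w, by rw [LinearMap.lTensor_tmul, hw]; rfl⟩
  obtain ⟨rhoK, hrhoK⟩ := exists_lTensor_lift hι hrho
  obtain ⟨θ, hθ, -⟩ := hO.universal K rhoK (hO.coaction.restrict hι hrhoK) (hO.base.restrict hι hrhoK)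
  have hid := (hO.universal O rho hO.coaction hO.base).unique
    (y₁ := ι.comp θ) (y₂ := BialgHom.id k O)
    (by
      refine LinearMap.ext fun a => ?_
      rw [← hrhoK a, ← hθ]
      exact LinearMap.lTensor_comp_apply _ (ι : K →ₗ[k] O) (θ : O →ₗ[k] K) (rho a))
    (LinearMap.ext fun a => LinearMap.lTensor_id_apply _ _ (rho a))
  refine ⟨π, fun x => ?_⟩
  obtain ⟨y, rfl⟩ := BialgHom.surjective_of_comp_eq_id θ hid x
  exact hrange.le ⟨y, rfl⟩

/-- By universality, a transposed UQSGd has no proper sub-weak-bialgebra containing the coefficients of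
its coactions. -/
theorem exists_surjective_of_isTransUQSGd (hI : IsGeneratedInDegreeGETwo I)
    {lam : PathAlgebra k Q ⧸ I →ₗ[k] O ⊗[k] (PathAlgebra k Q ⧸ I)}
    {rho : PathAlgebra k Q ⧸ I →ₗ[k] (PathAlgebra k Q ⧸ I) ⊗[k] O}
    (hO : IsTransUQSGd (quotGrade I) O lam rho) :
    ∃ π : FaceAlgebra k Q →ₐc[k] O, Function.Surjective π := by
  obtain ⟨π, hπ⟩ := exists_bialgHom_of_left hI hO.coaction_left hO.base_left
  obtain ⟨K, _, _, _, _, ι, hι, hrange⟩ := BialgHom.exists_image π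
  have hlam := mem_range_rTensor_of_length_lt_two ι hO.coaction_left.map_mul fun a ha => by
    rw [hπ a ha]
    refine Submodule.sum_mem _ fun c _ => ?_
    obtain ⟨w, hw⟩ := hrange.ge ⟨FaceAlgebra.x k a c, rfl⟩
    exact ⟨w ⊗ₜ[k] pathClass I c, by rw [LinearMap.rTensor_tmul, hw]; rfl⟩
  have hrho := mem_range_lTensor_of_length_lt_two ι hO.coaction_right.map_mul fun a _ =>
    hO.transposed.mem_range ι hlam (pathClass_mem a)
  obtain ⟨lamK, hlamK⟩ := exists_rTensor_lift hι hlam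
  obtain ⟨rhoK, hrhoK⟩ := exists_lTensor_lift hι hrho
  obtain ⟨θ, ⟨hθ, hθ'⟩, -⟩ := hO.universal K lamK rhoK (hO.coaction_left.restrict hι hlamK)
    (hO.coaction_right.restrict hι hrhoK) (hO.transposed.restrict hι hlamK hrhoK)
    (hO.base_left.restrict hι hlamK) (hO.base_right.restrict hι hrhoK)
  have hid := (hO.universal O lam rho hO.coaction_left hO.coaction_right hO.transposed hO.base_left
    hO.base_right).unique (y₁ := ι.comp θ) (y₂ := BialgHom.id k O)
    (by
      refine ⟨LinearMap.ext fun a => ?_, LinearMap.ext fun a => ?_⟩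
      · rw [← hlamK a, ← hθ]
        exact LinearMap.rTensor_comp_apply _ (ι : K →ₗ[k] O) (θ : O →ₗ[k] K) (lam a)
      · rw [← hrhoK a, ← hθ']
        exact LinearMap.lTensor_comp_apply _ (ι : K →ₗ[k] O) (θ : O →ₗ[k] K) (rho a))
    ⟨LinearMap.ext fun a => LinearMap.rTensor_id_apply _ _ (lam a),
      LinearMap.ext fun a => LinearMap.lTensor_id_apply _ _ (rho a)⟩
  refine ⟨π, fun x => ?_⟩
  obtain ⟨y, rfl⟩ := BialgHom.surjective_of_comp_eq_id θ hid x
  exact hrange.le ⟨y, rfl⟩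

end Surjectivity

/-- If a left, right or transposed UQSGd `O` of `kQ/I` exists, there is a surjective weak bialgebra
map `π : H(Q) → O` that induces an isomorphism of weak bialgebras `H(Q)/J ≅ O` for some biideal
`J`. -/
theorem proposition1p2 {k : Type*} [Field k] {Q : Type u} [Quiver.{v} Q] [Fintype Q]
    [∀ i j : Q, Finite (i ⟶ j)] (I : Ideal (PathAlgebra k Q)) [I.IsTwoSided]
    (hI : PathAlgebra.IsGeneratedInDegreeGETwo I)
    (O : Type w) [Ring O] [Algebra k O] [Coalgebra k O] [WeakBialgebra k O]
    (hO : (∃ lam, IsLeftUQSGd (PathAlgebra.quotGrade I) O lam) ∨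
      (∃ rho, IsRightUQSGd (PathAlgebra.quotGrade I) O rho) ∨
      (∃ lam rho, IsTransUQSGd (PathAlgebra.quotGrade I) O lam rho)) :
    ∃ π : FaceAlgebra k Q →ₐc[k] O, Function.Surjective π ∧
      ∃ (J : Biideal k (FaceAlgebra k Q)) (e : J.Quotient ≃ₐc[k] O),
        ∀ h : FaceAlgebra k Q, e (J.proj h) = π h := by
  obtain ⟨π, hπ⟩ : ∃ π : FaceAlgebra k Q →ₐc[k] O, Function.Surjective π := by
    rcases hO with ⟨lam, h⟩ | ⟨rho, h⟩ | ⟨lam, rho, h⟩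
    · exact exists_surjective_of_isLeftUQSGd hI h
    · exact exists_surjective_of_isRightUQSGd hI h
    · exact exists_surjective_of_isTransUQSGd hI h
  exact ⟨π, hπ, BialgHom.exists_quotient_equiv π hπ⟩
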